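/- Let $T>0$, $n,k\ge 1$, and consider the system $$(\Lambda_k+\mathcal V)\upsilon:=\sum_{i=0}^k A_i\,\upsilon^{(i)}(t)+\int_0^t K(t-s)\,\upsilon(s)\,ds=f(t),\qquad t\in[0,T],\tag{1}$$ where $A_0,\dots,A_k$ are constant real $n\times n$ matrices with $\det A_k=0$, $K$ is an $n\times n$ matrix function that is real analytic on (a neighbourhood of) $[0,T]$, and $f\in C^\infty([0,T];\mathbb R^n)$. *Left regularizing operator.* An operator $\Omega_l=\sum_{j=0}^l L_j (d/dt)^j$ with constant $n\times n$ matrices $L_j$ is a left regularizing operator (LRO) for $\Lambda_k+\mathcal V$ if there are continuous $n\times n$ matrix functions $\tilde A_0,\dots,\tilde A_k,\tilde K$ on $[0,T]$ with $\det\tilde A_k(t)\ne0$ for all $t\in[0,T]$ such that $$\Omega_l\big((\Lambda_k+\mathcal V)z\big)(t)=\sum_{i=0}^k\tilde A_i(t)z^{(i)}(t)+\int_0^t\tilde K(t-s)z(s)\,ds\qquad\text{for all } z\in C^{l+k}([0,T];\mathbb R^n),\ t\in[0,T].$$ *Reduction.* The reduction acts on systems $\sum_{i\le k}A_i\upsilon^{(i)}+\int_0^tK(t-s)\upsilon(s)ds=f(t)+W(t)c$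 of the above kind (any $k\ge0$, any number $n \ge 0$ of unknowns) whose right-hand side is smooth and may contain a vector $c$ of arbitrary constants; for (1) there are none. It stops successfully when the leading coefficient is nonsingular ($\det A_k\neq0$, which includes the case of no unknowns). Otherwise one may perform the following steps. (a) *Splitting and substitution.* Choose constant invertible matrices $P,Q$, put $\upsilon=Qw$, $w=(w_1,w_2)$ with $w_2$ of dimension $n_2\ge1$ and $w_1$ of dimension $n_1=n-n_2\ge0$, and split the equations multiplied by $P$ into blocks of $n_1$ and $n_2$ equations, so that the second block has an order $\kappa<k$ and an invertible coefficient at $w_2^{(\kappa)}$. Write this block as $$\sum_{i\le\kappa}A_{i,22}w_2^{(i)}+\int_0^tK_{22}(t-s)w_2(s)ds=\psi(t),$$ where $\psi$ collects the right-hand side and the terms with $w_1$. Solve it by $$w_2(t)=W_2(t)c_2+\int_0^t\mathcal K_{22}(t-s)\psi(s)\,ds$$ (plus the term $A_{0,22}^{-1}\psi(t)$ if $\kappa=0$), where $W_2$ is a fundamental matrix of the homogeneous equation, $\mathcal K_{22}$ is the real analytic resolvent kernel and $c_2$ is an arbitrary constant vector. Substitute this into the first block. The result is a system of the same kind in the $n_1$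 unknowns $w_1$, of order at most $k$, with constant coefficients and a real analytic convolution kernel, and with $c_2$ among the arbitrary constants on the right-hand side. (Here the terms $\int_0^t \mathcal K_{22}(t-s)\,w_1^{(i)}(s)\,ds$ are integrated by parts, and the resulting terms with initial values $w_1^{(i)}(0)$, $i<\kappa$, are absorbed in the arbitrary vector $c_2$ by a linear shift.) (b) *Differentiation.* If, after multiplication by a constant invertible matrix, some nonempty group of equations is purely integral, $\int_0^tK_2(t-s)\upsilon(s)ds=f_2(t)$, replace it by $$K_2^{(j-1)}(0)\upsilon(t)+\int_0^tK_2^{(j)}(t-s)\upsilon(s)ds=f_2^{(j)}(t),$$ where $j\ge1$ is the least number with $K_2^{(j-1)}(0)\ne0$; the other equations do not change. The reduction of (1) *can be performed* if some finite sequence of steps (a), (b) leads from (1) to a system with nonsingular leading coefficient. **Theorem.** The reduction of (1) can be performed if and only if there exists a left regularizing operator for $\Lambda_k+\mathcal V$. -/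

import Mathlib

open Set

open scoped ContDiff Matrix

/-- The operator `z ↦ ∑_{i ≤ k} A_i(t) z^{(i)}(t) + ∫_0^t K(t - s) z(s) ds` on `[0,T]`
(derivatives at the end points are one-sided). The matrices may be rectangular. -/
noncomputable def volterraOp {α β : Type} [Fintype α] [Fintype β] (T : ℝ) (k : ℕ)
    (A : ℕ → ℝ → Matrix α β ℝ) (K : ℝ → Matrix α β ℝ) (z : ℝ → β → ℝ) (t : ℝ) : α → ℝ :=
  (∑ i ∈ Finset.range (k + 1), A i t *ᵥ iteratedDerivWithin i z (Icc 0 T) t)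
    + ∫ s in (0 : ℝ)..t, K (t - s) *ᵥ z s

/-- The same operator with constant coefficients `A_0, …, A_k`. -/
noncomputable def constOp {α β : Type} [Fintype α] [Fintype β] (T : ℝ) (k : ℕ)
    (A : ℕ → Matrix α β ℝ) (K : ℝ → Matrix α β ℝ) (z : ℝ → β → ℝ) (t : ℝ) : α → ℝ :=
  volterraOp T k (fun i _ => A i) K z t

/-- A system of `n` integral-differential equations in `n` unknown functions on `[0,T]`,
`∑_{i ≤ k} A_i v^{(i)}(t) + ∫_0^t K(t - s) v(s) ds = f(t) + W(t) c`,
with constant matrices `A_0, …, A_k`, `k = order` (the values `A_i` with `i > k` are not used), a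
kernel that is real analytic on (a neighbourhood of) `[0,T]`, and a smooth right-hand side that
may contain `p` arbitrary constants, collected in the vector `c`. -/
structure IDESystem (T : ℝ) (n p : ℕ) where
  order : ℕ
  A : ℕ → Matrix (Fin n) (Fin n) ℝ
  K : ℝ → Matrix (Fin n) (Fin n) ℝ
  W : ℝ → Matrix (Fin n) (Fin p) ℝ
  f : ℝ → Fin n → ℝ
  analytic_K : ∀ a b, AnalyticOnNhd ℝ (fun u => K u a b) (Icc 0 T)
  smooth_W : ∀ a b, ContDiffOn ℝ ∞ (fun t => W t a b) (Icc 0 T)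
  smooth_f : ContDiffOn ℝ ∞ f (Icc 0 T)

namespace IDESystem

variable {T : ℝ} {n p : ℕ}

/-- The operator on the left-hand side of the system. -/
noncomputable def op (S : IDESystem T n p) (v : ℝ → Fin n → ℝ) (t : ℝ) : Fin n → ℝ :=
  constOp T S.order S.A S.K v t

/-- The right-hand side of the system, for the value `c` of the arbitrary constants. -/
def rhs (S : IDESystem T n p) (c : Fin p → ℝ) (t : ℝ) : Fin n → ℝ :=
  S.f t + S.W t *ᵥ c

/-- `∑_{j ≤ l} L_j (d/dt)^j` is a left regularizing operator: its composition with the operator of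
the system is again an operator of order `k`, with continuous coefficients and a continuous
convolution kernel, and the leading coefficient is nonsingular on `[0,T]`. -/
def IsLeftRegularizing (S : IDESystem T n p) (l : ℕ) (L : ℕ → Matrix (Fin n) (Fin n) ℝ) : Prop :=
  ∃ (A' : ℕ → ℝ → Matrix (Fin n) (Fin n) ℝ) (K' : ℝ → Matrix (Fin n) (Fin n) ℝ),
    (∀ i ≤ S.order, ∀ a b, ContinuousOn (fun t => A' i t a b) (Icc 0 T)) ∧
    (∀ a b, ContinuousOn (fun u => K' u a b) (Icc 0 T)) ∧
    (∀ t ∈ Icc 0 T, (A' S.order t).det ≠ 0) ∧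
    ∀ z : ℝ → Fin n → ℝ, ContDiffOn ℝ (l + S.order : ℕ) z (Icc 0 T) →
      ∀ t ∈ Icc 0 T,
        (∑ j ∈ Finset.range (l + 1), L j *ᵥ iteratedDerivWithin j (S.op z) (Icc 0 T) t)
          = volterraOp T S.order A' K' z t

/-- The operator of the system has a left regularizing operator. -/
def HasLRO (S : IDESystem T n p) : Prop :=
  ∃ (l : ℕ) (L : ℕ → Matrix (Fin n) (Fin n) ℝ), S.IsLeftRegularizing l L

end IDESystem

/-- `X` is a fundamental matrix of the homogeneous system `∑_{i ≤ κ} A_i z^{(i)} + K * z = 0`: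
its columns form a basis of the space of `C^κ` solutions on `[0,T]`. -/
def IsFundamentalMatrix {m d : ℕ} (T : ℝ) (κ : ℕ) (A : ℕ → Matrix (Fin m) (Fin m) ℝ)
    (K : ℝ → Matrix (Fin m) (Fin m) ℝ) (X : ℝ → Matrix (Fin m) (Fin d) ℝ) : Prop :=
  (∀ a b, ContDiffOn ℝ κ (fun t => X t a b) (Icc 0 T)) ∧
  (∀ c : Fin d → ℝ, ∀ t ∈ Icc 0 T, constOp T κ A K (fun s => X s *ᵥ c) t = 0) ∧
  ∀ z : ℝ → Fin m → ℝ, ContDiffOn ℝ κ z (Icc 0 T) →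
    (∀ t ∈ Icc 0 T, constOp T κ A K z t = 0) →
    ∃! c : Fin d → ℝ, ∀ t ∈ Icc 0 T, z t = X t *ᵥ c

/-- The function `∫_0^t R(t - s) ψ(s) ds`, to which the term `A_0⁻¹ ψ(t)` is added
when the order `κ` is zero (a Volterra equation of the second kind). -/
noncomputable def resolventApply {m : ℕ} (κ : ℕ) (A : ℕ → Matrix (Fin m) (Fin m) ℝ)
    (R : ℝ → Matrix (Fin m) (Fin m) ℝ) (ψ : ℝ → Fin m → ℝ) (t : ℝ) : Fin m → ℝ :=
  (if κ = 0 then (A 0)⁻¹ *ᵥ ψ t else 0) + ∫ s in (0 : ℝ)..t, R (t - s) *ᵥ ψ s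

/-- `R` is the resolvent kernel of `∑_{i ≤ κ} A_i z^{(i)} + K * z`: it is real analytic, and for
every continuous `ψ` the function `resolventApply κ A R ψ` is a solution with right-hand
side `ψ`. -/
def IsResolventKernel {m : ℕ} (T : ℝ) (κ : ℕ) (A : ℕ → Matrix (Fin m) (Fin m) ℝ)
    (K R : ℝ → Matrix (Fin m) (Fin m) ℝ) : Prop :=
  (∀ a b, AnalyticOnNhd ℝ (fun u => R u a b) (Icc 0 T)) ∧
  ∀ ψ : ℝ → Fin m → ℝ, ContinuousOn ψ (Icc 0 T) →
    ContDiffOn ℝ κ (resolventApply κ A R ψ) (Icc 0 T) ∧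
    ∀ t ∈ Icc 0 T, constOp T κ A K (resolventApply κ A R ψ) t = ψ t

namespace IDESystem

variable {T : ℝ}

/-- One splitting step, from a system `S` in `n` unknowns to a system `S₁` in `n₁ < n` unknowns.
After multiplication by an invertible `P` and the change of unknowns `v = Q (w₁, w₂)` the second
block of equations has order `κ < k` and a nonsingular coefficient at `w₂^{(κ)}`.
It is solved for `w₂` by a fundamental matrix `W₂` and the resolvent kernel `R`,
`w₂ = W₂ c₂ + resolvent (ψ)`, where `ψ` is the right-hand side minus the terms with `w₁`, and the
result is substituted into the first block. What is obtained is the system `S₁` for `w₁`, with the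
`d` components of `c₂` as additional arbitrary constants.
The matrices `Θ_i` account for the boundary terms of the integrations by parts that bring
`∫_0^t R(t - s) w₁^{(i)}(s) ds` to convolution form: they only shift the
arbitrary vector `c₂` by a linear combination of the initial values `w₁^{(i)}(0)`, `i < κ`. -/
def SplitStep {n p n₁ d : ℕ} (S : IDESystem T n p) (S₁ : IDESystem T n₁ (p + d)) : Prop :=
  ∃ (n₂ κ : ℕ)
    (P Q' : Matrix (Fin n₁ ⊕ Fin n₂) (Fin n) ℝ) (Q P' : Matrix (Fin n) (Fin n₁ ⊕ Fin n₂) ℝ)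
    (W₂ : ℝ → Matrix (Fin n₂) (Fin d) ℝ) (R : ℝ → Matrix (Fin n₂) (Fin n₂) ℝ)
    (Θ : ℕ → Matrix (Fin d) (Fin n₁) ℝ),
    let B : ℕ → Matrix (Fin n₁ ⊕ Fin n₂) (Fin n₁ ⊕ Fin n₂) ℝ := fun i => P * S.A i * Q
    let N : ℝ → Matrix (Fin n₁ ⊕ Fin n₂) (Fin n₁ ⊕ Fin n₂) ℝ := fun u => P * S.K u * Q
    let B₂₂ : ℕ → Matrix (Fin n₂) (Fin n₂) ℝ := fun i => (B i).toBlocks₂₂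
    let N₂₂ : ℝ → Matrix (Fin n₂) (Fin n₂) ℝ := fun u => (N u).toBlocks₂₂
    let g₁ : (Fin p → ℝ) → ℝ → Fin n₁ → ℝ := fun c t a => (P *ᵥ S.rhs c t) (Sum.inl a)
    let g₂ : (Fin p → ℝ) → ℝ → Fin n₂ → ℝ := fun c t a => (P *ᵥ S.rhs c t) (Sum.inr a)
    0 < n₂ ∧ κ < S.order ∧ S₁.order ≤ S.order ∧
    -- `P` and `Q` are invertible, hence `n = n₁ + n₂`
    (P * P' = 1 ∧ P' * P = 1) ∧ (Q * Q' = 1 ∧ Q' * Q = 1) ∧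
    -- the second block has order `κ`, and its leading coefficient at `w₂` is nonsingular
    (∀ i, κ < i → i ≤ S.order → (B i).toBlocks₂₁ = 0 ∧ (B i).toBlocks₂₂ = 0) ∧
    (B₂₂ κ).det ≠ 0 ∧
    -- solution of the second block with respect to `w₂`
    IsFundamentalMatrix T κ B₂₂ N₂₂ W₂ ∧
    IsResolventKernel T κ B₂₂ N₂₂ R ∧
    -- substitution into the first block
    ∀ (w₁ : ℝ → Fin n₁ → ℝ), ContDiffOn ℝ S.order w₁ (Icc 0 T) →
      ∀ (c : Fin p → ℝ) (c₂ : Fin d → ℝ),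
        let ψ : ℝ → Fin n₂ → ℝ := fun t =>
          g₂ c t - constOp T κ (fun i => (B i).toBlocks₂₁) (fun u => (N u).toBlocks₂₁) w₁ t
        let w₂ : ℝ → Fin n₂ → ℝ := fun t => W₂ t *ᵥ c₂ + resolventApply κ B₂₂ R ψ t
        ∀ t ∈ Icc 0 T,
          constOp T S.order (fun i => (B i).toBlocks₁₁) (fun u => (N u).toBlocks₁₁) w₁ t
            + constOp T S.order (fun i => (B i).toBlocks₁₂) (fun u => (N u).toBlocks₁₂) w₂ t
            - g₁ c t
          = S₁.op w₁ t
            - S₁.rhs (Fin.append c (c₂ + ∑ i ∈ Finset.range κ,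
                Θ i *ᵥ iteratedDerivWithin i w₁ (Icc 0 T) 0)) t

/-- One differentiation step. After multiplication by an invertible `P` the equations with
indices in the nonempty set `D` are purely integral, `∫_0^t K₂(t - s) v(s) ds = f₂(t)`. They are
differentiated `j ≥ 1` times, until a nonzero coefficient `K₂^{(j-1)}(0)` at `v(t)` appears:
they become `K₂^{(j-1)}(0) v(t) + ∫_0^t K₂^{(j)}(t - s) v(s) ds = f₂^{(j)}(t)`.
The other equations do not change. -/
def DiffStep {n p : ℕ} (S S' : IDESystem T n p) : Prop :=
  ∃ (P : Matrix (Fin n) (Fin n) ℝ) (D : Finset (Fin n)) (j : ℕ),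
    let K₂ : Fin n → Fin n → ℝ → ℝ := fun a b u => (P * S.K u) a b
    P.det ≠ 0 ∧ D.Nonempty ∧ 1 ≤ j ∧ S'.order = S.order ∧
    -- the equations with indices in `D` are purely integral
    (∀ a ∈ D, ∀ i ≤ S.order, ∀ b, (P * S.A i) a b = 0) ∧
    -- the number `j` of differentiations is the first one that gives a nonzero coefficient
    (∀ i, i + 1 < j → ∀ a ∈ D, ∀ b, iteratedDeriv i (K₂ a b) 0 = 0) ∧
    (∃ a ∈ D, ∃ b, iteratedDeriv (j - 1) (K₂ a b) 0 ≠ 0) ∧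
    -- the new equations
    (∀ a ∈ D,
      (∀ b, S'.A 0 a b = iteratedDeriv (j - 1) (K₂ a b) 0) ∧
      (∀ i, 1 ≤ i → i ≤ S.order → ∀ b, S'.A i a b = 0) ∧
      (∀ u ∈ Icc 0 T, ∀ b, S'.K u a b = iteratedDeriv j (K₂ a b) u) ∧
      (∀ c : Fin p → ℝ, ∀ t ∈ Icc 0 T,
        S'.rhs c t a = iteratedDerivWithin j (fun s => (P *ᵥ S.rhs c s) a) (Icc 0 T) t)) ∧
    -- the remaining equations
    (∀ a ∉ D,
      (∀ i ≤ S.order, ∀ b, S'.A i a b = (P * S.A i) a b) ∧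
      (∀ u ∈ Icc 0 T, ∀ b, S'.K u a b = K₂ a b u) ∧
      (∀ c : Fin p → ℝ, ∀ t ∈ Icc 0 T, S'.rhs c t a = (P *ᵥ S.rhs c t) a))

/-- The reduction can be performed: finitely many splitting and differentiation steps lead to
a system whose leading coefficient is nonsingular (a system without unknowns included). -/
inductive CanReduce : {n p : ℕ} → IDESystem T n p → Prop
  | done {n p : ℕ} (S : IDESystem T n p) (h : (S.A S.order).det ≠ 0) : CanReduce S
  | split {n p n₁ d : ℕ} (S : IDESystem T n p) (S₁ : IDESystem T n₁ (p + d))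
      (h : SplitStep S S₁) (h₁ : CanReduce S₁) : CanReduce S
  | differentiate {n p : ℕ} (S S' : IDESystem T n p)
      (h : DiffStep S S') (h' : CanReduce S') : CanReduce S

end IDESystem

/-! Under a formal Laplace transform, with `X` in place of the inverse of the Laplace variable, the
operator of a system becomes a square matrix `M` of power series: after multiplication by `X^k`, the
coefficient `A_i` contributes `A_i X^(k-i)` and the Taylor coefficient `K^(m)(0)` of the kernel
contributes `K^(m)(0) X^(k+1+m)`. Both sides of the equivalence turn out to say that `det M ≠ 0`.

Regularization. Applying `∑ L_j (d/dt)^j` multiplies `M` by `∑ L_j X^(l-j)`, up to the normalizing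
power of `X`. A left regularizing operator makes this product `X^l U` with `U(0)` the leading
coefficient at `t = 0`, hence invertible, and so `det M ≠ 0` (`det_symbol_ne_zero_of_hasLRO`).
Conversely, write `det M = X^l u` with `u` a unit. Then `u⁻¹ adj M` is a left inverse of `M` up to
`X^l`, and its truncation at degree `l` is a regularizing operator (`hasLRO_of_det_symbol_ne_zero`).

Reduction. Both kinds of steps preserve nonvanishing of the determinant: a differentiation divides
some rows by `X^j`, up to a constant invertible factor (`diagonal_mul_symbol_of_diffStep`), and a
splitting is block elimination with an invertible pivot (`det_symbol_ne_zero_iff_of_splitStep`).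
Since `M(0) = A_k`, a reduction that succeeds forces `det M ≠ 0`. Conversely, if `det M ≠ 0` and
`A_k` is singular, take a row `q ≠ 0` with `q A_k = 0`. Either some `q A_i` is nonzero, and one
unknown can be eliminated, or the combined equation is purely integral. Its kernel then has a
nonzero derivative at `0`, as otherwise `M` would have dependent rows, and differentiation lowers
the order of `det M`. The number of unknowns and this order give termination
(`canReduce_of_det_symbol_ne_zero`).

The analytic work is to show that elimination stays in the class of real analytic kernels.
Convolutions and solutions of Volterra equations inherit bounds `|f^(m)| ≤ B^(m+1) m!` on `[0,T]`,
and such bounds yield an analytic extension to a neighbourhood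
(`FactorialBound.exists_analyticOnNhd`). -/

/-! ### Algebra of the one-sided convolution -/

/-- The one-sided convolution `∫_0^t f(t - s) g(s) ds`. -/
noncomputable def vconv (f g : ℝ → ℝ) (t : ℝ) : ℝ := ∫ s in (0 : ℝ)..t, f (t - s) * g s

theorem vconv_comm (f g : ℝ → ℝ) : vconv f g = vconv g f := by
  funext t
  unfold vconv
  have := intervalIntegral.integral_comp_sub_left (a := 0) (b := t)
    (fun s => f (t - s) * g s) t
  simp only [sub_sub_cancel, sub_self, sub_zero] at this
  rw [← this]
  exact intervalIntegral.integral_congr fun s _ => mul_comm _ _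

@[simp] theorem vconv_zero_right_apply (f g : ℝ → ℝ) : vconv f g 0 = 0 := by
  simp [vconv]

theorem vconv_congr {T t : ℝ} {f f' g g' : ℝ → ℝ} (hf : EqOn f f' (Icc 0 T))
    (hg : EqOn g g' (Icc 0 T)) (ht : t ∈ Icc 0 T) : vconv f g t = vconv f' g' t := by
  refine intervalIntegral.integral_congr fun s hs => ?_
  rw [uIcc_of_le ht.1] at hs
  rw [hf ⟨by linarith [hs.2], by linarith [hs.1, ht.2]⟩, hg ⟨hs.1, hs.2.trans ht.2⟩]

theorem continuous_vconv {f g : ℝ → ℝ} (hf : Continuous f) (hg : Continuous g) :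
    Continuous (vconv f g) := by
  unfold vconv
  exact intervalIntegral.continuous_parametric_intervalIntegral_of_continuous
    (f := fun t s => f (t - s) * g s) (by fun_prop) continuous_id

/-- Fubini on the square `[0,t]²`, applied to `F` cut off by the indicator of the triangle `r ≤ s`.
-/
theorem intervalIntegral_triangle_swap {F : ℝ → ℝ → ℝ} (hF : Continuous (Function.uncurry F))
    {t : ℝ} (ht : 0 ≤ t) :
    ∫ s in (0 : ℝ)..t, ∫ r in (0 : ℝ)..s, F s r = ∫ r in (0 : ℝ)..t, ∫ s in r..t, F s r := by
  let S : Set (ℝ × ℝ) := {q | q.2 ≤ q.1}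
  have hS : MeasurableSet S := measurableSet_le measurable_snd measurable_fst
  let G : ℝ → ℝ → ℝ := fun s r => S.indicator (Function.uncurry F) (s, r)
  have hG : MeasureTheory.IntegrableOn (Function.uncurry G) (uIoc 0 t ×ˢ uIoc 0 t) := by
    have h1 : MeasureTheory.IntegrableOn (Function.uncurry F) (uIoc 0 t ×ˢ uIoc 0 t) := by
      refine (hF.continuousOn.integrableOn_compact
        (isCompact_uIcc.prod isCompact_uIcc (s := uIcc 0 t) (t := uIcc 0 t))).mono_set ?_
      exact prod_mono uIoc_subset_uIcc uIoc_subset_uIcc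
    exact h1.indicator hS
  have h := MeasureTheory.intervalIntegral_intervalIntegral_swap hG
  have e1 : ∀ s ∈ uIcc 0 t, ∫ r in (0 : ℝ)..t, G s r = ∫ r in (0 : ℝ)..s, F s r := by
    intro s hs
    rw [uIcc_of_le ht] at hs
    rw [intervalIntegral.integral_of_le ht, intervalIntegral.integral_of_le hs.1]
    have : (fun r => G s r) = (Iic s).indicator (F s) := by
      funext r
      by_cases hr : r ≤ s <;> simp [G, S, hr, indicator]
    rw [this, MeasureTheory.setIntegral_indicator measurableSet_Iic]
    congr 2
    ext x
    simp only [mem_inter_iff, mem_Ioc, mem_Iic]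
    constructor
    · rintro ⟨h1, h2⟩; exact ⟨h1.1, h2⟩
    · rintro ⟨h1, h2⟩; exact ⟨⟨h1, h2.trans hs.2⟩, h2⟩
  have e2 : ∀ r ∈ uIcc 0 t, ∫ s in (0 : ℝ)..t, G s r = ∫ s in r..t, F s r := by
    intro r hr
    rw [uIcc_of_le ht] at hr
    -- Here the cut-off set is `[r,∞)`. With closed intervals the intersection is exactly `[r,t]`,
    -- even for `r > 0`, whereas half-open ones would differ at the end point.
    rw [intervalIntegral.integral_of_le ht, intervalIntegral.integral_of_le hr.2,
      ← MeasureTheory.integral_Icc_eq_integral_Ioc, ← MeasureTheory.integral_Icc_eq_integral_Ioc]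
    have : (fun s => G s r) = (Ici r).indicator (fun s => F s r) := by
      funext s
      by_cases hr : r ≤ s <;> simp [G, S, hr, indicator]
    rw [this, MeasureTheory.setIntegral_indicator measurableSet_Ici]
    congr 2
    ext x
    simp only [mem_inter_iff, mem_Icc, mem_Ici]
    constructor
    · rintro ⟨h1, h2⟩; exact ⟨h2, h1.2⟩
    · rintro ⟨h1, h2⟩; exact ⟨⟨hr.1.trans h1, h2⟩, h1⟩
  rw [intervalIntegral.integral_congr e1, intervalIntegral.integral_congr e2] at h
  exact h

theorem vconv_assoc_of_continuous {f g h : ℝ → ℝ} (hf : Continuous f) (hg : Continuous g)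
    (hh : Continuous h) {t : ℝ} (ht : 0 ≤ t) :
    vconv (vconv f g) h t = vconv f (vconv g h) t := by
  have key := intervalIntegral_triangle_swap (F := fun s r => f (t - s) * (g (s - r) * h r))
    (by unfold Function.uncurry; fun_prop) ht
  unfold vconv
  simp only [← intervalIntegral.integral_const_mul, ← intervalIntegral.integral_mul_const]
  rw [key]
  refine intervalIntegral.integral_congr fun r _ => ?_
  have := intervalIntegral.integral_comp_sub_right (a := r) (b := t)
    (fun u => f (t - r - u) * g u * h r) r
  simp only [sub_self] at this
  rw [← this]
  refine intervalIntegral.integral_congr fun s _ => ?_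
  simp only [sub_sub_sub_cancel_right]
  ring

/-! ### Convolution and primitives on `[0,T]` -/

section Interval

variable {T : ℝ}

/-- Convolution at `t ∈ [0,T]` only sees values on `[0,T]`, so statements for globally continuous
functions carry over by extending with constants. -/
theorem exists_continuous_eqOn (hT : 0 < T) {f : ℝ → ℝ} (hf : ContinuousOn f (Icc 0 T)) :
    ∃ g : ℝ → ℝ, Continuous g ∧ EqOn f g (Icc 0 T) :=
  ⟨IccExtend hT.le ((Icc 0 T).domRestrict f),
    (continuousOn_iff_continuous_domRestrict.1 hf).Icc_extend',
    fun t ht => by rw [IccExtend_of_mem _ _ ht]; rfl⟩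

theorem continuousOn_vconv (hT : 0 < T) {f g : ℝ → ℝ} (hf : ContinuousOn f (Icc 0 T))
    (hg : ContinuousOn g (Icc 0 T)) : ContinuousOn (vconv f g) (Icc 0 T) := by
  obtain ⟨f', hf', ef⟩ := exists_continuous_eqOn hT hf
  obtain ⟨g', hg', eg⟩ := exists_continuous_eqOn hT hg
  exact (continuous_vconv hf' hg').continuousOn.congr fun t ht => vconv_congr ef eg ht

theorem vconv_assoc (hT : 0 < T) {f g h : ℝ → ℝ} (hf : ContinuousOn f (Icc 0 T))
    (hg : ContinuousOn g (Icc 0 T)) (hh : ContinuousOn h (Icc 0 T)) :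
    EqOn (vconv (vconv f g) h) (vconv f (vconv g h)) (Icc 0 T) := by
  obtain ⟨f', hf', ef⟩ := exists_continuous_eqOn hT hf
  obtain ⟨g', hg', eg⟩ := exists_continuous_eqOn hT hg
  obtain ⟨h', hh', eh⟩ := exists_continuous_eqOn hT hh
  intro t ht
  rw [vconv_congr (fun s hs => vconv_congr ef eg hs) eh ht,
    vconv_congr ef (fun s hs => vconv_congr eg eh hs) ht,
    vconv_assoc_of_continuous hf' hg' hh' ht.1]

theorem vconv_integrable {f g : ℝ → ℝ} (hf : ContinuousOn f (Icc 0 T))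
    (hg : ContinuousOn g (Icc 0 T)) {t : ℝ} (ht : t ∈ Icc 0 T) :
    IntervalIntegrable (fun s => f (t - s) * g s) MeasureTheory.volume 0 t := by
  apply ContinuousOn.intervalIntegrable
  rw [uIcc_of_le ht.1]
  refine ContinuousOn.mul (hf.comp (by fun_prop) fun s hs => ?_) (hg.mono fun s hs => ?_)
  · exact ⟨by linarith [hs.2], by linarith [hs.1, ht.2]⟩
  · exact ⟨hs.1, hs.2.trans ht.2⟩

theorem vconv_add_right {f g h : ℝ → ℝ} (hf : ContinuousOn f (Icc 0 T))
    (hg : ContinuousOn g (Icc 0 T)) (hh : ContinuousOn h (Icc 0 T)) {t : ℝ} (ht : t ∈ Icc 0 T) :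
    vconv f (fun s => g s + h s) t = vconv f g t + vconv f h t := by
  unfold vconv
  rw [← intervalIntegral.integral_add (vconv_integrable hf hg ht) (vconv_integrable hf hh ht)]
  exact intervalIntegral.integral_congr fun s _ => by simp only [mul_add]

theorem vconv_const_mul_right (f g : ℝ → ℝ) (c t : ℝ) :
    vconv f (fun s => c * g s) t = c * vconv f g t := by
  unfold vconv
  rw [← intervalIntegral.integral_const_mul]
  exact intervalIntegral.integral_congr fun s _ => by simp only; ring

theorem vconv_sum_right {ι : Type*} (I : Finset ι) {f : ℝ → ℝ} {g : ι → ℝ → ℝ}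
    (hf : ContinuousOn f (Icc 0 T)) (hg : ∀ i ∈ I, ContinuousOn (g i) (Icc 0 T)) {t : ℝ}
    (ht : t ∈ Icc 0 T) :
    vconv f (fun s => ∑ i ∈ I, g i s) t = ∑ i ∈ I, vconv f (g i) t := by
  unfold vconv
  rw [← intervalIntegral.integral_finsetSum fun i hi => vconv_integrable hf (hg i hi) ht]
  exact intervalIntegral.integral_congr fun s _ => by simp only [Finset.mul_sum]

theorem vconv_add_left {f g h : ℝ → ℝ} (hf : ContinuousOn f (Icc 0 T))
    (hg : ContinuousOn g (Icc 0 T)) (hh : ContinuousOn h (Icc 0 T)) {t : ℝ} (ht : t ∈ Icc 0 T) :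
    vconv (fun s => g s + h s) f t = vconv g f t + vconv h f t := by
  rw [vconv_comm, vconv_add_right hf hg hh ht, vconv_comm f, vconv_comm f]

theorem vconv_const_mul_left (f g : ℝ → ℝ) (c t : ℝ) :
    vconv (fun s => c * g s) f t = c * vconv g f t := by
  rw [vconv_comm, vconv_const_mul_right, vconv_comm]

theorem vconv_sum_left {ι : Type*} (I : Finset ι) {f : ℝ → ℝ} {g : ι → ℝ → ℝ}
    (hf : ContinuousOn f (Icc 0 T)) (hg : ∀ i ∈ I, ContinuousOn (g i) (Icc 0 T)) {t : ℝ}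
    (ht : t ∈ Icc 0 T) :
    vconv (fun s => ∑ i ∈ I, g i s) f t = ∑ i ∈ I, vconv (g i) f t := by
  rw [vconv_comm, vconv_sum_right I hf hg ht]
  simp only [vconv_comm f]

theorem vconv_one_left (f : ℝ → ℝ) (t : ℝ) : vconv (fun _ => 1) f t = ∫ s in (0 : ℝ)..t, f s := by
  simp [vconv]

theorem hasDerivWithinAt_vconv_one (hT : 0 < T) {f : ℝ → ℝ} (hf : ContinuousOn f (Icc 0 T))
    {t : ℝ} (ht : t ∈ Icc 0 T) :
    HasDerivWithinAt (vconv (fun _ => 1) f) (f t) (Icc 0 T) t := by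
  obtain ⟨g, hg, e⟩ := exists_continuous_eqOn hT hf
  have h1 : HasDerivAt (fun u => ∫ s in (0 : ℝ)..u, g s) (g t) t :=
    intervalIntegral.integral_hasDerivAt_right (hg.intervalIntegrable _ _)
      (hg.stronglyMeasurableAtFilter _ _) hg.continuousAt
  rw [e ht]
  refine h1.hasDerivWithinAt.congr_of_mem (fun u hu => ?_) ht
  rw [vconv_congr (fun _ _ => rfl) e hu, vconv_one_left]

/-- A function with continuous derivative on `[0,T]` is the primitive of its derivative. -/
theorem eq_add_vconv_derivWithin (hT : 0 < T) {f : ℝ → ℝ} (hf : ContDiffOn ℝ 1 f (Icc 0 T))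
    {t : ℝ} (ht : t ∈ Icc 0 T) :
    f t = f 0 + vconv (fun _ => 1) (derivWithin f (Icc 0 T)) t := by
  have hc : ContinuousOn (derivWithin f (Icc 0 T)) (Icc 0 T) :=
    hf.continuousOn_derivWithin (uniqueDiffOn_Icc hT) le_rfl
  have hd : DifferentiableOn ℝ f (Icc 0 T) := hf.differentiableOn (by norm_num)
  have h0 : (0 : ℝ) ∈ Icc 0 T := left_mem_Icc.2 hT.le
  -- The difference of `f` and the primitive of its derivative has zero derivative on a convex set,
  -- hence is constant.
  have key := (convex_Icc 0 T).is_const_of_fderivWithin_eq_zero (𝕜 := ℝ)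
    (f := fun u => f u - vconv (fun _ => 1) (derivWithin f (Icc 0 T)) u) (s := Icc 0 T)
    (fun u hu => ((hd u hu).sub (hasDerivWithinAt_vconv_one hT hc hu).differentiableWithinAt))
    (fun u hu => by
      have h := (hd u hu).hasDerivWithinAt.sub (hasDerivWithinAt_vconv_one hT hc hu)
      rw [sub_self] at h
      have h2 := h.hasFDerivWithinAt.fderivWithin (uniqueDiffOn_Icc hT u hu)
      exact h2.trans (by simp)) ht h0
  simp only [vconv_zero_right_apply, sub_zero] at key
  linarith

/-- The convolution with a continuously differentiable kernel is a primitive. -/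
theorem vconv_eq_primitive (hT : 0 < T) {f g : ℝ → ℝ} (hf : ContDiffOn ℝ 1 f (Icc 0 T))
    (hg : ContinuousOn g (Icc 0 T)) {t : ℝ} (ht : t ∈ Icc 0 T) :
    vconv f g t
      = vconv (fun _ => 1) (fun s => f 0 * g s + vconv (derivWithin f (Icc 0 T)) g s) t := by
  have hc : ContinuousOn (derivWithin f (Icc 0 T)) (Icc 0 T) :=
    hf.continuousOn_derivWithin (uniqueDiffOn_Icc hT) le_rfl
  have h1 : ContinuousOn (fun _ : ℝ => (1 : ℝ)) (Icc 0 T) := continuousOn_const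
  have h2 : ContinuousOn (fun s => f 0 * g s) (Icc 0 T) := continuousOn_const.mul hg
  -- Writing `f = f(0) + 1 * f'`, associativity gives `f * g = 1 * (f(0) g + f' * g)`. This replaces
  -- differentiation under the integral sign.
  rw [vconv_add_right h1 h2 (continuousOn_vconv hT hc hg) ht, ← vconv_assoc hT h1 hc hg ht,
    vconv_congr (f' := fun s => f 0 * 1 + vconv (fun _ => 1) (derivWithin f (Icc 0 T)) s)
      (fun s hs => by rw [eq_add_vconv_derivWithin hT hf hs, mul_one]) (fun _ _ => rfl) ht,
    vconv_add_left hg (continuousOn_const) (continuousOn_vconv hT h1 hc) ht,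
    vconv_const_mul_left, vconv_const_mul_right]

theorem hasDerivWithinAt_vconv (hT : 0 < T) {f g : ℝ → ℝ} (hf : ContDiffOn ℝ 1 f (Icc 0 T))
    (hg : ContinuousOn g (Icc 0 T)) {t : ℝ} (ht : t ∈ Icc 0 T) :
    HasDerivWithinAt (vconv f g) (f 0 * g t + vconv (derivWithin f (Icc 0 T)) g t) (Icc 0 T) t := by
  have hc : ContinuousOn (derivWithin f (Icc 0 T)) (Icc 0 T) :=
    hf.continuousOn_derivWithin (uniqueDiffOn_Icc hT) le_rfl
  refine (hasDerivWithinAt_vconv_one hT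
    ((continuousOn_const.mul hg).add (continuousOn_vconv hT hc hg)) ht).congr_of_mem
      (fun u hu => vconv_eq_primitive hT hf hg hu) ht

end Interval

-- Derivatives of convolutions and integration by parts

local notation:max "∂[" T "," j "]" f:max => iteratedDerivWithin j f (Icc 0 T)

section Derivatives

variable {T : ℝ}

theorem iteratedDerivWithin_comp_iteratedDerivWithin (i j : ℕ) (f : ℝ → ℝ) :
    ∂[T,i] (∂[T,j] f) = ∂[T,(i + j)] f := by
  have e : ∀ n (g : ℝ → ℝ), ∂[T,n] g = (fun h : ℝ → ℝ => derivWithin h (Icc 0 T))^[n] g :=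
    fun n g => funext fun x => iteratedDerivWithin_eq_iterate
  rw [e, e, e, Function.iterate_add_apply]

theorem contDiffOn_iteratedDerivWithin (hT : 0 < T) {m j : ℕ} {f : ℝ → ℝ}
    (hf : ContDiffOn ℝ (m + j : ℕ) f (Icc 0 T)) : ContDiffOn ℝ m (∂[T,j] f) (Icc 0 T) := by
  induction j generalizing f with
  | zero => simpa using hf
  | succ j ih =>
    rw [iteratedDerivWithin_succ']
    exact ih (hf.derivWithin (uniqueDiffOn_Icc hT) (by norm_cast))

theorem contDiffOn_infty_iteratedDerivWithin (hT : 0 < T) {f : ℝ → ℝ}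
    (hf : ContDiffOn ℝ ∞ f (Icc 0 T)) (j : ℕ) : ContDiffOn ℝ ∞ (∂[T,j] f) (Icc 0 T) :=
  contDiffOn_infty.2 fun _ => contDiffOn_iteratedDerivWithin hT (contDiffOn_infty.1 hf _)

theorem contDiffOn_nat_of_infty {E : Type*} [NormedAddCommGroup E] [NormedSpace ℝ E]
    {f : ℝ → E} (hf : ContDiffOn ℝ ∞ f (Icc 0 T)) (n : ℕ) :
    ContDiffOn ℝ n f (Icc 0 T) := contDiffOn_infty.1 hf n

theorem derivWithin_vconv (hT : 0 < T) {f g : ℝ → ℝ} (hf : ContDiffOn ℝ 1 f (Icc 0 T))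
    (hg : ContinuousOn g (Icc 0 T)) :
    EqOn (derivWithin (vconv f g) (Icc 0 T))
      (fun t => f 0 * g t + vconv (derivWithin f (Icc 0 T)) g t) (Icc 0 T) := fun t ht =>
  (hasDerivWithinAt_vconv hT hf hg ht).derivWithin (uniqueDiffOn_Icc hT t ht)

/-- The derivative `f(0) g + f' * g` puts the differentiation on the smooth kernel, so convolution
gains one order over `g`. The induction has to vary `f` because the kernel changes. -/
theorem contDiffOn_vconv (hT : 0 < T) {n : ℕ} {f g : ℝ → ℝ} (hf : ContDiffOn ℝ ∞ f (Icc 0 T))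
    (hg : ContDiffOn ℝ n g (Icc 0 T)) : ContDiffOn ℝ (n + 1 : ℕ) (vconv f g) (Icc 0 T) := by
  have hu := uniqueDiffOn_Icc hT
  induction n generalizing f with
  | zero =>
    have hf1 := contDiffOn_nat_of_infty hf 1
    push_cast at hf1
    rw [show ((0 + 1 : ℕ) : WithTop ℕ∞) = 0 + 1 by norm_num, contDiffOn_succ_iff_derivWithin hu]
    refine ⟨fun t ht => (hasDerivWithinAt_vconv hT hf1 hg.continuousOn
      ht).differentiableWithinAt, by simp, ?_⟩
    rw [contDiffOn_zero]
    exact ((continuousOn_const.mul hg.continuousOn).add (continuousOn_vconv hT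
      (hf1.continuousOn_derivWithin hu le_rfl) hg.continuousOn)).congr
        (derivWithin_vconv hT hf1 hg.continuousOn)
  | succ n ih =>
    have hf1 : ContDiffOn ℝ 1 f (Icc 0 T) := mod_cast contDiffOn_nat_of_infty hf 1
    have e : ((n + 1 + 1 : ℕ) : WithTop ℕ∞) = ((n + 1 : ℕ) : WithTop ℕ∞) + 1 := by push_cast; rfl
    rw [e, contDiffOn_succ_iff_derivWithin hu]
    refine ⟨fun t ht => (hasDerivWithinAt_vconv hT hf1 hg.continuousOn
      ht).differentiableWithinAt, by simp, ?_⟩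
    refine ContDiffOn.congr ?_ (derivWithin_vconv hT hf1 hg.continuousOn)
    exact (contDiffOn_const.mul hg).add
      (ih (hf.derivWithin hu (by simp)) (hg.of_le (by norm_cast; omega)))

theorem contDiffOn_infty_vconv (hT : 0 < T) {f g : ℝ → ℝ} (hf : ContDiffOn ℝ ∞ f (Icc 0 T))
    (hg : ContDiffOn ℝ ∞ g (Icc 0 T)) : ContDiffOn ℝ ∞ (vconv f g) (Icc 0 T) :=
  contDiffOn_infty.2 fun n =>
    (contDiffOn_vconv hT hf (contDiffOn_nat_of_infty hg n)).of_le (by norm_cast; omega)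

/-- Each differentiation moves to the kernel and leaves a boundary term. The truncated subtraction
`j - 1 - m` is harmless, since `m < j` throughout the sum. -/
theorem iteratedDerivWithin_vconv (hT : 0 < T) {j : ℕ} {f g : ℝ → ℝ}
    (hf : ContDiffOn ℝ ∞ f (Icc 0 T)) (hg : ContDiffOn ℝ j g (Icc 0 T)) {t : ℝ}
    (ht : t ∈ Icc 0 T) :
    ∂[T,j] (vconv f g) t
      = ∑ m ∈ Finset.range j, ∂[T,m] f 0 * ∂[T,(j - 1 - m)] g t + vconv (∂[T,j] f) g t := by
  have hu := uniqueDiffOn_Icc hT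
  induction j generalizing f with
  | zero => simp
  | succ j ih =>
    have hf1 : ContDiffOn ℝ 1 f (Icc 0 T) := mod_cast contDiffOn_nat_of_infty hf 1
    have hf' : ContDiffOn ℝ ∞ (derivWithin f (Icc 0 T)) (Icc 0 T) := hf.derivWithin hu (by simp)
    have hgj : ContDiffOn ℝ j g (Icc 0 T) := hg.of_le (by norm_cast; omega)
    rw [iteratedDerivWithin_succ',
      iteratedDerivWithin_congr (derivWithin_vconv hT hf1 hg.continuousOn) ht,
      iteratedDerivWithin_fun_add ht hu ((contDiffOn_const.mul hgj) t ht)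
        (((contDiffOn_vconv hT hf' hgj).of_le (by norm_cast; omega)) t ht),
      iteratedDerivWithin_const_mul_field, ih hf' hgj, Finset.sum_range_succ']
    simp only [iteratedDerivWithin_succ', iteratedDerivWithin_zero]
    have : ∀ m, j + 1 - 1 - (m + 1) = j - 1 - m := fun m => by omega
    simp only [this]
    simp only [Nat.add_sub_cancel, Nat.sub_zero]
    ring

/-- Integration by parts in a convolution. -/
theorem vconv_iteratedDerivWithin (hT : 0 < T) {j : ℕ} {f g : ℝ → ℝ}
    (hf : ContDiffOn ℝ ∞ f (Icc 0 T)) (hg : ContDiffOn ℝ j g (Icc 0 T)) {t : ℝ}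
    (ht : t ∈ Icc 0 T) :
    vconv f (∂[T,j] g) t + ∑ m ∈ Finset.range j, ∂[T,m] f t * ∂[T,(j - 1 - m)] g 0
      = vconv (∂[T,j] f) g t + ∑ m ∈ Finset.range j, ∂[T,m] f 0 * ∂[T,(j - 1 - m)] g t := by
  have hu := uniqueDiffOn_Icc hT
  induction j generalizing f with
  | zero => simp
  | succ j ih =>
    have hf1 : ContDiffOn ℝ 1 f (Icc 0 T) := mod_cast contDiffOn_nat_of_infty hf 1
    have hf' : ContDiffOn ℝ ∞ (derivWithin f (Icc 0 T)) (Icc 0 T) := hf.derivWithin hu (by simp)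
    have hgj : ContDiffOn ℝ j g (Icc 0 T) := hg.of_le (by norm_cast; omega)
    have hG : ContDiffOn ℝ (1 : ℕ) (∂[T,j] g) (Icc 0 T) :=
      contDiffOn_iteratedDerivWithin hT (by rwa [add_comm])
    have hG1 : ContDiffOn ℝ 1 (∂[T,j] g) (Icc 0 T) := mod_cast hG
    -- Differentiate `f * g^(j)` twice, once with the derivative on each factor, and compare.
    have parts : vconv f (∂[T,(j + 1)] g) t + f t * ∂[T,j] g 0
        = f 0 * ∂[T,j] g t + vconv (derivWithin f (Icc 0 T)) (∂[T,j] g) t := by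
      have h1 := derivWithin_vconv hT hf1 hG1.continuousOn ht
      have h2 := derivWithin_vconv hT hG1 hf1.continuousOn ht
      rw [vconv_comm, h1, ← iteratedDerivWithin_succ] at h2
      rw [vconv_comm (∂[T,(j + 1)] g)] at h2
      linarith
    have h := ih hf' hgj
    rw [Finset.sum_range_succ', Finset.sum_range_succ']
    have : ∀ m, j + 1 - 1 - (m + 1) = j - 1 - m := fun m => by omega
    simp only [this]
    simp only [Nat.add_sub_cancel, Nat.sub_zero, iteratedDerivWithin_zero]
    simp only [iteratedDerivWithin_succ' (f := f)]
    linarith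

end Derivatives

/-! ### Scalar operators and their symbols -/

section ScalarOperator

variable {T : ℝ}

/-- The scalar operator `z ↦ ∑_{i ≤ k} a_i z^{(i)} + K * z`. -/
noncomputable def scalarOp (T : ℝ) (k : ℕ) (a : ℕ → ℝ) (K z : ℝ → ℝ) (t : ℝ) : ℝ :=
  ∑ i ∈ Finset.range (k + 1), a i * ∂[T,i] z t + vconv K z t

/-- The symbol of `∑_{i ≤ k} a_i z^{(i)} + K * z`: the power series
`∑_{i ≤ k} a_i X^{k - i} + ∑_m K^{(m)}(0) X^{k + 1 + m}`. -/
noncomputable def scalarSymbol (T : ℝ) (k : ℕ) (a : ℕ → ℝ) (K : ℝ → ℝ) : PowerSeries ℝ :=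
  PowerSeries.mk fun e => if e ≤ k then a (k - e) else ∂[T,(e - k - 1)] K 0

/-- The series `∑_m z^{(m)}(0) X^m`. -/
noncomputable def jet (T : ℝ) (z : ℝ → ℝ) : PowerSeries ℝ := PowerSeries.mk fun m => ∂[T,m] z 0

theorem contDiffOn_scalarOp (hT : 0 < T) {k j : ℕ} {a : ℕ → ℝ} {K z : ℝ → ℝ}
    (hK : ContDiffOn ℝ ∞ K (Icc 0 T)) (hz : ContDiffOn ℝ (j + k : ℕ) z (Icc 0 T)) :
    ContDiffOn ℝ j (scalarOp T k a K z) (Icc 0 T) := by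
  refine ContDiffOn.add (ContDiffOn.sum fun i hi => contDiffOn_const.mul ?_)
    ((contDiffOn_vconv hT hK hz).of_le (by norm_cast; omega))
  rw [Finset.mem_range] at hi
  exact contDiffOn_iteratedDerivWithin hT (hz.of_le (by norm_cast; omega))

/-- The point of the symbol: every derivative of the operator has its coefficients read off from one
and the same power series. The boundary terms of the convolution supply the coefficients of index
above `k`. -/
theorem iteratedDerivWithin_scalarOp (hT : 0 < T) {k j : ℕ} {a : ℕ → ℝ} {K z : ℝ → ℝ}
    (hK : ContDiffOn ℝ ∞ K (Icc 0 T)) (hz : ContDiffOn ℝ (j + k : ℕ) z (Icc 0 T)) {t : ℝ}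
    (ht : t ∈ Icc 0 T) :
    ∂[T,j] (scalarOp T k a K z) t
      = ∑ N ∈ Finset.range (k + j + 1), PowerSeries.coeff (k + j - N) (scalarSymbol T k a K)
          * ∂[T,N] z t + vconv (∂[T,j] K) z t := by
  have hu := uniqueDiffOn_Icc hT
  have hd : ∀ i ∈ Finset.range (k + 1),
      ContDiffWithinAt ℝ j (fun t => a i * ∂[T,i] z t) (Icc 0 T) t := fun i hi => by
    rw [Finset.mem_range] at hi
    exact (contDiffOn_const.mul (contDiffOn_iteratedDerivWithin hT
      (hz.of_le (by norm_cast; omega)))) t ht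
  unfold scalarOp
  rw [iteratedDerivWithin_fun_add ht hu (ContDiffWithinAt.sum hd)
    (((contDiffOn_vconv hT hK hz).of_le (by norm_cast; omega)) t ht),
    iteratedDerivWithin_fun_sum ht hu hd,
    iteratedDerivWithin_vconv hT hK (hz.of_le (by norm_cast; omega)) ht, ← add_assoc]
  congr 1
  simp only [iteratedDerivWithin_const_mul_field, iteratedDerivWithin_comp_iteratedDerivWithin]
  -- Summation over the exponent `e = k + j - N`: the first `k + 1` exponents carry the `a_i`, the
  -- remaining `j` the boundary values of the kernel.
  have hr : ∑ N ∈ Finset.range (k + j + 1), PowerSeries.coeff (k + j - N) (scalarSymbol T k a K)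
        * ∂[T,N] z t = ∑ e ∈ Finset.range (k + 1 + j), PowerSeries.coeff e (scalarSymbol T k a K)
        * ∂[T,(k + j - e)] z t := by
    rw [← Finset.sum_range_reflect, show k + j + 1 = k + 1 + j by omega]
    refine Finset.sum_congr rfl fun e he => ?_
    rw [Finset.mem_range] at he
    have h1 : k + 1 + j - 1 - e = k + j - e := by omega
    have h2 : k + j - (k + j - e) = e := by omega
    rw [h1, h2]
  rw [hr, Finset.sum_range_add _ (k + 1) j, ← Finset.sum_range_reflect (fun i => a i * ∂[T,(j + i)] z t)]
  congr 1
  · refine Finset.sum_congr rfl fun e he => ?_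
    rw [Finset.mem_range] at he
    have h1 : k + 1 - 1 - e = k - e := by omega
    have h3 : j + (k - e) = k + j - e := by omega
    rw [h1, h3, scalarSymbol, PowerSeries.coeff_mk, if_pos (by omega)]
  · refine Finset.sum_congr rfl fun m hm => ?_
    rw [Finset.mem_range] at hm
    have h3 : k + j - (k + 1 + m) = j - 1 - m := by omega
    have h4 : k + 1 + m - k - 1 = m := by omega
    rw [h3, scalarSymbol, PowerSeries.coeff_mk, if_neg (by omega), h4]

/-- At `t = 0` the convolution disappears, and the formula for derivatives becomes a Cauchy product.
The zero of order `k` of `z` takes care of the coefficients of index below `k`, which no derivative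
of the operator represents. -/
theorem X_pow_mul_jet_scalarOp (hT : 0 < T) {k : ℕ} {a : ℕ → ℝ} {K z : ℝ → ℝ}
    (hK : ContDiffOn ℝ ∞ K (Icc 0 T)) (hz : ContDiffOn ℝ ∞ z (Icc 0 T))
    (h0 : PowerSeries.X ^ k ∣ jet T z) :
    PowerSeries.X ^ k * jet T (scalarOp T k a K z) = scalarSymbol T k a K * jet T z := by
  ext e
  rcases lt_or_ge e k with he | he
  · rw [PowerSeries.coeff_X_pow_mul', if_neg (by omega)]
    exact ((PowerSeries.X_pow_dvd_iff.1 (h0.mul_left (scalarSymbol T k a K))) e he).symm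
  · obtain ⟨j, rfl⟩ := Nat.exists_eq_add_of_le he
    rw [add_comm k j, PowerSeries.coeff_X_pow_mul, jet, PowerSeries.coeff_mk,
      iteratedDerivWithin_scalarOp hT hK (contDiffOn_nat_of_infty hz _) (left_mem_Icc.2 hT.le),
      vconv_zero_right_apply, add_zero, mul_comm (scalarSymbol T k a K), PowerSeries.coeff_mul,
      Finset.Nat.sum_antidiagonal_eq_sum_range_succ_mk, add_comm j k]
    refine Finset.sum_congr rfl fun N _ => ?_
    rw [jet, PowerSeries.coeff_mk, mul_comm]

theorem scalarOp_zero (T : ℝ) (a : ℕ → ℝ) (K z : ℝ → ℝ) (t : ℝ) :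
    scalarOp T 0 a K z t = a 0 * z t + vconv K z t := by simp [scalarOp]

end ScalarOperator

theorem mulVec_apply_eq_sum {α β : Type} [Fintype β] (A : Matrix α β ℝ) (v : β → ℝ) (a : α) :
    (A *ᵥ v) a = ∑ b, A a b * v b := rfl

/-! ### Matrix operators and composition with differential operators -/

section MatrixOperator

variable {T : ℝ} {α β : Type} [Fintype α] [Fintype β]

theorem iteratedDerivWithin_pi_apply (hT : 0 < T) {j : ℕ} {z : ℝ → β → ℝ}
    (hz : ContDiffOn ℝ j z (Icc 0 T)) {t : ℝ} (ht : t ∈ Icc 0 T) (b : β) :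
    iteratedDerivWithin j z (Icc 0 T) t b = ∂[T,j] (fun s => z s b) t := by
  have hu := uniqueDiffOn_Icc hT
  induction j generalizing z with
  | zero => simp
  | succ j ih =>
    have hd : DifferentiableOn ℝ z (Icc 0 T) := hz.differentiableOn (by simp)
    rw [iteratedDerivWithin_succ', iteratedDerivWithin_succ',
      ih (hz.derivWithin hu (by norm_cast))]
    refine iteratedDerivWithin_congr (fun s hs => ?_) ht
    rw [derivWithin_pi fun i => differentiableWithinAt_pi.1 (hd s hs) i]

theorem constOp_apply (hT : 0 < T) {k : ℕ} {A : ℕ → Matrix α β ℝ} {K : ℝ → Matrix α β ℝ}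
    {z : ℝ → β → ℝ} (hK : ∀ a b, ContinuousOn (fun u => K u a b) (Icc 0 T))
    (hz : ContDiffOn ℝ k z (Icc 0 T)) {t : ℝ} (ht : t ∈ Icc 0 T) (a : α) :
    constOp T k A K z t a
      = ∑ b, scalarOp T k (fun i => A i a b) (fun u => K u a b) (fun s => z s b) t := by
  have hzc : ∀ b, ContinuousOn (fun s => z s b) (Icc 0 T) := fun b =>
    continuousOn_pi.1 hz.continuousOn b
  have hint : ∀ a, IntervalIntegrable (fun s => (K (t - s) *ᵥ z s) a) MeasureTheory.volume 0 t := by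
    intro a
    simp only [mulVec_apply_eq_sum]
    have := IntervalIntegrable.sum Finset.univ fun b _ => vconv_integrable (hK a b) (hzc b) ht
    simpa only [Finset.sum_fn] using this
  have h1 : (∫ s in (0 : ℝ)..t, K (t - s) *ᵥ z s) a
      = ∑ b, vconv (fun u => K u a b) (fun s => z s b) t := by
    rw [intervalIntegral.integral_of_le ht.1]
    have := MeasureTheory.eval_integral
      (f := fun s => K (t - s) *ᵥ z s) (μ := MeasureTheory.volume.restrict (Ioc 0 t))
      (fun a => (hint a).1) a
    rw [this, ← intervalIntegral.integral_of_le ht.1]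
    simp only [mulVec_apply_eq_sum, vconv]
    exact intervalIntegral.integral_finsetSum fun b _ => vconv_integrable (hK a b) (hzc b) ht
  unfold constOp volterraOp scalarOp
  rw [Pi.add_apply, h1, Finset.sum_add_distrib, Finset.sum_apply, Finset.sum_comm]
  congr 1
  refine Finset.sum_congr rfl fun i hi => Finset.sum_congr rfl fun b _ => ?_
  rw [Finset.mem_range] at hi
  rw [iteratedDerivWithin_pi_apply hT (hz.of_le (by norm_cast; omega)) ht]

/-- The matrix of the symbols of the entries of a constant coefficient operator. -/
noncomputable def matrixSymbol (T : ℝ) (k : ℕ) (A : ℕ → Matrix α β ℝ) (K : ℝ → Matrix α β ℝ) :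
    Matrix α β (PowerSeries ℝ) :=
  Matrix.of fun a b => scalarSymbol T k (fun i => A i a b) (fun u => K u a b)

theorem contDiffOn_constOp (hT : 0 < T) {k j : ℕ} {A : ℕ → Matrix α β ℝ}
    {K : ℝ → Matrix α β ℝ} {z : ℝ → β → ℝ}
    (hK : ∀ a b, ContDiffOn ℝ ∞ (fun u => K u a b) (Icc 0 T))
    (hz : ContDiffOn ℝ (j + k : ℕ) z (Icc 0 T)) :
    ContDiffOn ℝ j (constOp T k A K z) (Icc 0 T) := by
  rw [contDiffOn_pi]
  intro a
  have h := ContDiffOn.sum (s := Finset.univ) fun b _ => contDiffOn_scalarOp hT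
    (a := fun i => A i a b) (hK a b) (contDiffOn_pi.1 hz b)
  refine h.congr fun t ht => ?_
  exact constOp_apply hT (fun a b => (hK a b).continuousOn) (hz.of_le (by norm_cast; omega)) ht a

theorem contDiffOn_infty_constOp (hT : 0 < T) {k : ℕ} {A : ℕ → Matrix α β ℝ}
    {K : ℝ → Matrix α β ℝ} {z : ℝ → β → ℝ}
    (hK : ∀ a b, ContDiffOn ℝ ∞ (fun u => K u a b) (Icc 0 T))
    (hz : ContDiffOn ℝ ∞ z (Icc 0 T)) :
    ContDiffOn ℝ ∞ (constOp T k A K z) (Icc 0 T) :=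
  contDiffOn_infty.2 fun _ => contDiffOn_constOp hT hK (contDiffOn_nat_of_infty hz _)

theorem iteratedDerivWithin_constOp (hT : 0 < T) {k j : ℕ} {A : ℕ → Matrix α β ℝ}
    {K : ℝ → Matrix α β ℝ} {z : ℝ → β → ℝ}
    (hK : ∀ a b, ContDiffOn ℝ ∞ (fun u => K u a b) (Icc 0 T))
    (hz : ContDiffOn ℝ (j + k : ℕ) z (Icc 0 T)) {t : ℝ} (ht : t ∈ Icc 0 T) (a : α) :
    iteratedDerivWithin j (constOp T k A K z) (Icc 0 T) t a
      = ∑ b, (∑ N ∈ Finset.range (k + j + 1),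
          PowerSeries.coeff (k + j - N) (matrixSymbol T k A K a b) * ∂[T,N] (fun s => z s b) t
          + vconv (∂[T,j] (fun u => K u a b)) (fun s => z s b) t) := by
  have hu := uniqueDiffOn_Icc hT
  have hb := contDiffOn_pi.1 hz
  rw [iteratedDerivWithin_pi_apply hT (contDiffOn_constOp hT hK hz) ht,
    iteratedDerivWithin_congr (g := fun t => ∑ b, scalarOp T k (fun i => A i a b)
      (fun u => K u a b) (fun s => z s b) t) (fun s hs => constOp_apply hT
      (fun a b => (hK a b).continuousOn) (hz.of_le (by norm_cast; omega)) hs a) ht,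
    iteratedDerivWithin_fun_sum ht hu fun b _ => contDiffOn_scalarOp hT (hK a b) (hb b) t ht]
  exact Finset.sum_congr rfl fun b _ => iteratedDerivWithin_scalarOp hT (hK a b) (hb b) ht

/-- The series `X^l ∑_{j ≤ l} L_j X^{-j}` of the operator `∑_{j ≤ l} L_j (d/dt)^j`. -/
noncomputable def polySymbol (l : ℕ) (L : ℕ → Matrix α β ℝ) : Matrix α β (PowerSeries ℝ) :=
  Matrix.of fun a b => ∑ j ∈ Finset.range (l + 1),
    PowerSeries.C (L j a b) * PowerSeries.X ^ (l - j)

/-- The condition `N ≤ k + j` reflects that the `j`-th derivative of an operator of order `k`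
contains no derivative of `z` beyond `k + j`. -/
theorem coeff_polySymbol_mul {γ : Type} (l k N : ℕ) (hN : N ≤ k + l) (L : ℕ → Matrix α β ℝ)
    (M : Matrix β γ (PowerSeries ℝ)) (a : α) (c : γ) :
    PowerSeries.coeff (k + l - N) ((polySymbol l L * M) a c)
      = ∑ j ∈ Finset.range (l + 1), ∑ b, L j a b *
          (if N ≤ k + j then PowerSeries.coeff (k + j - N) (M b c) else 0) := by
  rw [Matrix.mul_apply, map_sum, Finset.sum_comm]
  refine Finset.sum_congr rfl fun b _ => ?_
  rw [polySymbol, Matrix.of_apply, Finset.sum_mul, map_sum]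
  refine Finset.sum_congr rfl fun j hj => ?_
  rw [Finset.mem_range] at hj
  rw [mul_assoc, PowerSeries.coeff_C_mul, PowerSeries.coeff_X_pow_mul']
  by_cases h : N ≤ k + j
  · rw [if_pos h, if_pos (by omega), show k + l - N - (l - j) = k + j - N by omega]
  · rw [if_neg h, if_neg (by omega)]

/-- Composition of operators corresponds to multiplication of symbols. Both directions of the
characterization of regularizing operators read their coefficients from this formula. -/
theorem sum_mulVec_iteratedDerivWithin_constOp {γ : Type} [Fintype γ] (hT : 0 < T) {k l : ℕ}
    {A : ℕ → Matrix α β ℝ} {K : ℝ → Matrix α β ℝ} {z : ℝ → β → ℝ} (L : ℕ → Matrix γ α ℝ)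
    (hK : ∀ a b, ContDiffOn ℝ ∞ (fun u => K u a b) (Icc 0 T))
    (hz : ContDiffOn ℝ (l + k : ℕ) z (Icc 0 T)) {t : ℝ} (ht : t ∈ Icc 0 T) (c : γ) :
    (∑ j ∈ Finset.range (l + 1), L j *ᵥ
        iteratedDerivWithin j (constOp T k A K z) (Icc 0 T) t) c
      = ∑ b, (∑ N ∈ Finset.range (k + l + 1),
          PowerSeries.coeff (k + l - N) ((polySymbol l L * matrixSymbol T k A K) c b)
            * ∂[T,N] (fun s => z s b) t
          + vconv (fun u => ∑ j ∈ Finset.range (l + 1), ∑ a, L j c a *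
              ∂[T,j] (fun u => K u a b) u) (fun s => z s b) t) := by
  have hzc : ∀ b, ContinuousOn (fun s => z s b) (Icc 0 T) := fun b =>
    continuousOn_pi.1 hz.continuousOn b
  have hKc : ∀ j a b, ContinuousOn (∂[T,j] (fun u => K u a b)) (Icc 0 T) := fun j a b =>
    (contDiffOn_infty_iteratedDerivWithin hT (hK a b) j).continuousOn
  rw [Finset.sum_apply]
  have e1 : ∀ j ∈ Finset.range (l + 1), (L j *ᵥ
      iteratedDerivWithin j (constOp T k A K z) (Icc 0 T) t) c
      = ∑ b, (∑ N ∈ Finset.range (k + l + 1), (∑ a, L j c a * (if N ≤ k + j then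
          PowerSeries.coeff (k + j - N) (matrixSymbol T k A K a b) else 0))
            * ∂[T,N] (fun s => z s b) t
          + ∑ a, L j c a * vconv (∂[T,j] (fun u => K u a b)) (fun s => z s b) t) := by
    intro j hj
    rw [Finset.mem_range] at hj
    rw [mulVec_apply_eq_sum]
    have hsub : Finset.range (k + j + 1) ⊆ Finset.range (k + l + 1) :=
      Finset.range_subset_range.2 (by omega)
    -- Padding with zeros gives all `j` the same range of derivatives, so that the sums can be
    -- interchanged.
    have e2 : ∀ a b, ∑ N ∈ Finset.range (k + j + 1), PowerSeries.coeff (k + j - N)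
          (matrixSymbol T k A K a b) * ∂[T,N] (fun s => z s b) t
        = ∑ N ∈ Finset.range (k + l + 1), (if N ≤ k + j then
          PowerSeries.coeff (k + j - N) (matrixSymbol T k A K a b) else 0)
            * ∂[T,N] (fun s => z s b) t := by
      intro a b
      rw [← Finset.sum_subset hsub]
      · refine Finset.sum_congr rfl fun N hN => ?_
        rw [Finset.mem_range] at hN
        rw [if_pos (by omega)]
      · intro N _ hN
        rw [Finset.mem_range] at hN
        rw [if_neg (by omega), zero_mul]
    have hz' : ContDiffOn ℝ (j + k : ℕ) z (Icc 0 T) := hz.of_le (by norm_cast; omega)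
    simp only [iteratedDerivWithin_constOp hT hK hz' ht, e2]
    simp only [Finset.mul_sum, Finset.sum_mul, mul_add]
    rw [Finset.sum_comm]
    refine Finset.sum_congr rfl fun b _ => ?_
    rw [Finset.sum_add_distrib]
    congr 1
    rw [Finset.sum_comm]
    simp only [mul_assoc]
  rw [Finset.sum_congr rfl e1, Finset.sum_comm]
  refine Finset.sum_congr rfl fun b _ => ?_
  rw [Finset.sum_add_distrib, Finset.sum_comm]
  congr 1
  · refine Finset.sum_congr rfl fun N hN => ?_
    rw [Finset.mem_range] at hN
    rw [coeff_polySymbol_mul l k N (by omega), Finset.sum_mul]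
  · have hc1 : ∀ j a, ContinuousOn (fun u => L j c a * ∂[T,j] (fun u => K u a b) u) (Icc 0 T) :=
      fun j a => continuousOn_const.mul (hKc j a b)
    have hc2 : ∀ j ∈ Finset.range (l + 1), ContinuousOn
        (fun u => ∑ a, L j c a * ∂[T,j] (fun u => K u a b) u) (Icc 0 T) :=
      fun j _ => continuousOn_finsetSum _ fun a _ => hc1 j a
    rw [vconv_sum_left _ (hzc b) hc2 ht]
    refine Finset.sum_congr rfl fun j _ => ?_
    rw [vconv_sum_left _ (hzc b) (fun a _ => hc1 j a) ht]
    exact Finset.sum_congr rfl fun a _ => (vconv_const_mul_left _ _ _ _).symm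

theorem iteratedDerivWithin_monomial_zero (hT : 0 < T) (m N : ℕ) :
    ∂[T,m] (fun t : ℝ => t ^ N / (N.factorial : ℝ)) 0 = if m = N then 1 else 0 := by
  have h0 : (0 : ℝ) ∈ Icc 0 T := left_mem_Icc.2 hT.le
  have hc : ContDiff ℝ m (fun t : ℝ => t ^ N / (N.factorial : ℝ)) := by fun_prop
  rw [iteratedDerivWithin_eq_iteratedDeriv (uniqueDiffOn_Icc hT) hc.contDiffAt h0]
  have : (fun t : ℝ => t ^ N / (N.factorial : ℝ))
      = fun t : ℝ => (N.factorial : ℝ)⁻¹ * t ^ N := by funext t; ring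
  rw [this, iteratedDeriv_const_mul_field, iteratedDeriv_fun_pow_zero]
  have hN : (N.factorial : ℝ) ≠ 0 := by positivity
  by_cases h : m = N
  · subst h; simp [hN]
  · simp [h]

theorem jet_monomial (hT : 0 < T) (N : ℕ) :
    jet T (fun t : ℝ => t ^ N / (N.factorial : ℝ)) = PowerSeries.X ^ N := by
  ext m
  rw [jet, PowerSeries.coeff_mk, iteratedDerivWithin_monomial_zero hT, PowerSeries.coeff_X_pow]

end MatrixOperator

theorem AnalyticOnNhd.contDiffOn_infty {s : Set ℝ} {f : ℝ → ℝ} (hs : UniqueDiffOn ℝ s)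
    (h : AnalyticOnNhd ℝ f s) : ContDiffOn ℝ ∞ f s := h.contDiffOn hs

/-! ### Regularizing operators exist exactly when the determinant of the symbol is nonzero -/

namespace IDESystem

variable {T : ℝ} {n p : ℕ}

theorem contDiffOn_K (hT : 0 < T) (S : IDESystem T n p) (a b : Fin n) :
    ContDiffOn ℝ ∞ (fun u => S.K u a b) (Icc 0 T) :=
  (S.analytic_K a b).contDiffOn_infty (uniqueDiffOn_Icc hT)

/-- The symbol of the operator of the system. -/
noncomputable def symbol (S : IDESystem T n p) : Matrix (Fin n) (Fin n) (PowerSeries ℝ) :=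
  matrixSymbol T S.order S.A S.K

/-- The symbol divides, from the right, `X^l` times a matrix with invertible constant term, so its
determinant cannot vanish. -/
theorem det_symbol_ne_zero_of_hasLRO (hT : 0 < T) (S : IDESystem T n p) (h : S.HasLRO) :
    S.symbol.det ≠ 0 := by
  obtain ⟨l, L, A', K', -, -, hdet, hz⟩ := h
  set k := S.order with hk
  have h0 : (0 : ℝ) ∈ Icc 0 T := left_mem_Icc.2 hT.le
  -- Evaluate the composed operator at `t = 0` on `t^N / N!` in the component `b`. Only the `N`-th
  -- derivative survives and both integrals vanish, which isolates the coefficient of that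
  -- derivative.
  have key : ∀ N ≤ k + l, ∀ c b, PowerSeries.coeff (k + l - N) ((polySymbol l L * S.symbol) c b)
      = if N ≤ k then A' N 0 c b else 0 := by
    intro N hN c b
    let z : ℝ → Fin n → ℝ := fun t b' => if b' = b then t ^ N / (N.factorial : ℝ) else 0
    have hsm : ContDiff ℝ ∞ z := by
      refine contDiff_pi.2 fun b' => ?_
      by_cases h : b' = b <;> simp only [z, h, if_true, if_false] <;> fun_prop
    have hder : ∀ m b', ∂[T,m] (fun s => z s b') 0 = if b' = b ∧ m = N then 1 else 0 := by
      intro m b'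
      by_cases h : b' = b
      · simp only [z, h, if_true, true_and, iteratedDerivWithin_monomial_zero hT]
      · simp [z, h]
    have e := congrFun (hz z (contDiffOn_nat_of_infty hsm.contDiffOn _) 0 h0) c
    have e1 := sum_mulVec_iteratedDerivWithin_constOp hT L (A := S.A) (S.contDiffOn_K hT)
      (contDiffOn_nat_of_infty hsm.contDiffOn (l + k)) h0 c
    have e2 : (∑ j ∈ Finset.range (l + 1), L j *ᵥ
        iteratedDerivWithin j (S.op z) (Icc 0 T) 0) c = volterraOp T k A' K' z 0 c := e
    rw [show S.op z = constOp T k S.A S.K z from rfl, e1] at e2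
    simp only [vconv_zero_right_apply, add_zero, hder, mul_ite, mul_one, mul_zero] at e2
    rw [Finset.sum_eq_single b (fun b' _ hb => by simp [hb]) (by simp),
      Finset.sum_eq_single N (fun m _ hm => by simp [hm])
        (fun hm => absurd (Finset.mem_range.2 (by omega)) hm)] at e2
    simp only [and_self, if_true] at e2
    refine e2.trans ?_
    unfold volterraOp
    rw [intervalIntegral.integral_same, add_zero, Finset.sum_apply]
    simp only [mulVec_apply_eq_sum]
    simp only [fun i b' => iteratedDerivWithin_pi_apply hT
      (contDiffOn_nat_of_infty hsm.contDiffOn i) h0 b', hder, mul_ite, mul_one, mul_zero]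
    split_ifs with h
    · rw [Finset.sum_eq_single N (fun m _ hm => by simp [hm])
        (fun hm => absurd (Finset.mem_range.2 (by omega)) hm),
        Finset.sum_eq_single b (fun b' _ hb => by simp [hb]) (by simp)]
      simp
    · refine Finset.sum_eq_zero fun m hm => Finset.sum_eq_zero fun b' _ => ?_
      rw [Finset.mem_range] at hm
      rw [if_neg (by rintro ⟨-, rfl⟩; omega)]
  -- Exponents below `l` belong to derivatives of order above `k`, which are absent after
  -- regularization. Hence `X^l` can be divided out, and the exponent `l` gives the leading
  -- coefficient at `t = 0`.
  let U : Matrix (Fin n) (Fin n) (PowerSeries ℝ) := Matrix.of fun c b =>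
    PowerSeries.mk fun e => PowerSeries.coeff (e + l) ((polySymbol l L * S.symbol) c b)
  have hU : polySymbol l L * S.symbol = (PowerSeries.X ^ l : PowerSeries ℝ) • U := by
    ext c b e
    rw [Matrix.smul_apply, smul_eq_mul, PowerSeries.coeff_X_pow_mul']
    split_ifs with h
    · simp [U, Nat.sub_add_cancel h]
    · have := key (k + l - e) (by omega) c b
      rw [if_neg (by omega), show k + l - (k + l - e) = e by omega] at this
      exact this
  have hU0 : (PowerSeries.constantCoeff (R := ℝ)).mapMatrix U = A' k 0 := by
    ext c b
    have := key k (by omega) c b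
    rw [if_pos le_rfl, Nat.add_sub_cancel_left] at this
    simp [U, this]
  have hUd : U.det ≠ 0 := by
    intro h
    apply hdet 0 h0
    rw [← hU0, ← RingHom.map_det, h, map_zero]
  intro hS
  have := congrArg Matrix.det hU
  rw [Matrix.det_mul, hS, mul_zero, Matrix.det_smul] at this
  exact mul_ne_zero (pow_ne_zero _ (pow_ne_zero _ PowerSeries.X_ne_zero)) hUd this.symm

/-- The adjugate inverts the symbol up to the determinant. Differential operators only offer
polynomials of degree at most `l`, but a truncation at that degree leaves the product unchanged up
to degree `l`, and higher degrees concern only derivatives of order below `k`. -/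
theorem hasLRO_of_det_symbol_ne_zero (hT : 0 < T) (S : IDESystem T n p) (h : S.symbol.det ≠ 0) :
    S.HasLRO := by
  set M := S.symbol with hM
  set l := M.det.order.toNat with hl
  set u := PowerSeries.divXPowOrder M.det with hu
  have hXu : PowerSeries.X ^ l * u = M.det := PowerSeries.X_pow_order_mul_divXPowOrder
  have hu0 : PowerSeries.constantCoeff u ≠ 0 := by
    rwa [Ne, PowerSeries.constantCoeff_divXPowOrder_eq_zero_iff]
  -- Dividing by the unit part of the determinant makes the product exactly `X^l`, so the
  -- regularized leading coefficient will be the identity.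
  let B : Matrix (Fin n) (Fin n) (PowerSeries ℝ) := u⁻¹ • M.adjugate
  have hB : B * M = (PowerSeries.X ^ l : PowerSeries ℝ) • 1 := by
    simp only [B]
    rw [Matrix.smul_mul, Matrix.adjugate_mul, smul_smul, ← hXu, mul_left_comm,
      PowerSeries.inv_mul_cancel _ hu0, mul_one]
  let L : ℕ → Matrix (Fin n) (Fin n) ℝ := fun j => Matrix.of fun a b =>
    PowerSeries.coeff (l - j) (B a b)
  let C : ℕ → Matrix (Fin n) (Fin n) ℝ := fun N => Matrix.of fun a b =>
    PowerSeries.coeff (S.order + l - N) ((polySymbol l L * M) a b)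
  have hC : ∀ N, S.order ≤ N → N ≤ S.order + l →
      C N = if N = S.order then 1 else 0 := by
    intro N h1 h2
    -- For `N ≥ k` the exponent is at most `l`, so the truncated and the full series give the same
    -- coefficient.
    have hlow : C N = Matrix.of fun a b => PowerSeries.coeff (S.order + l - N) ((B * M) a b) := by
      ext a c
      simp only [C, Matrix.of_apply, Matrix.mul_apply, map_sum]
      refine Finset.sum_congr rfl fun b _ => ?_
      rw [PowerSeries.coeff_mul, PowerSeries.coeff_mul]
      refine Finset.sum_congr rfl fun q hq => ?_
      have hq' : q.1 + q.2 = _ := Finset.HasAntidiagonal.mem_antidiagonal.1 hq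
      congr 1
      simp only [polySymbol, Matrix.of_apply, map_sum, PowerSeries.coeff_C_mul,
        PowerSeries.coeff_X_pow, mul_ite, mul_one, mul_zero, L]
      rw [Finset.sum_eq_single (l - q.1)]
      · rw [if_pos (by omega), show l - (l - q.1) = q.1 by omega]
      · intro j hj hne
        rw [Finset.mem_range] at hj
        rw [if_neg (by omega)]
      · intro hj
        exact absurd (Finset.mem_range.2 (by omega)) hj
    rw [hlow, hB]
    ext a c
    simp only [Matrix.of_apply, Matrix.smul_apply, smul_eq_mul, Matrix.one_apply, mul_ite, mul_one,
      mul_zero]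
    by_cases hN : N = S.order
    · subst hN
      by_cases hac : a = c <;> simp [hac, PowerSeries.coeff_X_pow, Matrix.one_apply]
    · rw [if_neg hN]
      by_cases hac : a = c
      · rw [if_pos hac, PowerSeries.coeff_X_pow, if_neg (by omega)]; rfl
      · rw [if_neg hac]; simp
  have hKd : ∀ j a b, ContinuousOn (∂[T,j] (fun u => S.K u a b)) (Icc 0 T) := fun j a b =>
    (contDiffOn_infty_iteratedDerivWithin hT (S.contDiffOn_K hT a b) j).continuousOn
  let K' : ℝ → Matrix (Fin n) (Fin n) ℝ := fun u => Matrix.of fun c b =>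
    ∑ j ∈ Finset.range (l + 1), ∑ a, L j c a * ∂[T,j] (fun u => S.K u a b) u
  have hK' : ∀ a b, ContinuousOn (fun u => K' u a b) (Icc 0 T) := by
    intro c b
    have h : ContinuousOn (fun u => ∑ j ∈ Finset.range (l + 1), ∑ a,
        L j c a * ∂[T,j] (fun u => S.K u a b) u) (Icc 0 T) := by
      refine continuousOn_finsetSum _ fun j _ => continuousOn_finsetSum _ fun a _ => ?_
      exact continuousOn_const.mul (hKd j a b)
    exact h
  refine ⟨l, L, fun N _ => C N, K', fun _ _ _ _ => continuousOn_const, hK', fun t _ => ?_,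
    fun z hz t ht => ?_⟩
  · change (C S.order).det ≠ 0
    rw [hC _ le_rfl (by omega), if_pos rfl, Matrix.det_one]
    exact one_ne_zero
  · ext c
    have hz' : ContDiffOn ℝ S.order z (Icc 0 T) := hz.of_le (by norm_cast; omega)
    refine (sum_mulVec_iteratedDerivWithin_constOp hT L (S.contDiffOn_K hT) hz ht c).trans ?_
    refine Eq.trans ?_ (constOp_apply hT hK' hz' ht c).symm
    refine Finset.sum_congr rfl fun b _ => ?_
    unfold scalarOp
    congr 1
    symm
    -- The derivatives of order above `k` have zero coefficients and can be dropped.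
    refine Finset.sum_subset (Finset.range_subset_range.2 (by omega)) fun N h1 h2 => ?_
    rw [Finset.mem_range] at h1 h2
    have : C N c b = 0 := by rw [hC N (by omega) (by omega), if_neg (by omega)]; rfl
    exact mul_eq_zero_of_left this _

end IDESystem

/-! ### Linearity of operators, jets and symbols -/

section Linearity

variable {T : ℝ} {α β : Type} [Fintype α] [Fintype β]

theorem scalarOp_congr {k : ℕ} {a : ℕ → ℝ} {K K' z z' : ℝ → ℝ} (hK : EqOn K K' (Icc 0 T))
    (hz : EqOn z z' (Icc 0 T)) {t : ℝ} (ht : t ∈ Icc 0 T) :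
    scalarOp T k a K z t = scalarOp T k a K' z' t := by
  unfold scalarOp
  rw [vconv_congr hK hz ht]
  congr 1
  exact Finset.sum_congr rfl fun i _ => by rw [iteratedDerivWithin_congr hz ht]

theorem scalarOp_add (hT : 0 < T) {k : ℕ} {a : ℕ → ℝ} {K z z' : ℝ → ℝ}
    (hK : ContinuousOn K (Icc 0 T)) (hz : ContDiffOn ℝ k z (Icc 0 T))
    (hz' : ContDiffOn ℝ k z' (Icc 0 T)) {t : ℝ} (ht : t ∈ Icc 0 T) :
    scalarOp T k a K (fun s => z s + z' s) t = scalarOp T k a K z t + scalarOp T k a K z' t := by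
  unfold scalarOp
  rw [vconv_add_right hK hz.continuousOn hz'.continuousOn ht, add_add_add_comm,
    ← Finset.sum_add_distrib]
  congr 1
  refine Finset.sum_congr rfl fun i hi => ?_
  rw [Finset.mem_range] at hi
  rw [iteratedDerivWithin_fun_add ht (uniqueDiffOn_Icc hT)
    (hz.of_le (by norm_cast; omega) t ht) (hz'.of_le (by norm_cast; omega) t ht), mul_add]

theorem scalarOp_const_mul {k : ℕ} {a : ℕ → ℝ} {K z : ℝ → ℝ} (c t : ℝ) :
    scalarOp T k a K (fun s => c * z s) t = c * scalarOp T k a K z t := by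
  unfold scalarOp
  rw [vconv_const_mul_right, mul_add, Finset.mul_sum]
  congr 1
  exact Finset.sum_congr rfl fun i _ => by rw [iteratedDerivWithin_const_mul_field]; ring

theorem scalarOp_sum (hT : 0 < T) {ι : Type*} (I : Finset ι) {k : ℕ} {a : ℕ → ℝ} {K : ℝ → ℝ}
    {z : ι → ℝ → ℝ} (hK : ContinuousOn K (Icc 0 T))
    (hz : ∀ i ∈ I, ContDiffOn ℝ k (z i) (Icc 0 T)) {t : ℝ} (ht : t ∈ Icc 0 T) :
    scalarOp T k a K (fun s => ∑ i ∈ I, z i s) t = ∑ i ∈ I, scalarOp T k a K (z i) t := by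
  classical
  induction I using Finset.induction_on with
  | empty =>
    have := scalarOp_const_mul (T := T) (k := k) (a := a) (K := K) (z := fun _ => 0) 0 t
    simpa using this
  | insert i I hi ih =>
    simp only [Finset.sum_insert hi]
    rw [scalarOp_add hT hK (hz i (Finset.mem_insert_self _ _))
      (ContDiffOn.sum fun j hj => hz j (Finset.mem_insert_of_mem hj)) ht,
      ih fun j hj => hz j (Finset.mem_insert_of_mem hj)]

theorem constOp_congr (hT : 0 < T) {k : ℕ} {A : ℕ → Matrix α β ℝ} {K : ℝ → Matrix α β ℝ}
    {z z' : ℝ → β → ℝ} (hK : ∀ a b, ContinuousOn (fun u => K u a b) (Icc 0 T))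
    (hz : ContDiffOn ℝ k z (Icc 0 T)) (h : EqOn z z' (Icc 0 T)) :
    EqOn (constOp T k A K z) (constOp T k A K z') (Icc 0 T) := by
  intro t ht
  ext a
  rw [constOp_apply hT hK hz ht, constOp_apply hT hK (hz.congr fun s hs => (h hs).symm) ht]
  exact Finset.sum_congr rfl fun b _ =>
    scalarOp_congr (fun _ _ => rfl) (fun s hs => congrFun (h hs) b) ht

theorem constOp_add (hT : 0 < T) {k : ℕ} {A : ℕ → Matrix α β ℝ} {K : ℝ → Matrix α β ℝ}
    {z z' : ℝ → β → ℝ} (hK : ∀ a b, ContinuousOn (fun u => K u a b) (Icc 0 T))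
    (hz : ContDiffOn ℝ k z (Icc 0 T)) (hz' : ContDiffOn ℝ k z' (Icc 0 T)) {t : ℝ}
    (ht : t ∈ Icc 0 T) :
    constOp T k A K (fun s => z s + z' s) t = constOp T k A K z t + constOp T k A K z' t := by
  ext a
  rw [Pi.add_apply, constOp_apply hT hK (hz.add hz') ht, constOp_apply hT hK hz ht,
    constOp_apply hT hK hz' ht, ← Finset.sum_add_distrib]
  exact Finset.sum_congr rfl fun b _ =>
    scalarOp_add hT (hK a b) (contDiffOn_pi.1 hz b) (contDiffOn_pi.1 hz' b) ht

theorem constOp_sub (hT : 0 < T) {k : ℕ} {A : ℕ → Matrix α β ℝ} {K : ℝ → Matrix α β ℝ}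
    {z z' : ℝ → β → ℝ} (hK : ∀ a b, ContinuousOn (fun u => K u a b) (Icc 0 T))
    (hz : ContDiffOn ℝ k z (Icc 0 T)) (hz' : ContDiffOn ℝ k z' (Icc 0 T)) {t : ℝ}
    (ht : t ∈ Icc 0 T) :
    constOp T k A K (fun s => z s - z' s) t = constOp T k A K z t - constOp T k A K z' t := by
  have h := constOp_add (A := A) hT hK (hz.sub hz') hz' ht
  simp only [sub_add_cancel] at h
  rw [h]
  exact (add_sub_cancel_right _ _).symm

theorem jet_congr (hT : 0 < T) {z z' : ℝ → ℝ} (h : EqOn z z' (Icc 0 T)) : jet T z = jet T z' := by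
  ext m
  rw [jet, jet, PowerSeries.coeff_mk, PowerSeries.coeff_mk,
    iteratedDerivWithin_congr h (left_mem_Icc.2 hT.le)]

theorem jet_sum (hT : 0 < T) {ι : Type*} (I : Finset ι) {z : ι → ℝ → ℝ}
    (hz : ∀ i ∈ I, ContDiffOn ℝ ∞ (z i) (Icc 0 T)) :
    jet T (fun s => ∑ i ∈ I, z i s) = ∑ i ∈ I, jet T (z i) := by
  ext m
  have h0 : (0 : ℝ) ∈ Icc 0 T := left_mem_Icc.2 hT.le
  rw [map_sum, jet, PowerSeries.coeff_mk, iteratedDerivWithin_fun_sum h0 (uniqueDiffOn_Icc hT)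
    fun i hi => contDiffOn_nat_of_infty (hz i hi) m 0 h0]
  simp only [jet, PowerSeries.coeff_mk]

theorem jet_const_mul (c : ℝ) (z : ℝ → ℝ) :
    jet T (fun s => c * z s) = PowerSeries.C c * jet T z := by
  ext m
  simp [jet]

theorem X_pow_mul_jet_constOp (hT : 0 < T) {k : ℕ} {A : ℕ → Matrix α β ℝ}
    {K : ℝ → Matrix α β ℝ} {z : ℝ → β → ℝ}
    (hK : ∀ a b, ContDiffOn ℝ ∞ (fun u => K u a b) (Icc 0 T))
    (hz : ContDiffOn ℝ ∞ z (Icc 0 T))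
    (h0 : ∀ b, PowerSeries.X ^ k ∣ jet T (fun s => z s b)) (a : α) :
    PowerSeries.X ^ k * jet T (fun s => constOp T k A K z s a)
      = ∑ b, matrixSymbol T k A K a b * jet T (fun s => z s b) := by
  have hb := contDiffOn_pi.1 hz
  rw [jet_congr hT fun t ht => constOp_apply hT (fun a b => (hK a b).continuousOn)
    (contDiffOn_nat_of_infty hz k) ht a, jet_sum hT _ fun b _ => contDiffOn_infty.2 fun j =>
      contDiffOn_scalarOp hT (hK a b) (contDiffOn_nat_of_infty (hb b) _), Finset.mul_sum]
  exact Finset.sum_congr rfl fun b _ => X_pow_mul_jet_scalarOp hT (hK a b) (hb b) (h0 b)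

theorem scalarSymbol_congr (hT : 0 < T) {k : ℕ} {a a' : ℕ → ℝ} {K K' : ℝ → ℝ}
    (ha : ∀ i ≤ k, a i = a' i) (hK : EqOn K K' (Icc 0 T)) :
    scalarSymbol T k a K = scalarSymbol T k a' K' := by
  ext e
  rw [scalarSymbol, scalarSymbol, PowerSeries.coeff_mk, PowerSeries.coeff_mk, ha _ (by omega),
    iteratedDerivWithin_congr hK (left_mem_Icc.2 hT.le)]

theorem scalarSymbol_sum (hT : 0 < T) {ι : Type*} (I : Finset ι) (k : ℕ) (p : ι → ℝ)
    (a : ι → ℕ → ℝ) {K : ι → ℝ → ℝ} (hK : ∀ c ∈ I, ContDiffOn ℝ ∞ (K c) (Icc 0 T)) :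
    scalarSymbol T k (fun i => ∑ c ∈ I, p c * a c i) (fun u => ∑ c ∈ I, p c * K c u)
      = ∑ c ∈ I, PowerSeries.C (p c) * scalarSymbol T k (a c) (K c) := by
  ext e
  have h0 : (0 : ℝ) ∈ Icc 0 T := left_mem_Icc.2 hT.le
  simp only [map_sum, PowerSeries.coeff_C_mul, scalarSymbol, PowerSeries.coeff_mk]
  split_ifs with h
  · rfl
  · rw [iteratedDerivWithin_fun_sum h0 (uniqueDiffOn_Icc hT) fun c hc =>
      (contDiffOn_const.mul (contDiffOn_nat_of_infty (hK c hc) _)) 0 h0]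
    simp only [iteratedDerivWithin_const_mul_field]

/-- The normalization by `X^k` depends on the declared order, so declaring too large an order costs
a power of `X`. -/
theorem scalarSymbol_eq_X_pow_mul {k κ : ℕ} (hκ : κ ≤ k) {a : ℕ → ℝ} {K : ℝ → ℝ}
    (ha : ∀ i, κ < i → i ≤ k → a i = 0) :
    scalarSymbol T k a K = PowerSeries.X ^ (k - κ) * scalarSymbol T κ a K := by
  ext e
  rw [PowerSeries.coeff_X_pow_mul']
  simp only [scalarSymbol, PowerSeries.coeff_mk]
  split_ifs with h1 h2 h3 h3 h3
  · rw [show κ - (e - (k - κ)) = k - e by omega]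
  · omega
  · exact ha _ (by omega) (by omega)
  · omega
  · rw [show e - (k - κ) - κ - 1 = e - k - 1 by omega]
  · omega

end Linearity

/-! ### Multiplication by constant matrices -/

section MatrixProducts

variable {T : ℝ} {α β γ : Type}

theorem matrixSymbol_mul_left [Fintype α] (hT : 0 < T) (k : ℕ) (P : Matrix γ α ℝ) (A : ℕ → Matrix α β ℝ)
    {K : ℝ → Matrix α β ℝ} (hK : ∀ a b, ContDiffOn ℝ ∞ (fun u => K u a b) (Icc 0 T)) :
    matrixSymbol T k (fun i => P * A i) (fun u => P * K u)
      = P.map PowerSeries.C * matrixSymbol T k A K := by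
  ext1 c b
  exact scalarSymbol_sum hT _ k (P c) (fun a i => A i a b) fun a _ => hK a b

theorem matrixSymbol_mul_right [Fintype β] (hT : 0 < T) (k : ℕ) (Q : Matrix β γ ℝ) (A : ℕ → Matrix α β ℝ)
    {K : ℝ → Matrix α β ℝ} (hK : ∀ a b, ContDiffOn ℝ ∞ (fun u => K u a b) (Icc 0 T)) :
    matrixSymbol T k (fun i => A i * Q) (fun u => K u * Q)
      = matrixSymbol T k A K * Q.map PowerSeries.C := by
  ext1 a c
  have h := scalarSymbol_sum hT Finset.univ k (fun b => Q b c) (fun b i => A i a b)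
    fun b _ => hK a b
  simp only [matrixSymbol, Matrix.of_apply, Matrix.mul_apply, Matrix.map_apply, mul_comm (A _ a _),
    mul_comm (K _ a _)]
  rw [h]
  exact Finset.sum_congr rfl fun b _ => mul_comm _ _

theorem contDiffOn_matrix_mul_left [Fintype α] {k : ℕ∞ω} (P : Matrix γ α ℝ) {K : ℝ → Matrix α β ℝ}
    (hK : ∀ a b, ContDiffOn ℝ k (fun u => K u a b) (Icc 0 T)) (c : γ) (b : β) :
    ContDiffOn ℝ k (fun u => (P * K u) c b) (Icc 0 T) := by
  simp only [Matrix.mul_apply]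
  exact ContDiffOn.sum fun a _ => contDiffOn_const.mul (hK a b)

theorem contDiffOn_matrix_mul_right [Fintype β] {k : ℕ∞ω} (Q : Matrix β γ ℝ) {K : ℝ → Matrix α β ℝ}
    (hK : ∀ a b, ContDiffOn ℝ k (fun u => K u a b) (Icc 0 T)) (a : α) (c : γ) :
    ContDiffOn ℝ k (fun u => (K u * Q) a c) (Icc 0 T) := by
  simp only [Matrix.mul_apply]
  exact ContDiffOn.sum fun b _ => (hK a b).mul contDiffOn_const

theorem analyticOnNhd_mul_left [Fintype α] {s : Set ℝ} (P : Matrix γ α ℝ) {K : ℝ → Matrix α β ℝ}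
    (hK : ∀ a b, AnalyticOnNhd ℝ (fun u => K u a b) s) (c : γ) (b : β) :
    AnalyticOnNhd ℝ (fun u => (P * K u) c b) s := by
  simp only [Matrix.mul_apply]
  exact Finset.analyticOnNhd_fun_sum _ fun a _ => analyticOnNhd_const.mul (hK a b)

theorem analyticOnNhd_mul_right [Fintype β] {s : Set ℝ} (Q : Matrix β γ ℝ) {K : ℝ → Matrix α β ℝ}
    (hK : ∀ a b, AnalyticOnNhd ℝ (fun u => K u a b) s) (a : α) (c : γ) :
    AnalyticOnNhd ℝ (fun u => (K u * Q) a c) s := by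
  simp only [Matrix.mul_apply]
  exact Finset.analyticOnNhd_fun_sum _ fun b _ => (hK a b).mul analyticOnNhd_const

end MatrixProducts

/-! ### Effect of a differentiation step on the symbol -/

namespace IDESystem

variable {T : ℝ} {n p : ℕ}

theorem iteratedDerivWithin_eq_of_analytic (hT : 0 < T) {f : ℝ → ℝ}
    (hf : AnalyticOnNhd ℝ f (Icc 0 T)) (j : ℕ) {t : ℝ} (ht : t ∈ Icc 0 T) :
    ∂[T,j] f t = iteratedDeriv j f t :=
  iteratedDerivWithin_eq_iteratedDeriv (uniqueDiffOn_Icc hT) (hf t ht).contDiffAt ht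

/-- Differentiating a purely integral equation shifts the Taylor coefficients of its kernel, so its
row is divided by `X^j`. Minimality of `j` ensures that no nonzero coefficient is lost: the first
one to survive becomes the coefficient at `v`. -/
theorem diagonal_mul_symbol_of_diffStep (hT : 0 < T) {S S' : IDESystem T n p}
    (h : DiffStep S S') : ∃ (P : Matrix (Fin n) (Fin n) ℝ) (D : Finset (Fin n)) (j : ℕ),
      P.det ≠ 0 ∧ D.Nonempty ∧ 1 ≤ j ∧
      Matrix.diagonal (fun a => if a ∈ D then (PowerSeries.X : PowerSeries ℝ) ^ j else 1)
        * S'.symbol = P.map PowerSeries.C * S.symbol := by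
  obtain ⟨P, D, j, hP, hD, hj, hord, hpure, hmin, -, hin, hout⟩ := h
  refine ⟨P, D, j, hP, hD, hj, ?_⟩
  have h0 : (0 : ℝ) ∈ Icc 0 T := left_mem_Icc.2 hT.le
  have hKa : ∀ a b, AnalyticOnNhd ℝ (fun u => (P * S.K u) a b) (Icc 0 T) :=
    analyticOnNhd_mul_left P S.analytic_K
  unfold symbol
  rw [← matrixSymbol_mul_left hT S.order P S.A (S.contDiffOn_K hT), hord]
  ext1 a b
  rw [Matrix.diagonal_mul]
  by_cases ha : a ∈ D
  · rw [if_pos ha]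
    obtain ⟨hA0, hAi, hK, -⟩ := hin a ha
    ext e
    rw [PowerSeries.coeff_X_pow_mul']
    simp only [matrixSymbol, Matrix.of_apply, scalarSymbol, PowerSeries.coeff_mk]
    have hder : ∀ m, ∂[T,m] (fun u => S'.K u a b) 0
        = iteratedDeriv (m + j) (fun u => (P * S.K u) a b) 0 := by
      intro m
      rw [iteratedDerivWithin_congr (g := ∂[T,j] (fun u => (P * S.K u) a b)) (fun u hu => by
        rw [hK u hu b, iteratedDerivWithin_eq_of_analytic hT (hKa a b) j hu]) h0,
        iteratedDerivWithin_comp_iteratedDerivWithin,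
        iteratedDerivWithin_eq_of_analytic hT (hKa a b) _ h0]
    rw [iteratedDerivWithin_eq_of_analytic hT (hKa a b) _ h0, hder]
    by_cases h1 : e ≤ S.order
    · rw [if_pos h1, hpure a ha _ (by omega)]
      by_cases h2 : j ≤ e
      · rw [if_pos h2, if_pos (by omega), hAi _ (by omega) (by omega)]
      · rw [if_neg h2]
    · rw [if_neg h1]
      by_cases h2 : j ≤ e
      · rw [if_pos h2]
        by_cases h3 : e - j ≤ S.order
        · rw [if_pos h3]
          -- At `e - j = k` stands the coefficient `K₂^(j-1)(0)` of the new equation. Below that,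
          -- the kernel derivative has index less than `j - 1` and vanishes by minimality.
          rcases Nat.eq_or_lt_of_le h3 with h4 | h4
          · rw [h4, Nat.sub_self, hA0, show j - 1 = e - S.order - 1 by omega]
          · rw [hAi _ (by omega) (by omega), hmin _ (by omega) a ha]
        · rw [if_neg h3, show e - j - S.order - 1 + j = e - S.order - 1 by omega]
      · rw [if_neg h2, hmin _ (by omega) a ha]
  · rw [if_neg ha, one_mul]
    obtain ⟨hA, hK, -⟩ := hout a ha
    exact scalarSymbol_congr hT (fun i hi => hA i hi b) fun u hu => hK u hu b

theorem det_map_C {m : Type} [Fintype m] [DecidableEq m] (P : Matrix m m ℝ) :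
    (P.map (PowerSeries.C (R := ℝ))).det = PowerSeries.C P.det := by
  rw [RingHom.map_det]; rfl

theorem det_map_C_ne_zero {m : Type} [Fintype m] [DecidableEq m] {P : Matrix m m ℝ}
    (hP : P.det ≠ 0) : (P.map (PowerSeries.C (R := ℝ))).det ≠ 0 := by
  rw [det_map_C]
  exact (map_ne_zero_iff _ PowerSeries.C_injective).2 hP

theorem det_symbol_ne_zero_iff_of_diffStep (hT : 0 < T) {S S' : IDESystem T n p}
    (h : DiffStep S S') : S.symbol.det ≠ 0 ↔ S'.symbol.det ≠ 0 := by
  obtain ⟨P, D, j, hP, -, -, e⟩ := diagonal_mul_symbol_of_diffStep hT h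
  have hd := congrArg Matrix.det e
  rw [Matrix.det_mul, Matrix.det_mul, Matrix.det_diagonal] at hd
  have h1 : ∏ a, (if a ∈ D then (PowerSeries.X : PowerSeries ℝ) ^ j else 1) ≠ 0 := by
    refine Finset.prod_ne_zero_iff.2 fun a _ => ?_
    split_ifs
    · exact pow_ne_zero _ PowerSeries.X_ne_zero
    · exact one_ne_zero
  have h2 := det_map_C_ne_zero hP
  constructor
  · intro hS hS'
    rw [hS', mul_zero] at hd
    exact mul_ne_zero h2 hS hd.symm
  · intro hS' hS
    rw [hS, mul_zero] at hd
    exact mul_ne_zero h1 hS' hd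

/-- At least one row loses a factor `X^j` with `j ≥ 1`, while the constant matrix `P` contributes a
unit. This order is the quantity that bounds the number of consecutive differentiations. -/
theorem order_det_symbol_lt_of_diffStep (hT : 0 < T) {S S' : IDESystem T n p}
    (h : DiffStep S S') (hS : S.symbol.det ≠ 0) :
    S'.symbol.det.order < S.symbol.det.order := by
  have hS' := (det_symbol_ne_zero_iff_of_diffStep hT h).1 hS
  obtain ⟨P, D, j, hP, ⟨r, hr⟩, hj, e⟩ := diagonal_mul_symbol_of_diffStep hT h
  have hd := congrArg (fun M => (Matrix.det M).order) e
  simp only [Matrix.det_mul, Matrix.det_diagonal, PowerSeries.order_mul] at hd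
  have h2 : (P.map (PowerSeries.C (R := ℝ))).det.order = 0 := by
    rw [det_map_C]
    exact PowerSeries.order_zero_of_unit ((isUnit_iff_ne_zero.2 hP).map PowerSeries.C)
  have h1 : 1 ≤ (∏ a, (if a ∈ D then (PowerSeries.X : PowerSeries ℝ) ^ j else 1)).order := by
    rw [← Finset.mul_prod_erase _ _ (Finset.mem_univ r), if_pos hr, PowerSeries.order_mul,
      PowerSeries.order_X_pow]
    exact le_add_right (by exact_mod_cast hj)
  rw [h2, zero_add] at hd
  rw [← hd]
  have hfin : S'.symbol.det.order ≠ ⊤ := fun h => hS' (PowerSeries.order_eq_top.1 h)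
  calc S'.symbol.det.order < S'.symbol.det.order + 1 :=
        (ENat.lt_add_one_iff hfin).2 le_rfl
    _ ≤ _ := by rw [add_comm]; gcongr

/-- The constant term of the symbol is the leading coefficient. -/
theorem det_symbol_ne_zero_of_det_ne_zero (S : IDESystem T n p) (h : (S.A S.order).det ≠ 0) :
    S.symbol.det ≠ 0 := by
  have h0 : (PowerSeries.constantCoeff (R := ℝ)).mapMatrix S.symbol = S.A S.order := by
    ext a b
    simp [symbol, matrixSymbol, scalarSymbol, ← PowerSeries.coeff_zero_eq_constantCoeff_apply]
  intro hS
  apply h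
  rw [← h0, ← RingHom.map_det, hS, map_zero]

end IDESystem

/-! ### Effect of a splitting step on the symbol -/

/-- Viewed as an operator of order zero, the resolvent falls under the general results on
regularity, linearity and jets. -/
theorem resolventApply_eq_constOp (T : ℝ) {m : ℕ} (κ : ℕ) (A : ℕ → Matrix (Fin m) (Fin m) ℝ)
    (R : ℝ → Matrix (Fin m) (Fin m) ℝ) (ψ : ℝ → Fin m → ℝ) :
    resolventApply κ A R ψ
      = constOp T 0 (fun _ => if κ = 0 then (A 0)⁻¹ else 0) R ψ := by
  funext t
  unfold resolventApply constOp volterraOp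
  by_cases h : κ = 0 <;> simp [h]

namespace IDESystem

variable {T : ℝ}

theorem contDiffOn_rhs {n p : ℕ} (S : IDESystem T n p) (c : Fin p → ℝ) :
    ContDiffOn ℝ ∞ (S.rhs c) (Icc 0 T) := by
  refine S.smooth_f.add (contDiffOn_pi.2 fun a => ?_)
  simp only [mulVec_apply_eq_sum]
  exact ContDiffOn.sum fun b _ => (S.smooth_W a b).mul contDiffOn_const

theorem contDiffOn_mulVec {α β : Type} [Fintype α] [Fintype β] (P : Matrix α β ℝ)
    {f : ℝ → β → ℝ} (hf : ContDiffOn ℝ ∞ f (Icc 0 T)) (a : α) :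
    ContDiffOn ℝ ∞ (fun t => (P *ᵥ f t) a) (Icc 0 T) := by
  simp only [mulVec_apply_eq_sum]
  exact ContDiffOn.sum fun b _ => contDiffOn_const.mul (contDiffOn_pi.1 hf b)

/-- The symbol of a system is, up to invertible factors, block triangularized by a splitting step;
its determinant vanishes if and only if that of the reduced system does. -/
theorem det_symbol_ne_zero_iff_of_splitStep (hT : 0 < T) {n p n₁ d : ℕ} {S : IDESystem T n p}
    {S₁ : IDESystem T n₁ (p + d)} (h : SplitStep S S₁) :
    S.symbol.det ≠ 0 ↔ S₁.symbol.det ≠ 0 := by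
  obtain ⟨n₂, κ, P, Q', Q, P', W₂, R, Θ, -, hκ, hord, ⟨hPP, hPP'⟩, ⟨hQQ, hQQ'⟩, hB, hdet, -, hR,
    hsub⟩ := h
  set B : ℕ → Matrix (Fin n₁ ⊕ Fin n₂) (Fin n₁ ⊕ Fin n₂) ℝ := fun i => P * S.A i * Q with hBdef
  set N : ℝ → Matrix (Fin n₁ ⊕ Fin n₂) (Fin n₁ ⊕ Fin n₂) ℝ := fun u => P * S.K u * Q with hNdef
  set k := S.order with hk
  have h0 : (0 : ℝ) ∈ Icc 0 T := left_mem_Icc.2 hT.le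
  have hu := uniqueDiffOn_Icc hT
  have hN : ∀ a b, ContDiffOn ℝ ∞ (fun u => N u a b) (Icc 0 T) :=
    contDiffOn_matrix_mul_right Q (contDiffOn_matrix_mul_left P (S.contDiffOn_K hT))
  have hRs : ∀ a b, ContDiffOn ℝ ∞ (fun u => R u a b) (Icc 0 T) := fun a b =>
    (hR.1 a b).contDiffOn_infty hu
  let M₁₁ := matrixSymbol T k (fun i => (B i).toBlocks₁₁) (fun u => (N u).toBlocks₁₁)
  let M₁₂ := matrixSymbol T k (fun i => (B i).toBlocks₁₂) (fun u => (N u).toBlocks₁₂)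
  let M₂₁ := matrixSymbol T κ (fun i => (B i).toBlocks₂₁) (fun u => (N u).toBlocks₂₁)
  let M₂₂ := matrixSymbol T κ (fun i => (B i).toBlocks₂₂) (fun u => (N u).toBlocks₂₂)
  have hN11 : ∀ a b, ContDiffOn ℝ ∞ (fun u => (N u).toBlocks₁₁ a b) (Icc 0 T) :=
    fun a b => hN (Sum.inl a) (Sum.inl b)
  have hN12 : ∀ a b, ContDiffOn ℝ ∞ (fun u => (N u).toBlocks₁₂ a b) (Icc 0 T) :=
    fun a b => hN (Sum.inl a) (Sum.inr b)
  have hN21 : ∀ a b, ContDiffOn ℝ ∞ (fun u => (N u).toBlocks₂₁ a b) (Icc 0 T) :=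
    fun a b => hN (Sum.inr a) (Sum.inl b)
  have hN22 : ∀ a b, ContDiffOn ℝ ∞ (fun u => (N u).toBlocks₂₂ a b) (Icc 0 T) :=
    fun a b => hN (Sum.inr a) (Sum.inr b)
  -- the effect of the elimination on monomials of high degree
  have key : ∀ b₀ : Fin n₁, ∃ y : Fin n₂ → PowerSeries ℝ,
      (∀ c, M₂₁ c b₀ * PowerSeries.X ^ (2 * k) + ∑ e, M₂₂ c e * y e = 0) ∧
      ∀ a, M₁₁ a b₀ * PowerSeries.X ^ (2 * k) + ∑ e, M₁₂ a e * y e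
        = PowerSeries.X ^ (k - S₁.order) * S₁.symbol a b₀ * PowerSeries.X ^ (2 * k) := by
    intro b₀
    -- The exponent `2k` gives a zero deep enough that `w₂` still vanishes to order `k` after `κ <
    -- k` orders are lost in the second block. It also kills the initial values multiplied by the
    -- `Θ_i`.
    let w : ℝ → Fin n₁ → ℝ := fun t b =>
      if b = b₀ then t ^ (2 * k) / ((2 * k).factorial : ℝ) else 0
    -- Subtracting the substitution identity for the zero function removes the right-hand side of
    -- the system.
    let z : ℝ → Fin n₁ → ℝ := fun _ => 0
    have hz : ContDiffOn ℝ ∞ z (Icc 0 T) := contDiffOn_const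
    have hw : ContDiffOn ℝ ∞ w (Icc 0 T) := by
      refine (contDiff_pi.2 fun b => ?_ : ContDiff ℝ ∞ w).contDiffOn
      by_cases h : b = b₀ <;> simp only [w, h, if_true, if_false] <;> fun_prop
    have hjw : ∀ b, jet T (fun s => w s b) = if b = b₀ then PowerSeries.X ^ (2 * k) else 0 := by
      intro b
      by_cases h : b = b₀
      · simp only [w, h, if_true, jet_monomial hT]
      · simp only [w, h, if_false]
        ext m; simp [jet]
    have hjd : ∀ i ≤ k, ∀ b, PowerSeries.X ^ i ∣ jet T (fun s => w s b) := by
      intro i hi b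
      rw [hjw]
      split_ifs
      · exact pow_dvd_pow _ (by omega)
      · exact dvd_zero _
    have hw0 : ∀ i, i < κ → iteratedDerivWithin i w (Icc 0 T) 0 = 0 := by
      intro i hi
      ext b
      rw [iteratedDerivWithin_pi_apply hT (contDiffOn_nat_of_infty hw i) h0]
      have := congrArg (PowerSeries.coeff i) (hjw b)
      rw [jet, PowerSeries.coeff_mk] at this
      rw [this]
      split_ifs
      · rw [PowerSeries.coeff_X_pow, if_neg (by omega)]; rfl
      · simp
    have hz0 : ∀ i, iteratedDerivWithin i z (Icc 0 T) 0 = 0 := by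
      intro i
      simp [z]
    let g : ℝ → Fin n₂ → ℝ := fun t a => (P *ᵥ S.rhs 0 t) (Sum.inr a)
    have hg : ContDiffOn ℝ ∞ g (Icc 0 T) :=
      contDiffOn_pi.2 fun a => contDiffOn_mulVec P (S.contDiffOn_rhs 0) (Sum.inr a)
    let φ : (ℝ → Fin n₁ → ℝ) → ℝ → Fin n₂ → ℝ := fun w₁ =>
      constOp T κ (fun i => (B i).toBlocks₂₁) (fun u => (N u).toBlocks₂₁) w₁
    have hφ : ∀ w₁, ContDiffOn ℝ ∞ w₁ (Icc 0 T) → ContDiffOn ℝ ∞ (φ w₁) (Icc 0 T) := fun w₁ h =>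
      contDiffOn_infty_constOp hT hN21 h
    let ρ : (ℝ → Fin n₂ → ℝ) → ℝ → Fin n₂ → ℝ :=
      resolventApply κ (fun i => (B i).toBlocks₂₂) R
    have hρ : ∀ ψ, ContDiffOn ℝ ∞ ψ (Icc 0 T) → ContDiffOn ℝ ∞ (ρ ψ) (Icc 0 T) := fun ψ h => by
      simp only [ρ]
      rw [resolventApply_eq_constOp T]
      exact contDiffOn_infty_constOp hT hRs h
    have hgw : ∀ w₁, ContDiffOn ℝ ∞ w₁ (Icc 0 T) →
        ContDiffOn ℝ ∞ (fun t => g t - φ w₁ t) (Icc 0 T) := fun w₁ h => hg.sub (hφ w₁ h)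
    -- The change of `w₂` between the two substitutions. It solves the second block with the
    -- contribution of `w` alone on the right.
    let v : ℝ → Fin n₂ → ℝ := ρ (fun t => φ z t - φ w t)
    have hv : ContDiffOn ℝ ∞ v (Icc 0 T) := hρ _ ((hφ z hz).sub (hφ w hw))
    have hφw : ∀ t ∈ Icc 0 T, φ z t - φ w t = - φ w t := by
      intro t ht
      have : φ z t = 0 := by
        have := constOp_sub (A := fun i => (B i).toBlocks₂₁) (K := fun u => (N u).toBlocks₂₁) hT
          (fun a b => (hN21 a b).continuousOn) (contDiffOn_nat_of_infty hz κ)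
          (contDiffOn_nat_of_infty hz κ) ht
        simp only [sub_self] at this
        exact this
      rw [this, zero_sub]
    have hdiff : ∀ t ∈ Icc 0 T, ρ (fun t => g t - φ w t) t - ρ (fun t => g t - φ z t) t = v t := by
      intro t ht
      simp only [v, ρ]
      rw [resolventApply_eq_constOp T, resolventApply_eq_constOp T, resolventApply_eq_constOp T,
        ← constOp_sub hT (fun a b => (hRs a b).continuousOn)
          (contDiffOn_nat_of_infty (hgw w hw) 0) (contDiffOn_nat_of_infty (hgw z hz) 0) ht]
      simp only [sub_sub_sub_cancel_left]
    have hid : ∀ t ∈ Icc 0 T,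
        constOp T k (fun i => (B i).toBlocks₁₁) (fun u => (N u).toBlocks₁₁) w t
          + constOp T k (fun i => (B i).toBlocks₁₂) (fun u => (N u).toBlocks₁₂) v t
        = S₁.op w t := by
      intro t ht
      have e1 := hsub w (contDiffOn_nat_of_infty hw _) 0 0 t ht
      have e2 := hsub z (contDiffOn_nat_of_infty hz _) 0 0 t ht
      have s1 : ∑ i ∈ Finset.range κ, Θ i *ᵥ iteratedDerivWithin i w (Icc 0 T) 0 = 0 :=
        Finset.sum_eq_zero fun i hi => by rw [hw0 i (Finset.mem_range.1 hi), Matrix.mulVec_zero]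
      have s2 : ∑ i ∈ Finset.range κ, Θ i *ᵥ iteratedDerivWithin i z (Icc 0 T) 0 = 0 :=
        Finset.sum_eq_zero fun i _ => by rw [hz0 i, Matrix.mulVec_zero]
      simp only [s1, s2, Matrix.mulVec_zero, zero_add, add_zero] at e1 e2
      have c1 : ∀ w₁, ContDiffOn ℝ ∞ w₁ (Icc 0 T) →
          ContDiffOn ℝ k (ρ fun t => g t - φ w₁ t) (Icc 0 T) := fun w₁ h =>
        contDiffOn_nat_of_infty (hρ _ (hgw w₁ h)) k
      have d1 := constOp_sub (A := fun i => (B i).toBlocks₁₁) hT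
        (fun a b => (hN11 a b).continuousOn) (contDiffOn_nat_of_infty hw k)
        (contDiffOn_nat_of_infty hz k) ht
      have d2 := constOp_sub (A := fun i => (B i).toBlocks₁₂) hT
        (fun a b => (hN12 a b).continuousOn) (c1 w hw) (c1 z hz) ht
      have d3 := constOp_sub (A := S₁.A) hT
        (fun a b => (S₁.contDiffOn_K hT a b).continuousOn) (contDiffOn_nat_of_infty hw S₁.order)
        (contDiffOn_nat_of_infty hz S₁.order) ht
      have d4 := constOp_congr (A := fun i => (B i).toBlocks₁₂) hT
        (fun a b => (hN12 a b).continuousOn) ((c1 w hw).sub (c1 z hz)) hdiff ht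
      simp only [z, sub_zero] at d1 d3
      rw [d1, ← d4, d2]
      change _ = constOp T S₁.order S₁.A S₁.K w t
      rw [d3]
      change _ - (fun a => (P *ᵥ S.rhs 0 t) (Sum.inl a)) = constOp T S₁.order S₁.A S₁.K w t - _ at e1
      change _ - (fun a => (P *ᵥ S.rhs 0 t) (Sum.inl a)) = constOp T S₁.order S₁.A S₁.K z t - _ at e2
      have := congrArg₂ (fun x y => x - y) e1 e2
      simp only [sub_sub_sub_cancel_right] at this
      rw [← this]
      exact (add_sub_add_comm _ _ _ _).symm
    -- passing to jets
    have hjφ : ∀ c, PowerSeries.X ^ κ * jet T (fun s => φ z s c - φ w s c)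
        = - (M₂₁ c b₀ * PowerSeries.X ^ (2 * k)) := by
      intro c
      have := X_pow_mul_jet_constOp (A := fun i => (B i).toBlocks₂₁) hT hN21 hw
        (hjd κ hκ.le) c
      rw [Finset.sum_eq_single b₀ (fun b _ hb => by rw [hjw, if_neg hb, mul_zero]) (by simp),
        hjw, if_pos rfl] at this
      have e : EqOn (fun s => φ z s c - φ w s c) (fun s => (-1) * φ w s c) (Icc 0 T) :=
        fun s hs => by
          have := congrFun (hφw s hs) c
          simp only [Pi.sub_apply, Pi.neg_apply] at this
          simp only [this, neg_mul, one_mul]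
      rw [jet_congr hT e, jet_const_mul, mul_left_comm, this, map_neg, map_one, neg_one_mul]
    have hjφd : ∀ c, PowerSeries.X ^ (2 * k - κ) ∣ jet T (fun s => φ z s c - φ w s c) := by
      intro c
      have : PowerSeries.X ^ κ * PowerSeries.X ^ (2 * k - κ)
          ∣ PowerSeries.X ^ κ * jet T (fun s => φ z s c - φ w s c) := by
        rw [hjφ, ← pow_add, show κ + (2 * k - κ) = 2 * k by omega]
        exact (Dvd.intro_left _ rfl).neg_right
      exact (mul_dvd_mul_iff_left (pow_ne_zero _ PowerSeries.X_ne_zero)).1 this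
    have hsψ : ContDiffOn ℝ ∞ (fun t => φ z t - φ w t) (Icc 0 T) := (hφ z hz).sub (hφ w hw)
    -- An operator of order zero does not lower the order of vanishing, and `2k - κ ≥ k`.
    have hvd : ∀ e, PowerSeries.X ^ k ∣ jet T (fun s => v s e) := by
      intro e
      have hve : v = constOp T 0 (fun _ => if κ = 0 then ((B 0).toBlocks₂₂)⁻¹ else 0) R
          (fun t => φ z t - φ w t) := resolventApply_eq_constOp T κ _ R _
      have h1 := X_pow_mul_jet_constOp (k := 0)
        (A := fun _ => if κ = 0 then ((B 0).toBlocks₂₂)⁻¹ else 0) hT hRs hsψ (fun _ => by simp) e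
      rw [pow_zero, one_mul, ← hve] at h1
      rw [h1]
      refine Finset.dvd_sum fun c _ => Dvd.dvd.mul_left ?_ _
      exact (pow_dvd_pow _ (by omega)).trans (hjφd c)
    refine ⟨fun e => jet T (fun s => v s e), fun c => ?_, fun a => ?_⟩
    · have h1 := X_pow_mul_jet_constOp (A := fun i => (B i).toBlocks₂₂) hT hN22 hv
        (fun e => (pow_dvd_pow _ hκ.le).trans (hvd e)) c
      have h2 : EqOn (fun s => constOp T κ (fun i => (B i).toBlocks₂₂)
          (fun u => (N u).toBlocks₂₂) v s c) (fun s => φ z s c - φ w s c) (Icc 0 T) := fun s hs =>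
        congrFun ((hR.2 _ hsψ.continuousOn).2 s hs) c
      rw [jet_congr hT h2, hjφ] at h1
      change _ + ∑ e, matrixSymbol T κ (fun i => (B i).toBlocks₂₂)
          (fun u => (N u).toBlocks₂₂) c e * _ = 0
      rw [← h1, add_neg_cancel]
    · have h1 := X_pow_mul_jet_constOp (A := fun i => (B i).toBlocks₁₁) hT hN11 hw
        (hjd k le_rfl) a
      have h2 := X_pow_mul_jet_constOp (A := fun i => (B i).toBlocks₁₂) hT hN12 hv hvd a
      have h3 := X_pow_mul_jet_constOp (A := S₁.A) hT (S₁.contDiffOn_K hT) hw (hjd _ hord) a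
      rw [Finset.sum_eq_single b₀ (fun b _ hb => by rw [hjw, if_neg hb, mul_zero]) (by simp),
        hjw, if_pos rfl] at h1 h3
      have h4 : jet T (fun s => S₁.op w s a) = jet T (fun s => constOp T k
          (fun i => (B i).toBlocks₁₁) (fun u => (N u).toBlocks₁₁) w s a) + jet T (fun s =>
          constOp T k (fun i => (B i).toBlocks₁₂) (fun u => (N u).toBlocks₁₂) v s a) := by
        ext m
        simp only [jet, map_add, PowerSeries.coeff_mk]
        rw [← iteratedDerivWithin_fun_add h0 hu
          (contDiffOn_nat_of_infty (contDiffOn_pi.1 (contDiffOn_infty_constOp hT hN11 hw) a) m 0 h0)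
          (contDiffOn_nat_of_infty (contDiffOn_pi.1 (contDiffOn_infty_constOp hT hN12 hv) a) m 0 h0)]
        exact iteratedDerivWithin_congr (fun s hs => (congrFun (hid s hs) a).symm) h0
      change matrixSymbol T k (fun i => (B i).toBlocks₁₁) (fun u => (N u).toBlocks₁₁) a b₀ * _
        + ∑ e, matrixSymbol T k (fun i => (B i).toBlocks₁₂) (fun u => (N u).toBlocks₁₂) a e * _
        = _ * matrixSymbol T S₁.order S₁.A S₁.K a b₀ * _
      rw [← h1, ← h2, ← mul_add, ← h4, mul_assoc, ← h3, ← mul_assoc, ← pow_add,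
        Nat.sub_add_cancel hord]
      rfl
  choose y hy₂ hy₁ using key
  let Y : Matrix (Fin n₂) (Fin n₁) (PowerSeries ℝ) := Matrix.of fun e b => y b e
  have hM22 : M₂₂.det ≠ 0 := by
    have e0 : (PowerSeries.constantCoeff (R := ℝ)).mapMatrix M₂₂ = (B κ).toBlocks₂₂ := by
      ext a b
      simp [M₂₂, matrixSymbol, scalarSymbol, ← PowerSeries.coeff_zero_eq_constantCoeff_apply]
    intro h
    apply hdet
    change ((B κ).toBlocks₂₂).det = 0
    rw [← e0, ← RingHom.map_det, h, map_zero]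
  have hX : ∀ m : ℕ, (PowerSeries.X : PowerSeries ℝ) ^ m ≠ 0 := fun m =>
    pow_ne_zero _ PowerSeries.X_ne_zero
  -- The jets of the eliminated components form the columns of `Y`. Multiplication by a lower
  -- triangular matrix thus performs the elimination; using `X^(2k)` instead of `1` only affects the
  -- determinant by a nonzero factor.
  have tri : Matrix.fromBlocks M₁₁ M₁₂ M₂₁ M₂₂
      * Matrix.fromBlocks ((PowerSeries.X : PowerSeries ℝ) ^ (2 * k) • 1) 0 Y 1
      = Matrix.fromBlocks ((PowerSeries.X : PowerSeries ℝ) ^ (k - S₁.order + 2 * k) • S₁.symbol)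
          M₁₂ 0 M₂₂ := by
    rw [Matrix.fromBlocks_multiply]
    congr 1
    · ext1 a b
      have := hy₁ b a
      simp only [Matrix.add_apply, Matrix.smul_apply, Matrix.mul_smul, Matrix.mul_one,
        Matrix.mul_apply, smul_eq_mul, Y, Matrix.of_apply]
      rw [mul_comm _ (M₁₁ a b), this, pow_add]
      ring
    · simp
    · ext1 a b
      have := hy₂ b a
      simp only [Matrix.add_apply, Matrix.smul_apply, Matrix.mul_smul, Matrix.mul_one,
        Matrix.mul_apply, smul_eq_mul, Y, Matrix.of_apply]
      rw [mul_comm _ (M₂₁ a b), this]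
      rfl
    · simp
  -- The second block of equations has true order `κ`, so as part of a system of order `k` its rows
  -- carry the factor `X^(k-κ)`.
  have full : P.map PowerSeries.C * S.symbol * Q.map PowerSeries.C
      = Matrix.fromBlocks 1 0 0 ((PowerSeries.X : PowerSeries ℝ) ^ (k - κ) • 1)
        * Matrix.fromBlocks M₁₁ M₁₂ M₂₁ M₂₂ := by
    rw [symbol, ← matrixSymbol_mul_left hT _ P S.A (S.contDiffOn_K hT),
      ← matrixSymbol_mul_right hT _ Q _ (contDiffOn_matrix_mul_left P (S.contDiffOn_K hT)),
      Matrix.fromBlocks_multiply]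
    simp only [Matrix.one_mul, Matrix.zero_mul, add_zero, zero_add, Matrix.smul_mul]
    ext1 a b
    rcases a with a | a <;> rcases b with b | b
    · rfl
    · rfl
    · exact scalarSymbol_eq_X_pow_mul hκ.le fun i h1 h2 =>
        congrFun (congrFun (hB i h1 h2).1 a) b
    · exact scalarSymbol_eq_X_pow_mul hκ.le fun i h1 h2 =>
        congrFun (congrFun (hB i h1 h2).2 a) b
  have mapC : ∀ {α β γ : Type} [Fintype β] (X : Matrix α β ℝ) (Z : Matrix β γ ℝ),
      X.map (PowerSeries.C (R := ℝ)) * Z.map PowerSeries.C = (X * Z).map PowerSeries.C := by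
    intro α β γ _ X Z
    exact (Matrix.map_mul (f := PowerSeries.C (R := ℝ))).symm
  have mapone : ∀ {α : Type} [DecidableEq α],
      (1 : Matrix α α ℝ).map (PowerSeries.C (R := ℝ)) = 1 := by
    intro α _
    exact Matrix.map_one _ (map_zero _) (map_one _)
  have hPQ : (P * Q).det ≠ 0 := by
    have : (P * Q) * (Q' * P') = 1 := by
      rw [Matrix.mul_assoc, ← Matrix.mul_assoc Q, hQQ, Matrix.one_mul, hPP]
    intro h
    have h2 := congrArg Matrix.det this
    rw [Matrix.det_mul, h, zero_mul, Matrix.det_one] at h2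
    exact zero_ne_one h2
  -- `P` and `Q` connect different index types and have no determinants of their own. Conjugating by
  -- `P` leaves the square matrix `P Q` as the only extra factor.
  have dfull : (P.map PowerSeries.C * S.symbol * Q.map PowerSeries.C).det
      = S.symbol.det * ((P * Q).map (PowerSeries.C (R := ℝ))).det := by
    have e1 : P.map PowerSeries.C * S.symbol * Q.map PowerSeries.C
        = (P.map PowerSeries.C * S.symbol * P'.map PowerSeries.C)
          * (P * Q).map PowerSeries.C := by
      rw [← mapC P Q, Matrix.mul_assoc _ (P'.map PowerSeries.C), ← Matrix.mul_assoc (P'.map _),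
        mapC P' P, hPP', mapone, Matrix.one_mul]
    rw [e1, Matrix.det_mul, Matrix.det_conj_of_mul_eq_one _ _]
    · rw [mapC, hPP, mapone]
    · rw [mapC, hPP', mapone]
  have d1 := congrArg Matrix.det tri
  have d2 := congrArg Matrix.det full
  rw [Matrix.det_mul, Matrix.det_fromBlocks_zero₁₂, Matrix.det_fromBlocks_zero₂₁, Matrix.det_one,
    mul_one, Matrix.det_smul, Matrix.det_one, mul_one, Matrix.det_smul] at d1
  rw [dfull, Matrix.det_mul, Matrix.det_fromBlocks_zero₁₂, Matrix.det_one, one_mul,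
    Matrix.det_smul, Matrix.det_one, mul_one] at d2
  have hPQ' := det_map_C_ne_zero hPQ
  constructor
  · intro hS hS₁
    rw [hS₁, mul_zero, zero_mul] at d1
    have d3 := (mul_eq_zero.1 d1).resolve_right (pow_ne_zero _ (hX _))
    rw [d3, mul_zero] at d2
    exact mul_ne_zero hS hPQ' d2
  · intro hS₁ hS
    rw [hS, zero_mul] at d2
    have d3 := (mul_eq_zero.1 d2.symm).resolve_left (pow_ne_zero _ (hX _))
    rw [d3, zero_mul] at d1
    exact mul_ne_zero (mul_ne_zero (pow_ne_zero _ (hX _)) hS₁) hM22 d1.symm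

theorem det_symbol_ne_zero_of_canReduce (hT : 0 < T) {n p : ℕ} {S : IDESystem T n p}
    (h : S.CanReduce) : S.symbol.det ≠ 0 := by
  induction h with
  | done S h => exact S.det_symbol_ne_zero_of_det_ne_zero h
  | split S S₁ h _ ih => exact (det_symbol_ne_zero_iff_of_splitStep hT h).2 ih
  | differentiate S S' h _ ih => exact (det_symbol_ne_zero_iff_of_diffStep hT h).2 ih

end IDESystem

/-! ### Real analyticity on `[0,T]` through factorial bounds -/

section FactorialBound

open scoped Topology NNReal ENNReal

/-- Cauchy estimates uniform in the base point, without complex extension: re-expand the power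
series at each nearby point and bound all the new coefficients by one convergent double series. -/
theorem AnalyticAt.exists_eventually_iteratedDeriv_le {f : ℝ → ℝ} {x : ℝ}
    (hf : AnalyticAt ℝ f x) : ∃ B : ℝ, 1 ≤ B ∧
      ∀ᶠ y in 𝓝 x, ∀ m : ℕ, |iteratedDeriv m f y| ≤ B ^ (m + 1) * m.factorial := by
  obtain ⟨p, r, hr⟩ := hf
  obtain ⟨r', hr'0, hr'⟩ := ENNReal.lt_iff_exists_nnreal_btwn.1 hr.r_pos
  have hr'pos : 0 < r' := by exact_mod_cast hr'0
  -- Half the radius is spent on moving the base point, the other half on the re-expanded series.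
  set δ : ℝ≥0 := r' / 2 with hδ
  have hδ0 : 0 < δ := half_pos hr'pos
  have hδδ : ((δ : ℝ≥0∞) + δ) = r' := by
    rw [← ENNReal.coe_add, hδ, add_halves]
  have hrad : ((δ : ℝ≥0∞) + δ) < p.radius := by
    rw [hδδ]; exact hr'.trans_le hr.r_le
  have hsum := p.changeOriginSeries_summable_aux₁ hrad
  have hsum2 := (NNReal.summable_sigma.1 hsum).2
  set C : ℝ≥0 := ∑' k, ∑' s : Σ l : ℕ, { s : Finset (Fin (k + l)) // s.card = l },
    ‖p (k + s.1)‖₊ * δ ^ s.1 * δ ^ k with hC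
  have hbound : ∀ z : ℝ, ‖z‖₊ ≤ δ → ∀ k, ‖p.changeOrigin z k‖₊ * δ ^ k ≤ C := by
    intro z hz k
    have hz' : (‖z‖₊ : ℝ≥0∞) < p.radius :=
      (ENNReal.coe_le_coe.2 hz).trans_lt (lt_of_le_of_lt le_self_add hrad)
    calc ‖p.changeOrigin z k‖₊ * δ ^ k
        ≤ (∑' s : Σ l : ℕ, { s : Finset (Fin (k + l)) // s.card = l },
            ‖p (k + s.1)‖₊ * ‖z‖₊ ^ s.1) * δ ^ k := by
          gcongr; exact p.nnnorm_changeOrigin_le k hz'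
      _ = ∑' s : Σ l : ℕ, { s : Finset (Fin (k + l)) // s.card = l },
            ‖p (k + s.1)‖₊ * ‖z‖₊ ^ s.1 * δ ^ k := by rw [NNReal.tsum_mul_right]
      _ ≤ ∑' s : Σ l : ℕ, { s : Finset (Fin (k + l)) // s.card = l },
            ‖p (k + s.1)‖₊ * δ ^ s.1 * δ ^ k := by
          have h1 := (NNReal.summable_sigma.1 hsum).1 k
          have hle : ∀ s : Σ l : ℕ, { s : Finset (Fin (k + l)) // s.card = l },
            ‖p (k + s.1)‖₊ * ‖z‖₊ ^ s.1 * δ ^ k ≤ ‖p (k + s.1)‖₊ * δ ^ s.1 * δ ^ k :=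
            fun s => by gcongr
          exact Summable.tsum_le_tsum hle (NNReal.summable_of_le hle h1) h1
      _ ≤ C := hsum2.le_tsum k fun _ _ => zero_le
  refine ⟨max 1 (max C δ⁻¹ : ℝ), le_max_left _ _, ?_⟩
  have hnear : ∀ᶠ y in 𝓝 x, ‖y - x‖ < δ := by
    have : Filter.Tendsto (fun y => ‖y - x‖) (𝓝 x) (𝓝 ‖x - x‖) := by
      apply Continuous.tendsto; fun_prop
    rw [sub_self, norm_zero] at this
    exact this.eventually_lt_const (by exact_mod_cast hδ0)
  filter_upwards [hnear] with y hy m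
  have hyn : ‖y - x‖₊ ≤ δ := by
    rw [← NNReal.coe_le_coe]; exact hy.le
  have hyr : (‖y - x‖₊ : ℝ≥0∞) < r := by
    refine (ENNReal.coe_le_coe.2 hyn).trans_lt (lt_of_le_of_lt ?_ hr')
    rw [← hδδ]; exact le_self_add
  have hy2 := hr.changeOrigin hyr
  rw [add_sub_cancel] at hy2
  have h3 := hy2.factorial_smul 1 m
  rw [← iteratedDeriv_eq_iteratedFDeriv] at h3
  have h4 : |iteratedDeriv m f y| ≤ m.factorial * ‖p.changeOrigin (y - x) m‖ := by
    rw [← h3, nsmul_eq_mul, abs_mul, Nat.abs_cast]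
    gcongr
    refine ((p.changeOrigin (y - x) m).le_opNorm _).trans_eq ?_
    simp
  have h5 : ‖p.changeOrigin (y - x) m‖ ≤ C * ((δ : ℝ)⁻¹) ^ m := by
    have := hbound _ hyn m
    rw [← NNReal.coe_le_coe] at this
    push_cast at this
    have hδ' : (0 : ℝ) < δ := by exact_mod_cast hδ0
    rw [inv_pow, ← div_eq_mul_inv, le_div_iff₀ (by positivity)]
    exact this
  rw [mul_comm]
  refine h4.trans ?_
  gcongr
  refine h5.trans ?_
  rw [pow_succ']
  gcongr
  · exact (le_max_left _ _).trans (le_max_right _ _)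
  · exact (le_max_right _ _).trans (le_max_right _ _)

variable {T : ℝ}

/-- All derivatives of `f` on `[0,T]` are bounded by `B^(m+1) m!` for some `B`. -/
def FactorialBound (T : ℝ) (f : ℝ → ℝ) : Prop :=
  ∃ B : ℝ, 1 ≤ B ∧ ∀ m : ℕ, ∀ t ∈ Icc 0 T, |∂[T,m] f t| ≤ B ^ (m + 1) * m.factorial

/-- The local bounds combine over a finite cover of the compact interval. -/
theorem AnalyticOnNhd.factorialBound (hT : 0 < T) {f : ℝ → ℝ}
    (hf : AnalyticOnNhd ℝ f (Icc 0 T)) : FactorialBound T f := by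
  have key : ∃ B : ℝ, 1 ≤ B ∧ ∀ y ∈ Icc 0 T, ∀ m : ℕ,
      |iteratedDeriv m f y| ≤ B ^ (m + 1) * m.factorial := by
    refine isCompact_Icc.induction_on (p := fun s => ∃ B : ℝ, 1 ≤ B ∧ ∀ y ∈ s, ∀ m : ℕ,
      |iteratedDeriv m f y| ≤ B ^ (m + 1) * m.factorial) ⟨1, le_rfl, by simp⟩ ?_ ?_ ?_
    · rintro s t hst ⟨B, hB, h⟩
      exact ⟨B, hB, fun y hy => h y (hst hy)⟩
    · rintro s t ⟨B, hB, h⟩ ⟨B', hB', h'⟩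
      refine ⟨max B B', hB.trans (le_max_left _ _), ?_⟩
      rintro y (hy | hy) m
      · refine (h y hy m).trans ?_
        gcongr; exact le_max_left _ _
      · refine (h' y hy m).trans ?_
        gcongr; exact le_max_right _ _
    · intro x hx
      obtain ⟨B, hB, h⟩ := (hf x hx).exists_eventually_iteratedDeriv_le
      exact ⟨_, mem_nhdsWithin_of_mem_nhds h, B, hB, fun y hy => hy⟩
  obtain ⟨B, hB, h⟩ := key
  refine ⟨B, hB, fun m t ht => ?_⟩
  rw [iteratedDerivWithin_eq_iteratedDeriv (uniqueDiffOn_Icc hT) (hf t ht).contDiffAt ht]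
  exact h t ht m

theorem FactorialBound.of_le {f : ℝ → ℝ} {D σ : ℝ} (hσ : 0 ≤ σ)
    (h : ∀ m : ℕ, ∀ t ∈ Icc 0 T, |∂[T,m] f t| ≤ D * σ ^ m * m.factorial) :
    FactorialBound T f := by
  refine ⟨max 1 (max D σ), le_max_left _ _, fun m t ht => (h m t ht).trans ?_⟩
  have h1 : (1 : ℝ) ≤ max 1 (max D σ) := le_max_left _ _
  rw [pow_succ']
  gcongr
  · exact (le_max_left _ _).trans (le_max_right _ _)
  · exact (le_max_right _ _).trans (le_max_right _ _)

/-- The Lagrange remainder has the shape of the next term of the series with the derivative at an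
intermediate point, so the same geometric bound forces it to zero. -/
theorem hasSum_taylor (hT : 0 < T) {f : ℝ → ℝ} (hf : ContDiffOn ℝ ∞ f (Icc 0 T)) {B : ℝ}
    (hB1 : 1 ≤ B) (hB : ∀ m : ℕ, ∀ t ∈ Icc 0 T, |∂[T,m] f t| ≤ B ^ (m + 1) * m.factorial)
    {x₀ x : ℝ} (hx₀ : x₀ ∈ Icc 0 T) (hx : x ∈ Icc 0 T) (hd : B * |x - x₀| < 1) :
    HasSum (fun m : ℕ => ∂[T,m] f x₀ / m.factorial * (x - x₀) ^ m) (f x) := by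
  have hterm : ∀ m : ℕ, ∀ t ∈ Icc 0 T, |∂[T,m] f t / m.factorial * (x - x₀) ^ m|
      ≤ B * (B * |x - x₀|) ^ m := by
    intro m t ht
    have hm : (0 : ℝ) < m.factorial := by positivity
    rw [abs_mul, abs_div, Nat.abs_cast, abs_pow, mul_pow, ← mul_assoc, ← pow_succ']
    gcongr
    rw [div_le_iff₀ hm]
    exact hB m t ht
  have hq : 0 ≤ B * |x - x₀| := by positivity
  have hgeo : Summable fun m : ℕ => B * (B * |x - x₀|) ^ m :=
    (summable_geometric_of_lt_one hq hd).mul_left B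
  rw [hasSum_iff_tendsto_nat_of_summable_norm
    (hgeo.of_nonneg_of_le (fun _ => norm_nonneg _) fun m => hterm m x₀ hx₀)]
  rw [← Filter.tendsto_add_atTop_iff_nat 1]
  -- The mean value form of the remainder needs distinct points; at `x = x₀` only the constant term
  -- remains.
  rcases eq_or_ne x₀ x with rfl | hne
  · refine tendsto_const_nhds.congr fun n => ?_
    rw [Finset.sum_range_succ']
    simp
  have hsub : uIcc x₀ x ⊆ Icc 0 T := by
    rw [uIcc_eq_union]
    exact union_subset (Icc_subset_Icc hx₀.1 hx.2) (Icc_subset_Icc hx.1 hx₀.2)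
  have huJ := uniqueDiffOn_uIcc hne
  have hder : ∀ (m : ℕ), ∀ y ∈ uIcc x₀ x, iteratedDerivWithin m f (uIcc x₀ x) y = ∂[T,m] f y := by
    intro m y hy
    unfold iteratedDerivWithin
    rw [iteratedFDerivWithin_subset hsub huJ (uniqueDiffOn_Icc hT)
      (contDiffOn_nat_of_infty hf m) hy]
  rw [tendsto_iff_norm_sub_tendsto_zero]
  refine squeeze_zero (fun _ => norm_nonneg _) (fun n => ?_) (g := fun n : ℕ =>
    B * (B * |x - x₀|) ^ (n + 1)) ?_
  · obtain ⟨y, hy, e⟩ := taylor_mean_remainder_lagrange (n := n) hne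
      ((contDiffOn_nat_of_infty hf n).mono hsub)
      (((hf.mono hsub).differentiableOn_iteratedDerivWithin (m := n)
        (by exact_mod_cast WithTop.coe_lt_top _) huJ).mono uIoo_subset_uIcc_self)
    have hyJ : y ∈ uIcc x₀ x := uIoo_subset_uIcc_self hy
    rw [taylor_within_apply] at e
    have e2 : ∑ k ∈ Finset.range (n + 1), (((k.factorial : ℝ))⁻¹ * (x - x₀) ^ k) •
        iteratedDerivWithin k f (uIcc x₀ x) x₀
        = ∑ i ∈ Finset.range (n + 1), ∂[T,i] f x₀ / i.factorial * (x - x₀) ^ i := by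
      refine Finset.sum_congr rfl fun k _ => ?_
      rw [hder k x₀ left_mem_uIcc, smul_eq_mul]
      ring
    rw [e2, hder _ y hyJ] at e
    rw [norm_sub_rev, e, mul_div_right_comm]
    exact hterm (n + 1) y (hsub hyJ)
  · have := ((tendsto_pow_atTop_nhds_zero_of_lt_one hq hd).const_mul B)
    rw [mul_zero] at this
    exact (Filter.tendsto_add_atTop_iff_nat 1).2 this

/-- A smooth function on `[0,T]` with factorially bounded derivatives extends to a function that is
real analytic on a neighbourhood of `[0,T]`. -/
theorem FactorialBound.exists_analyticOnNhd (hT : 0 < T) {f : ℝ → ℝ}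
    (hf : ContDiffOn ℝ ∞ f (Icc 0 T)) (h : FactorialBound T f) :
    ∃ g : ℝ → ℝ, AnalyticOnNhd ℝ g (Icc 0 T) ∧ EqOn f g (Icc 0 T) := by
  obtain ⟨B, hB1, hB⟩ := h
  have hB0 : 0 < B := by linarith
  let p : ℝ → FormalMultilinearSeries ℝ ℝ ℝ := fun x =>
    FormalMultilinearSeries.ofScalars ℝ (fun m => ∂[T,m] f x / m.factorial)
  have hpr : ∀ x ∈ Icc 0 T, 0 < (p x).radius := by
    intro x hx
    have := (p x).le_radius_of_bound B (r := ⟨B⁻¹, by positivity⟩) fun n => by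
      simp only [p]
      rw [FormalMultilinearSeries.ofScalars_norm, Real.norm_eq_abs, abs_div, Nat.abs_cast]
      have hn : (0 : ℝ) < n.factorial := by positivity
      have := hB n x hx
      calc |∂[T,n] f x| / n.factorial * (B⁻¹) ^ n
          ≤ B ^ (n + 1) * (B⁻¹) ^ n := by gcongr; rwa [div_le_iff₀ hn]
        _ = B := by rw [pow_succ', mul_assoc, ← mul_pow, mul_inv_cancel₀ hB0.ne', one_pow, mul_one]
    refine lt_of_lt_of_le ?_ this
    have hr : (0 : NNReal) < ⟨B⁻¹, by positivity⟩ := inv_pos.2 hB0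
    exact ENNReal.coe_pos.2 hr
  have hps : ∀ x y : ℝ, (p x).sum y = ∑' m : ℕ, ∂[T,m] f x / m.factorial * y ^ m := by
    intro x y
    exact FormalMultilinearSeries.ofScalars_sum_eq _ _
  -- The extension uses the Taylor series at the nearest point of `[0,T]`: inside it returns `f`,
  -- beyond an end point it sums the series at that end point.
  let π : ℝ → ℝ := fun t => max 0 (min t T)
  have hπ : ∀ t ∈ Icc 0 T, π t = t := fun t ht => by
    simp only [π]; rw [min_eq_left ht.2, max_eq_right ht.1]
  let g : ℝ → ℝ := fun t => (p (π t)).sum (t - π t)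
  have hgf : ∀ t ∈ Icc 0 T, g t = f t := by
    intro t ht
    simp only [g]
    rw [hπ t ht, sub_self, hps]
    rw [tsum_eq_single 0 fun m hm => by rw [zero_pow hm, mul_zero]]
    simp
  refine ⟨g, fun x hx => ?_, fun t ht => (hgf t ht).symm⟩
  have han : AnalyticAt ℝ (fun t => (p x).sum (t - x)) x := by
    have h1 := ((p x).hasFPowerSeriesOnBall (hpr x hx)).comp_sub x
    rw [zero_add] at h1
    exact h1.analyticAt
  refine han.congr ?_
  have hnear : ∀ᶠ t in 𝓝 x, B * |t - x| < 1 := by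
    have : Filter.Tendsto (fun t => B * |t - x|) (𝓝 x) (𝓝 (B * |x - x|)) := by
      apply Continuous.tendsto; fun_prop
    rw [sub_self, abs_zero, mul_zero] at this
    exact this.eventually_lt_const one_pos
  -- Close to `x`, the interval can only be left through `x` itself. Hence the extension agrees near
  -- `x` with the single Taylor series at `x`.
  have hlow : ∀ᶠ t in 𝓝 x, t < 0 → x = 0 := by
    rcases hx.1.eq_or_lt with h | h
    · exact Filter.Eventually.of_forall fun _ _ => h.symm
    · filter_upwards [lt_mem_nhds h] with t ht ht'
      exact absurd ht' (not_lt.2 ht.le)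
  have hhigh : ∀ᶠ t in 𝓝 x, T < t → x = T := by
    rcases hx.2.eq_or_lt with h | h
    · exact Filter.Eventually.of_forall fun _ _ => h
    · filter_upwards [gt_mem_nhds h] with t ht ht'
      exact absurd ht' (not_lt.2 ht.le)
  filter_upwards [hnear, hlow, hhigh] with t h1 h2 h3
  rcases lt_or_ge t 0 with h4 | h4
  · have : π t = x := by
      simp only [π]
      rw [h2 h4, min_eq_left (h4.le.trans hT.le), max_eq_left h4.le]
    simp only [g, this]
  rcases lt_or_ge T t with h5 | h5
  · have : π t = x := by
      simp only [π]
      rw [h3 h5, min_eq_right h5.le, max_eq_right hT.le]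
    simp only [g, this]
  · rw [hgf t ⟨h4, h5⟩, hps]
    exact (hasSum_taylor hT hf hB1 hB hx ⟨h4, h5⟩ h1).tsum_eq

theorem abs_vconv_le {f g : ℝ → ℝ} {C D : ℝ} (hC : 0 ≤ C)
    (hf : ∀ t ∈ Icc 0 T, |f t| ≤ C) (hg : ∀ t ∈ Icc 0 T, |g t| ≤ D) {t : ℝ} (ht : t ∈ Icc 0 T) :
    |vconv f g t| ≤ T * (C * D) := by
  have hD : 0 ≤ D := (abs_nonneg _).trans (hg t ht)
  have h := intervalIntegral.norm_integral_le_of_norm_le_const (a := 0) (b := t)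
    (f := fun s => f (t - s) * g s) (C := C * D) fun s hs => by
      rw [uIoc_of_le ht.1] at hs
      rw [Real.norm_eq_abs, abs_mul]
      gcongr
      · exact hf _ ⟨by linarith [hs.2], by linarith [hs.1, ht.2]⟩
      · exact hg _ ⟨hs.1.le, hs.2.trans ht.2⟩
  rw [sub_zero, abs_of_nonneg ht.1, Real.norm_eq_abs] at h
  refine h.trans ?_
  rw [mul_comm]
  gcongr
  exact ht.2

theorem factorial_mul_factorial_le {i m : ℕ} (hi : i < m) :
    (i.factorial : ℝ) * ((m - 1 - i).factorial : ℝ) ≤ (m - 1).factorial := by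
  have h := Nat.le_of_dvd (Nat.factorial_pos _)
    (Nat.factorial_mul_factorial_dvd_factorial_add i (m - 1 - i))
  rw [show i + (m - 1 - i) = m - 1 by omega] at h
  exact_mod_cast h

/-- The `m` boundary terms are each at most `B^(m+1) (m-1)!`, as `i! (m-1-i)! ≤ (m-1)!`, and
together they give `B^(m+1) m!`. -/
theorem FactorialBound.vconv (hT : 0 < T) {f g : ℝ → ℝ} (hf : ContDiffOn ℝ ∞ f (Icc 0 T))
    (hg : ContDiffOn ℝ ∞ g (Icc 0 T)) (hfb : FactorialBound T f) (hgb : FactorialBound T g) :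
    FactorialBound T (vconv f g) := by
  obtain ⟨B₁, hB₁, h₁⟩ := hfb
  obtain ⟨B₂, hB₂, h₂⟩ := hgb
  set B := max B₁ B₂ with hBdef
  have hB : 1 ≤ B := hB₁.trans (le_max_left _ _)
  have hfB : ∀ m : ℕ, ∀ t ∈ Icc 0 T, |∂[T,m] f t| ≤ B ^ (m + 1) * m.factorial :=
    fun m t ht => (h₁ m t ht).trans (by gcongr; exact le_max_left _ _)
  have hgB : ∀ m : ℕ, ∀ t ∈ Icc 0 T, |∂[T,m] g t| ≤ B ^ (m + 1) * m.factorial :=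
    fun m t ht => (h₂ m t ht).trans (by gcongr; exact le_max_right _ _)
  refine FactorialBound.of_le (D := B + T * (B * B)) (σ := B) (by linarith) fun m t ht => ?_
  rw [iteratedDerivWithin_vconv hT hf (contDiffOn_nat_of_infty hg m) ht]
  refine (abs_add_le _ _).trans ?_
  rw [add_mul, add_mul]
  refine add_le_add ?_ ?_
  · refine (Finset.abs_sum_le_sum_abs _ _).trans ?_
    have : ∀ i ∈ Finset.range m, |∂[T,i] f 0 * ∂[T,(m - 1 - i)] g t|
        ≤ B ^ (m + 1) * (m - 1).factorial := by
      intro i hi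
      rw [Finset.mem_range] at hi
      rw [abs_mul]
      calc |∂[T,i] f 0| * |∂[T,(m - 1 - i)] g t|
          ≤ (B ^ (i + 1) * i.factorial) * (B ^ (m - 1 - i + 1) * (m - 1 - i).factorial) := by
            gcongr
            · exact hfB i 0 (left_mem_Icc.2 hT.le)
            · exact hgB _ t ht
        _ = B ^ (m + 1) * (i.factorial * (m - 1 - i).factorial) := by
            rw [show m + 1 = (i + 1) + (m - 1 - i + 1) by omega, pow_add]; ring
        _ ≤ _ := by gcongr; exact factorial_mul_factorial_le hi
    refine (Finset.sum_le_sum this).trans ?_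
    rw [Finset.sum_const, Finset.card_range, nsmul_eq_mul]
    rcases Nat.eq_zero_or_pos m with rfl | hm
    · simp; linarith
    · rw [← Nat.mul_factorial_pred hm.ne']
      push_cast
      rw [pow_succ']
      exact le_of_eq (by ring)
  · refine (abs_vconv_le (C := B ^ (m + 1) * m.factorial) (D := B) (by positivity)
      (fun s hs => hfB m s hs) (fun s hs => by simpa using hgB 0 s hs) ht).trans_eq ?_
    rw [pow_succ]; ring

theorem exists_analytic_vconv (hT : 0 < T) {f g : ℝ → ℝ} (hf : AnalyticOnNhd ℝ f (Icc 0 T))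
    (hg : AnalyticOnNhd ℝ g (Icc 0 T)) :
    ∃ h : ℝ → ℝ, AnalyticOnNhd ℝ h (Icc 0 T) ∧ EqOn (vconv f g) h (Icc 0 T) := by
  have hu := uniqueDiffOn_Icc hT
  exact FactorialBound.exists_analyticOnNhd hT
    (contDiffOn_infty_vconv hT (hf.contDiffOn_infty hu) (hg.contDiffOn_infty hu))
    (FactorialBound.vconv hT (hf.contDiffOn_infty hu) (hg.contDiffOn_infty hu)
      (hf.factorialBound hT) (hg.factorialBound hT))

/-- The equation itself makes a continuous solution smooth, one order at a time, and then expresses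
its `m`-th derivative through lower ones, so the factorial bounds follow by strong induction. -/
theorem exists_analytic_volterra (hT : 0 < T) {q g y : ℝ → ℝ} (hq : AnalyticOnNhd ℝ q (Icc 0 T))
    (hg : AnalyticOnNhd ℝ g (Icc 0 T)) (hy : ContinuousOn y (Icc 0 T))
    (e : EqOn y (fun t => g t + vconv q y t) (Icc 0 T)) :
    ∃ h : ℝ → ℝ, AnalyticOnNhd ℝ h (Icc 0 T) ∧ EqOn y h (Icc 0 T) := by
  have hu := uniqueDiffOn_Icc hT
  have hqs := hq.contDiffOn_infty hu
  have hgs := hg.contDiffOn_infty hu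
  have hys : ∀ n : ℕ, ContDiffOn ℝ n y (Icc 0 T) := by
    intro n
    induction n with
    | zero => simpa using hy
    | succ n ih =>
      exact ((contDiffOn_nat_of_infty hgs (n + 1)).add (contDiffOn_vconv hT hqs ih)).congr e
  have hy' : ContDiffOn ℝ ∞ y (Icc 0 T) := contDiffOn_infty.2 hys
  refine FactorialBound.exists_analyticOnNhd hT hy' ?_
  obtain ⟨B₁, hB₁, h₁⟩ := hq.factorialBound hT
  obtain ⟨B₂, hB₂, h₂⟩ := hg.factorialBound hT
  set B := max B₁ B₂ with hBdef
  have hB : 1 ≤ B := hB₁.trans (le_max_left _ _)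
  have hqB : ∀ m : ℕ, ∀ t ∈ Icc 0 T, |∂[T,m] q t| ≤ B ^ (m + 1) * m.factorial :=
    fun m t ht => (h₁ m t ht).trans (by gcongr; exact le_max_left _ _)
  have hgB : ∀ m : ℕ, ∀ t ∈ Icc 0 T, |∂[T,m] g t| ≤ B ^ (m + 1) * m.factorial :=
    fun m t ht => (h₂ m t ht).trans (by gcongr; exact le_max_right _ _)
  obtain ⟨Y, hY⟩ := isCompact_Icc.exists_bound_of_continuousOn hy
  have hY0 : 0 ≤ Y := (norm_nonneg _).trans (hY 0 (left_mem_Icc.2 hT.le))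
  -- Half of `D` pays for `g` and the remaining convolution, the other half for the boundary terms.
  set D := 2 * (B * (1 + T * Y)) with hD
  have hD0 : 0 ≤ D := by positivity
  -- With ratio `3B` the sum `∑ B^i (3B)^(m-1-i)` is at most `(3B)^m / (2B)`, which is what gains
  -- the factor `1/2` needed to close the induction.
  refine FactorialBound.of_le (D := D) (σ := 3 * B) (by linarith) fun m => ?_
  induction m using Nat.strong_induction_on with
  | _ m ih =>
  intro t ht
  rw [iteratedDerivWithin_congr e ht, iteratedDerivWithin_fun_add ht hu
    (contDiffOn_nat_of_infty hgs m t ht)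
    (contDiffOn_nat_of_infty (contDiffOn_infty_vconv hT hqs hy') m t ht),
    iteratedDerivWithin_vconv hT hqs (hys m) ht]
  have hsum : |∑ i ∈ Finset.range m, ∂[T,i] q 0 * ∂[T,(m - 1 - i)] y t|
      ≤ D / 2 * (3 * B) ^ m * m.factorial := by
    refine (Finset.abs_sum_le_sum_abs _ _).trans ?_
    have : ∀ i ∈ Finset.range m, |∂[T,i] q 0 * ∂[T,(m - 1 - i)] y t|
        ≤ B ^ i * (3 * B) ^ (m - 1 - i) * (B * D * m.factorial) := by
      intro i hi
      rw [Finset.mem_range] at hi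
      rw [abs_mul]
      calc |∂[T,i] q 0| * |∂[T,(m - 1 - i)] y t|
          ≤ (B ^ (i + 1) * i.factorial)
              * (D * (3 * B) ^ (m - 1 - i) * (m - 1 - i).factorial) := by
            gcongr
            · exact hqB i 0 (left_mem_Icc.2 hT.le)
            · exact ih _ (by omega) t ht
        _ = B ^ i * (3 * B) ^ (m - 1 - i) *
              (B * D * (i.factorial * (m - 1 - i).factorial)) := by
            rw [pow_succ]; ring
        _ ≤ _ := by
            gcongr
            refine (factorial_mul_factorial_le hi).trans ?_
            exact_mod_cast Nat.factorial_le (by omega)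
    refine (Finset.sum_le_sum this).trans ?_
    rw [← Finset.sum_mul]
    have hgeo := geom_sum₂_mul B (3 * B) m
    have h2 : (∑ i ∈ Finset.range m, B ^ i * (3 * B) ^ (m - 1 - i)) * (2 * B) ≤ (3 * B) ^ m := by
      have : 0 ≤ B ^ m := by positivity
      nlinarith
    calc (∑ i ∈ Finset.range m, B ^ i * (3 * B) ^ (m - 1 - i)) * (B * D * m.factorial)
        = ((∑ i ∈ Finset.range m, B ^ i * (3 * B) ^ (m - 1 - i)) * (2 * B))
            * (D / 2 * m.factorial) := by ring
      _ ≤ (3 * B) ^ m * (D / 2 * m.factorial) := by gcongr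
      _ = _ := by ring
  have hrest : |∂[T,m] g t| + |vconv (∂[T,m] q) y t| ≤ D / 2 * (3 * B) ^ m * m.factorial := by
    have a1 := hgB m t ht
    have a2 := abs_vconv_le (C := B ^ (m + 1) * m.factorial) (D := Y) (by positivity)
      (fun s hs => hqB m s hs) (fun s hs => hY s hs) ht
    refine (add_le_add a1 a2).trans ?_
    have : B ^ (m + 1) * m.factorial + T * (B ^ (m + 1) * m.factorial * Y)
        = D / 2 * B ^ m * m.factorial := by rw [hD, pow_succ]; ring
    rw [this]
    gcongr
    linarith
  calc _ ≤ |∂[T,m] g t| + (|∑ i ∈ Finset.range m, ∂[T,i] q 0 * ∂[T,(m - 1 - i)] y t|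
        + |vconv (∂[T,m] q) y t|) := (abs_add_le _ _).trans (by gcongr; exact abs_add_le _ _)
    _ ≤ D / 2 * (3 * B) ^ m * m.factorial + D / 2 * (3 * B) ^ m * m.factorial := by linarith
    _ = _ := by ring

end FactorialBound

/-! ### Volterra equations of the second kind -/

section Volterra

variable {T : ℝ}

theorem integral_exp_neg_mul_sub_le {l t : ℝ} (hl : 0 < l) (c : ℝ) (hc : 0 ≤ c) :
    ∫ s in (0 : ℝ)..t, c * Real.exp (-l * (t - s)) ≤ c / l := by
  have h : ∀ s ∈ uIcc 0 t, HasDerivAt (fun s => c / l * Real.exp (-l * (t - s)))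
      (c * Real.exp (-l * (t - s))) s := by
    intro s _
    have h1 : HasDerivAt (fun s => -l * (t - s)) l s := by
      have := ((hasDerivAt_id s).const_sub t).const_mul (-l)
      simpa using this
    have h2 := (h1.exp).const_mul (c / l)
    have h3 : c / l * (Real.exp (-l * (t - s)) * l) = c * Real.exp (-l * (t - s)) := by
      field_simp
    rwa [h3] at h2
  rw [intervalIntegral.integral_eq_sub_of_hasDerivAt h (by
    apply Continuous.intervalIntegrable; fun_prop)]
  simp only [sub_self, mul_zero, Real.exp_zero, mul_one]
  have : 0 ≤ c / l * Real.exp (-l * (t - 0)) := by positivity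
  linarith

/-- A Volterra equation of the second kind with continuous data has a continuous solution. -/
theorem exists_volterra_of_continuous (hT : 0 < T) {q g : ℝ → ℝ} (hq : Continuous q)
    (hg : Continuous g) :
    ∃ y : ℝ → ℝ, ContinuousOn y (Icc 0 T) ∧ EqOn y (fun t => g t + vconv q y t) (Icc 0 T) := by
  obtain ⟨M, hM⟩ := isCompact_Icc.exists_bound_of_continuousOn (hq.continuousOn (s := Icc 0 T))
  -- After weighting by `exp(-l t)` the integral operator has Lipschitz constant at most `(|M| + 1)
  -- / l = 1/2`, so one contraction works on the whole interval.
  set l : ℝ := 2 * (|M| + 1) with hl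
  have hl0 : 0 < l := by positivity
  let q' : ℝ → ℝ := fun u => Real.exp (-l * u) * q u
  let g' : ℝ → ℝ := fun u => Real.exp (-l * u) * g u
  have hq' : Continuous q' := by fun_prop
  have hg' : Continuous g' := by fun_prop
  let ext : C(Icc 0 T, ℝ) → ℝ → ℝ := fun u => IccExtend hT.le u
  have hext : ∀ u, Continuous (ext u) := fun u => u.continuous.Icc_extend'
  let Φ : C(Icc 0 T, ℝ) → C(Icc 0 T, ℝ) := fun u =>
    ⟨fun t => g' t + vconv q' (ext u) t,
      (hg'.add (continuous_vconv hq' (hext u))).comp continuous_subtype_val⟩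
  have hΦ : ContractingWith (1 / 2) Φ := by
    refine ⟨by norm_num, LipschitzWith.of_dist_le_mul fun u v => ?_⟩
    rw [ContinuousMap.dist_le (by positivity)]
    rintro ⟨t, ht⟩
    simp only [Φ, ContinuousMap.coe_mk, dist_add_left, Real.dist_eq]
    unfold vconv
    rw [← intervalIntegral.integral_sub
      ((by have := hext u; fun_prop : Continuous fun s => q' (t - s) * ext u s).intervalIntegrable
        _ _)
      ((by have := hext v; fun_prop : Continuous fun s => q' (t - s) * ext v s).intervalIntegrable
        _ _)]
    have hb := intervalIntegral.norm_integral_le_of_norm_le (μ := MeasureTheory.volume)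
      (f := fun s => q' (t - s) * ext u s - q' (t - s) * ext v s)
      (g := fun s => ((|M| + 1) * dist u v) * Real.exp (-l * (t - s))) ht.1
      (Filter.Eventually.of_forall fun s hs => ?_)
      (by apply Continuous.intervalIntegrable; fun_prop)
    · rw [Real.norm_eq_abs] at hb
      refine hb.trans ((integral_exp_neg_mul_sub_le hl0 _ (by positivity)).trans_eq ?_)
      rw [hl]
      push_cast
      field_simp
    · have h1 : |q (t - s)| ≤ |M| + 1 := by
        have := hM (t - s) ⟨by linarith [hs.2], by linarith [hs.1, ht.2]⟩
        rw [Real.norm_eq_abs] at this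
        linarith [le_abs_self M]
      have h2 : |ext u s - ext v s| ≤ dist u v := by
        simp only [ext, IccExtend, Function.comp]
        exact ContinuousMap.dist_apply_le_dist (f := u) (g := v) (projIcc 0 T hT.le s)
      rw [← mul_sub, Real.norm_eq_abs, abs_mul, abs_mul, Real.abs_exp]
      calc _ ≤ Real.exp (-l * (t - s)) * (|M| + 1) * dist u v := by gcongr
        _ = _ := by ring
  set u := ContractingWith.fixedPoint Φ hΦ with hu
  have hfix : Φ u = u := hΦ.fixedPoint_isFixedPt
  have heq : ∀ t ∈ Icc 0 T, ext u t = g' t + vconv q' (ext u) t := by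
    intro t ht
    have h := congrArg (fun v : C(Icc 0 T, ℝ) => v ⟨t, ht⟩) hfix
    simp only [Φ, ContinuousMap.coe_mk] at h
    rw [h]
    exact IccExtend_of_mem _ _ ht
  refine ⟨fun t => Real.exp (l * t) * ext u t, by
    have := hext u
    exact (by fun_prop : Continuous fun t => Real.exp (l * t) * ext u t).continuousOn,
    fun t ht => ?_⟩
  have e1 : vconv q (fun t => Real.exp (l * t) * ext u t) t
      = Real.exp (l * t) * vconv q' (ext u) t := by
    unfold vconv
    rw [← intervalIntegral.integral_const_mul]
    refine intervalIntegral.integral_congr fun s _ => ?_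
    simp only [q']
    have : Real.exp (l * s) = Real.exp (l * t) * Real.exp (-l * (t - s)) := by
      rw [← Real.exp_add]; ring_nf
    rw [this]; ring
  have e2 : Real.exp (l * t) * g' t = g t := by
    simp only [g']
    rw [← mul_assoc, ← Real.exp_add]
    simp
  simp only []
  rw [e1, heq t ht, mul_add, e2]

/-- A Volterra equation of the second kind with real analytic data has a real analytic solution. -/
theorem exists_analytic_volterra_solution (hT : 0 < T) {q g : ℝ → ℝ}
    (hq : AnalyticOnNhd ℝ q (Icc 0 T)) (hg : AnalyticOnNhd ℝ g (Icc 0 T)) :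
    ∃ y : ℝ → ℝ, AnalyticOnNhd ℝ y (Icc 0 T) ∧ EqOn y (fun t => g t + vconv q y t) (Icc 0 T) := by
  obtain ⟨q', hq', eq⟩ := exists_continuous_eqOn hT hq.continuousOn
  obtain ⟨g', hg', eg⟩ := exists_continuous_eqOn hT hg.continuousOn
  obtain ⟨y, hy, ey⟩ := exists_volterra_of_continuous hT hq' hg'
  have ey' : EqOn y (fun t => g t + vconv q y t) (Icc 0 T) := fun t ht => by
    rw [ey ht]
    simp only
    rw [eg ht, vconv_congr eq (fun _ _ => rfl) ht]
  obtain ⟨h, hh, eh⟩ := exists_analytic_volterra hT hq hg hy ey'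
  refine ⟨h, hh, fun t ht => ?_⟩
  rw [← eh ht, ey' ht]
  simp only
  rw [vconv_congr (fun _ _ => rfl) eh ht]

end Volterra

/-! ### The scalar resolvent kernel -/

section ScalarResolvent

variable {T : ℝ}

/-- Derivatives of a convolution with a kernel that vanishes at `0` to high order. -/
theorem iteratedDerivWithin_vconv_of_vanishing (hT : 0 < T) {κ : ℕ} {f g : ℝ → ℝ}
    (hf : ContDiffOn ℝ ∞ f (Icc 0 T)) (hg : ContinuousOn g (Icc 0 T))
    (h0 : ∀ m, m + 1 < κ → ∂[T,m] f 0 = 0) :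
    ContDiffOn ℝ κ (vconv f g) (Icc 0 T) ∧
    (∀ i < κ, EqOn (∂[T,i] (vconv f g)) (vconv (∂[T,i] f) g) (Icc 0 T)) ∧
    (∀ i, i + 1 = κ → EqOn (∂[T,κ] (vconv f g))
      (fun t => ∂[T,i] f 0 * g t + vconv (∂[T,κ] f) g t) (Icc 0 T)) := by
  have hu := uniqueDiffOn_Icc hT
  induction κ generalizing f with
  | zero =>
    refine ⟨?_, fun i hi => absurd hi (by omega), fun i hi => absurd hi (by omega)⟩
    simpa using continuousOn_vconv hT hf.continuousOn hg
  | succ κ ih =>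
    have hf1 : ContDiffOn ℝ 1 f (Icc 0 T) := mod_cast contDiffOn_nat_of_infty hf 1
    have hf' : ContDiffOn ℝ ∞ (derivWithin f (Icc 0 T)) (Icc 0 T) := hf.derivWithin hu (by simp)
    have hd := derivWithin_vconv hT hf1 hg
    rcases Nat.eq_zero_or_pos κ with rfl | hκ
    · refine ⟨?_, fun i hi => ?_, fun i hi => ?_⟩
      · exact contDiffOn_vconv hT hf (by simpa using hg)
      · obtain rfl : i = 0 := by omega
        simp only [iteratedDerivWithin_zero, eqOn_refl]
      · obtain rfl : i = 0 := by omega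
        intro t ht
        simp only [zero_add, iteratedDerivWithin_one, iteratedDerivWithin_zero]
        rw [hd ht]
    · have h00 := h0 0 (by omega)
      rw [iteratedDerivWithin_zero] at h00
      have hd' : EqOn (derivWithin (vconv f g) (Icc 0 T)) (vconv (derivWithin f (Icc 0 T)) g)
          (Icc 0 T) := fun t ht => by rw [hd ht]; simp [h00]
      obtain ⟨i1, i2, i3⟩ := ih hf' fun m hm => by
        rw [← iteratedDerivWithin_succ']; exact h0 (m + 1) (by omega)
      refine ⟨?_, fun i hi => ?_, fun i hi => ?_⟩
      · rw [show ((κ + 1 : ℕ) : WithTop ℕ∞) = (κ : WithTop ℕ∞) + 1 by push_cast; rfl,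
          contDiffOn_succ_iff_derivWithin hu]
        exact ⟨fun t ht => (hasDerivWithinAt_vconv hT hf1 hg ht).differentiableWithinAt, by simp,
          i1.congr hd'⟩
      · rcases i with _ | i
        · simp only [iteratedDerivWithin_zero]
          exact eqOn_refl _ _
        · intro t ht
          simp only [iteratedDerivWithin_succ']
          rw [iteratedDerivWithin_congr hd' ht, i2 i (by omega) ht]
      · obtain rfl : i = κ := by omega
        obtain ⟨i, rfl⟩ : ∃ j, i = j + 1 := ⟨i - 1, by omega⟩
        intro t ht
        rw [iteratedDerivWithin_succ', iteratedDerivWithin_congr hd' ht, i3 i rfl ht]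
        simp only [← iteratedDerivWithin_succ']

/-- Only the last differentiation leaves a boundary term, so the operator acts on the kernel `f`
apart from one multiple of `g`. No smoothness of `g` is spent. -/
theorem scalarOp_vconv_of_vanishing (hT : 0 < T) {κ : ℕ} {b : ℕ → ℝ} {N f g : ℝ → ℝ}
    (hN : ContinuousOn N (Icc 0 T)) (hf : ContDiffOn ℝ ∞ f (Icc 0 T))
    (hg : ContinuousOn g (Icc 0 T)) (h0 : ∀ m, m + 1 < κ → ∂[T,m] f 0 = 0) {t : ℝ}
    (ht : t ∈ Icc 0 T) :
    scalarOp T κ b N (vconv f g) t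
      = (if κ = 0 then 0 else b κ * ∂[T,(κ - 1)] f 0) * g t + vconv (scalarOp T κ b N f) g t := by
  obtain ⟨-, h1, h2⟩ := iteratedDerivWithin_vconv_of_vanishing hT hf hg h0
  have hfd : ∀ i, ContinuousOn (∂[T,i] f) (Icc 0 T) := fun i =>
    (contDiffOn_infty_iteratedDerivWithin hT hf i).continuousOn
  have hbf : ∀ i, ContinuousOn (fun s => b i * ∂[T,i] f s) (Icc 0 T) := fun i =>
    continuousOn_const.mul (hfd i)
  have e : vconv (scalarOp T κ b N f) g t
      = ∑ i ∈ Finset.range (κ + 1), b i * vconv (∂[T,i] f) g t + vconv (vconv N f) g t := by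
    have : scalarOp T κ b N f = fun s => (∑ i ∈ Finset.range (κ + 1), b i * ∂[T,i] f s)
        + vconv N f s := rfl
    rw [this, vconv_add_left hg (continuousOn_finsetSum _ fun i _ => hbf i)
      (continuousOn_vconv hT hN hf.continuousOn) ht, vconv_sum_left _ hg (fun i _ => hbf i) ht]
    simp only [vconv_const_mul_left]
  rw [e, vconv_assoc hT hN hf.continuousOn hg ht]
  unfold scalarOp
  rw [← add_assoc]
  congr 1
  rw [Finset.sum_range_succ, Finset.sum_range_succ,
    Finset.sum_congr rfl fun i hi => by rw [h1 i (Finset.mem_range.1 hi) ht]]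
  rcases κ with _ | κ
  · simp
  · rw [h2 κ rfl ht, if_neg (by omega), Nat.add_sub_cancel]
    ring

theorem AnalyticOnNhd.iteratedDeriv_on {s : Set ℝ} {f : ℝ → ℝ} (hf : AnalyticOnNhd ℝ f s) (n : ℕ) :
    AnalyticOnNhd ℝ (iteratedDeriv n f) s := by
  rw [iteratedDeriv_eq_iterate]
  exact hf.iterated_deriv n

theorem exists_analytic_scalarOp (hT : 0 < T) (k : ℕ) (a : ℕ → ℝ) {N f : ℝ → ℝ}
    (hN : AnalyticOnNhd ℝ N (Icc 0 T)) (hf : AnalyticOnNhd ℝ f (Icc 0 T)) :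
    ∃ h : ℝ → ℝ, AnalyticOnNhd ℝ h (Icc 0 T) ∧ EqOn (scalarOp T k a N f) h (Icc 0 T) := by
  obtain ⟨h, hh, e⟩ := exists_analytic_vconv hT hN hf
  refine ⟨fun t => (∑ i ∈ Finset.range (k + 1), a i * iteratedDeriv i f t) + h t,
    (Finset.analyticOnNhd_fun_sum _ fun i _ => analyticOnNhd_const.mul
      (hf.iteratedDeriv_on i)).add hh, fun t ht => ?_⟩
  unfold scalarOp
  rw [e ht]
  congr 1
  exact Finset.sum_congr rfl fun i _ => by
    rw [IDESystem.iteratedDerivWithin_eq_of_analytic hT hf i ht]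

/-- `R` is the resolvent kernel of the scalar operator `∑_{i ≤ κ} b_i z^{(i)} + N * z`,
described by an initial value problem. -/
structure IsScalarResolvent (T : ℝ) (κ : ℕ) (b : ℕ → ℝ) (N R : ℝ → ℝ) : Prop where
  analytic : AnalyticOnNhd ℝ R (Icc 0 T)
  vanishing : ∀ m, m + 1 < κ → ∂[T,m] R 0 = 0
  leading : κ ≠ 0 → b κ * ∂[T,(κ - 1)] R 0 = 1
  equation : ∀ t ∈ Icc 0 T, scalarOp T κ b N R t = - ((if κ = 0 then (b 0)⁻¹ else 0) * N t)

/-- For `κ ≥ 1` put `R = e / b_κ + e * y` with `e = t^(κ-1) / (κ-1)!`, which builds in the initial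
values. If `h` is the operator applied to `e`, the homogeneous equation becomes `b_κ y + h * y = -h
/ b_κ`, of the second kind. For `κ = 0` the equation for `R` already has this form. -/
theorem exists_isScalarResolvent (hT : 0 < T) {κ : ℕ} {b : ℕ → ℝ} (hb : b κ ≠ 0) {N : ℝ → ℝ}
    (hN : AnalyticOnNhd ℝ N (Icc 0 T)) : ∃ R, IsScalarResolvent T κ b N R := by
  have hu := uniqueDiffOn_Icc hT
  have h0 : (0 : ℝ) ∈ Icc 0 T := left_mem_Icc.2 hT.le
  rcases κ with _ | κ
  · obtain ⟨R, hR, e⟩ := exists_analytic_volterra_solution hT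
      (q := fun u => -(b 0)⁻¹ * N u) (g := fun u => -((b 0)⁻¹ * (b 0)⁻¹) * N u)
      (analyticOnNhd_const.mul hN) (analyticOnNhd_const.mul hN)
    refine ⟨R, hR, fun m hm => absurd hm (by omega), fun h => absurd rfl h, fun t ht => ?_⟩
    have := e ht
    simp only [vconv_const_mul_left] at this
    rw [scalarOp_zero, if_pos rfl, this]
    field_simp
    ring
  · let e : ℝ → ℝ := fun t => t ^ κ / (κ.factorial : ℝ)
    have hes : ContDiff ℝ ω e := by fun_prop
    have hea : AnalyticOnNhd ℝ e (Icc 0 T) := fun x _ => hes.contDiffAt.analyticAt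
    have hei : ContDiffOn ℝ ∞ e (Icc 0 T) := hea.contDiffOn_infty hu
    have he0 : ∀ m, ∂[T,m] e 0 = if m = κ then 1 else 0 := fun m =>
      iteratedDerivWithin_monomial_zero hT m κ
    obtain ⟨h, hh, eh⟩ := exists_analytic_scalarOp hT (κ + 1) b hN hea
    obtain ⟨y, hy, ey⟩ := exists_analytic_volterra_solution hT
      (q := fun u => -(b (κ + 1))⁻¹ * h u)
      (g := fun u => -((b (κ + 1))⁻¹ * (b (κ + 1))⁻¹) * h u)
      (analyticOnNhd_const.mul hh) (analyticOnNhd_const.mul hh)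
    obtain ⟨v, hv, ev⟩ := exists_analytic_vconv hT hea hy
    have hva : ∀ m, m + 1 < κ + 1 → ∂[T,m] e 0 = 0 := fun m hm => by
      rw [he0, if_neg (by omega)]
    obtain ⟨c1, c2, -⟩ := iteratedDerivWithin_vconv_of_vanishing hT hei hy.continuousOn hva
    have eR : EqOn (fun t => (b (κ + 1))⁻¹ * e t + v t)
        (fun t => (b (κ + 1))⁻¹ * e t + vconv e y t) (Icc 0 T) := fun t ht => by
      simp only [ev ht]
    have hinit : ∀ m ≤ κ, ∂[T,m] (fun t => (b (κ + 1))⁻¹ * e t + v t) 0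
        = (b (κ + 1))⁻¹ * (if m = κ then 1 else 0) := by
      intro m hm
      rw [iteratedDerivWithin_congr eR h0, iteratedDerivWithin_fun_add h0 hu
        ((contDiffOn_const.mul (contDiffOn_nat_of_infty hei m)) 0 h0)
        (c1.of_le (by norm_cast; omega) 0 h0), iteratedDerivWithin_const_mul_field, he0,
        c2 m (by omega) h0, vconv_zero_right_apply, add_zero]
    refine ⟨fun t => (b (κ + 1))⁻¹ * e t + v t, (analyticOnNhd_const.mul hea).add hv,
      fun m hm => ?_, fun _ => ?_, fun t ht => ?_⟩
    · rw [hinit m (by omega), if_neg (by omega), mul_zero]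
    · rw [Nat.add_sub_cancel, hinit κ le_rfl, if_pos rfl, mul_one, mul_inv_cancel₀ hb]
    · rw [scalarOp_congr (fun _ _ => rfl) eR ht, scalarOp_add hT hN.continuousOn
        (contDiffOn_const.mul (contDiffOn_nat_of_infty hei _)) c1 ht, scalarOp_const_mul,
        scalarOp_vconv_of_vanishing hT hN.continuousOn hei hy.continuousOn hva ht,
        eh ht, vconv_congr eh (fun _ _ => rfl) ht, if_neg (by omega), if_neg (by omega),
        Nat.add_sub_cancel, he0, if_pos rfl]
      have := ey ht
      simp only [vconv_const_mul_left] at this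
      rw [this]
      field_simp
      ring

namespace IsScalarResolvent

variable {κ : ℕ} {b : ℕ → ℝ} {N R : ℝ → ℝ}

theorem contDiffOn_infty (hT : 0 < T) (h : IsScalarResolvent T κ b N R) :
    ContDiffOn ℝ ∞ R (Icc 0 T) := h.analytic.contDiffOn_infty (uniqueDiffOn_Icc hT)

/-- The resolvent kernel solves the inhomogeneous equation. -/
theorem scalarOp_resolvent (hT : 0 < T) (h : IsScalarResolvent T κ b N R) (hb : b κ ≠ 0)
    (hN : ContinuousOn N (Icc 0 T)) {ψ : ℝ → ℝ} (hψ : ContinuousOn ψ (Icc 0 T)) :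
    ContDiffOn ℝ κ (fun t => (if κ = 0 then (b 0)⁻¹ else 0) * ψ t + vconv R ψ t) (Icc 0 T) ∧
    ∀ t ∈ Icc 0 T,
      scalarOp T κ b N (fun t => (if κ = 0 then (b 0)⁻¹ else 0) * ψ t + vconv R ψ t) t = ψ t := by
  have hR := h.contDiffOn_infty hT
  obtain ⟨h1, -⟩ := iteratedDerivWithin_vconv_of_vanishing hT hR hψ h.vanishing
  have hψ' : ContDiffOn ℝ κ (fun t => (if κ = 0 then (b 0)⁻¹ else 0) * ψ t) (Icc 0 T) := by
    split_ifs with hκ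
    · subst hκ
      have : ContinuousOn (fun t => (b 0)⁻¹ * ψ t) (Icc 0 T) := continuousOn_const.mul hψ
      simpa using this
    · simp only [zero_mul]; exact contDiffOn_const
  refine ⟨hψ'.add h1, fun t ht => ?_⟩
  rw [scalarOp_add hT hN hψ' h1 ht, scalarOp_const_mul,
    scalarOp_vconv_of_vanishing hT hN hR hψ h.vanishing ht,
    vconv_congr (f' := fun s => -(if κ = 0 then (b 0)⁻¹ else 0) * N s)
      (fun s hs => (h.equation s hs).trans (neg_mul _ _).symm) (fun _ _ => rfl) ht,
    vconv_const_mul_left]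
  rcases κ with _ | κ
  · simp only [if_true, scalarOp_zero]
    field_simp
    ring
  · simp only [Nat.succ_ne_zero, if_false]
    rw [h.leading (by omega)]
    ring

/-- The derivatives of the resolvent kernel up to order `κ - 1` solve the homogeneous equation. -/
theorem scalarOp_iteratedDerivWithin (hT : 0 < T) (h : IsScalarResolvent T κ b N R)
    (hN : ContDiffOn ℝ ∞ N (Icc 0 T)) {m : ℕ} (hm : m < κ) {t : ℝ} (ht : t ∈ Icc 0 T) :
    scalarOp T κ b N (∂[T,m] R) t = 0 := by
  have hu := uniqueDiffOn_Icc hT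
  have hR := h.contDiffOn_infty hT
  have e0 : EqOn (scalarOp T κ b N R) (fun _ => 0) (Icc 0 T) := fun s hs => by
    rw [h.equation s hs, if_neg (by omega)]; simp
  have e1 : ∂[T,m] (scalarOp T κ b N R) t = 0 := by
    rw [iteratedDerivWithin_congr e0 ht]
    simp
  have hd : ∀ i ∈ Finset.range (κ + 1), ContDiffWithinAt ℝ m (fun t => b i * ∂[T,i] R t)
      (Icc 0 T) t := fun i _ => (contDiffOn_const.mul (contDiffOn_nat_of_infty
        (contDiffOn_infty_iteratedDerivWithin hT hR i) m)) t ht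
  unfold scalarOp at e1
  -- By commutativity the derivatives of the convolution are put on `R`; the boundary values
  -- `R^(j)(0)` with `j < m < κ` vanish.
  rw [iteratedDerivWithin_fun_add ht hu (ContDiffWithinAt.sum hd)
    (contDiffOn_nat_of_infty (contDiffOn_infty_vconv hT hN hR) m t ht),
    iteratedDerivWithin_fun_sum ht hu hd, vconv_comm N,
    iteratedDerivWithin_vconv hT hR (contDiffOn_nat_of_infty hN m) ht,
    Finset.sum_eq_zero (s := Finset.range m) fun j hj => by
      rw [Finset.mem_range] at hj
      rw [h.vanishing j (by omega), zero_mul], zero_add, vconv_comm] at e1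
  unfold scalarOp
  refine Eq.trans ?_ e1
  congr 1
  exact Finset.sum_congr rfl fun i _ => by
    rw [iteratedDerivWithin_const_mul_field, iteratedDerivWithin_comp_iteratedDerivWithin,
      iteratedDerivWithin_comp_iteratedDerivWithin, add_comm]

/-- Convolution of the resolvent kernel with a differential expression, integrated by parts. -/
theorem vconv_sum_iteratedDerivWithin (hT : 0 < T) (h : IsScalarResolvent T κ b N R) {c : ℕ → ℝ}
    {G w : ℝ → ℝ} (hG : ContinuousOn G (Icc 0 T)) (hw : ContDiffOn ℝ κ w (Icc 0 T)) {t : ℝ}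
    (ht : t ∈ Icc 0 T) :
    vconv R (scalarOp T κ c G w) t
        + ∑ i ∈ Finset.range (κ + 1), c i *
            ∑ m ∈ Finset.range i, ∂[T,m] R t * ∂[T,(i - 1 - m)] w 0
      = vconv (scalarOp T κ c G R) w t
        + (if κ = 0 then 0 else c κ * ∂[T,(κ - 1)] R 0) * w t := by
  have hR := h.contDiffOn_infty hT
  have hRd : ∀ i, ContinuousOn (∂[T,i] R) (Icc 0 T) := fun i =>
    (contDiffOn_infty_iteratedDerivWithin hT hR i).continuousOn
  have hwd : ∀ i ∈ Finset.range (κ + 1), ContinuousOn (∂[T,i] w) (Icc 0 T) := fun i hi =>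
    hw.continuousOn_iteratedDerivWithin
      (by rw [Finset.mem_range] at hi; norm_cast; omega) (uniqueDiffOn_Icc hT)
  have hcR : ∀ i ∈ Finset.range (κ + 1), ContinuousOn (fun s => c i * ∂[T,i] R s) (Icc 0 T) :=
    fun i _ => continuousOn_const.mul (hRd i)
  have hcw : ∀ i ∈ Finset.range (κ + 1), ContinuousOn (fun s => c i * ∂[T,i] w s) (Icc 0 T) :=
    fun i hi => continuousOn_const.mul (hwd i hi)
  have e1 : vconv R (scalarOp T κ c G w) t
      = ∑ i ∈ Finset.range (κ + 1), c i * vconv R (∂[T,i] w) t + vconv R (vconv G w) t := by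
    have : scalarOp T κ c G w = fun s => (∑ i ∈ Finset.range (κ + 1), c i * ∂[T,i] w s)
        + vconv G w s := rfl
    rw [this, vconv_add_right hR.continuousOn (continuousOn_finsetSum _ hcw)
      (continuousOn_vconv hT hG hw.continuousOn) ht, vconv_sum_right _ hR.continuousOn hcw ht]
    simp only [vconv_const_mul_right]
  have e2 : vconv (scalarOp T κ c G R) w t
      = ∑ i ∈ Finset.range (κ + 1), c i * vconv (∂[T,i] R) w t + vconv (vconv G R) w t := by
    have : scalarOp T κ c G R = fun s => (∑ i ∈ Finset.range (κ + 1), c i * ∂[T,i] R s)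
        + vconv G R s := rfl
    rw [this, vconv_add_left hw.continuousOn (continuousOn_finsetSum _ hcR)
      (continuousOn_vconv hT hG hR.continuousOn) ht, vconv_sum_left _ hw.continuousOn hcR ht]
    simp only [vconv_const_mul_left]
  have e3 : vconv R (vconv G w) t = vconv (vconv G R) w t := by
    rw [vconv_comm G R, vconv_assoc hT hR.continuousOn hG hw.continuousOn ht]
  have e4 : ∀ i ∈ Finset.range (κ + 1), c i * vconv R (∂[T,i] w) t
      + c i * ∑ m ∈ Finset.range i, ∂[T,m] R t * ∂[T,(i - 1 - m)] w 0
      = c i * vconv (∂[T,i] R) w t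
        + if i = κ then (if κ = 0 then 0 else c κ * ∂[T,(κ - 1)] R 0) * w t else 0 := by
    intro i hi
    rw [Finset.mem_range] at hi
    have hp := vconv_iteratedDerivWithin hT hR (hw.of_le (by norm_cast; omega) :
      ContDiffOn ℝ i w (Icc 0 T)) ht
    rw [← mul_add, hp, mul_add]
    congr 1
    rcases i with _ | i
    · rcases κ with _ | κ <;> simp
    · rw [Finset.sum_range_succ, Finset.sum_eq_zero fun m hm => by
        rw [Finset.mem_range] at hm
        rw [h.vanishing m (by omega), zero_mul], zero_add, Nat.add_sub_cancel, Nat.sub_self,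
        iteratedDerivWithin_zero]
      split_ifs with h1 h2
      · omega
      · subst h1; rw [Nat.add_sub_cancel]; ring
      · rw [h.vanishing i (by omega)]; ring
  rw [e1, e2, e3, add_right_comm, ← Finset.sum_add_distrib, Finset.sum_congr rfl e4,
    Finset.sum_add_distrib, Finset.sum_ite_eq', if_pos (by simp)]
  ring

/-- Representation of the solutions of the homogeneous equation. -/
theorem eq_sum_of_scalarOp_eq_zero (hT : 0 < T) (h : IsScalarResolvent T κ b N R) (hb : b κ ≠ 0)
    (hN : ContinuousOn N (Icc 0 T)) {z : ℝ → ℝ} (hz : ContDiffOn ℝ κ z (Icc 0 T))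
    (hz0 : ∀ t ∈ Icc 0 T, scalarOp T κ b N z t = 0) {t : ℝ} (ht : t ∈ Icc 0 T) :
    z t = ∑ i ∈ Finset.range (κ + 1), b i *
            ∑ m ∈ Finset.range i, ∂[T,m] R t * ∂[T,(i - 1 - m)] z 0 := by
  -- Convolve the homogeneous equation with `R`: the operator moves from `z` to `R`, which returns
  -- `z` at the price of initial values.
  have key := h.vconv_sum_iteratedDerivWithin hT (c := b) hN hz ht
  have e1 : vconv R (scalarOp T κ b N z) t = 0 := by
    rw [vconv_congr (g' := fun _ => 0) (fun _ _ => rfl) (fun s hs => hz0 s hs) ht]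
    simp [vconv]
  rw [e1, vconv_congr (f' := fun s => -(if κ = 0 then (b 0)⁻¹ else 0) * N s)
      (fun s hs => (h.equation s hs).trans (neg_mul _ _).symm) (fun _ _ => rfl) ht,
    vconv_const_mul_left, zero_add] at key
  rw [key]
  rcases κ with _ | κ
  · have := hz0 t ht
    rw [scalarOp_zero] at this
    simp only [if_true, zero_mul, add_zero]
    field_simp
    linarith
  · rw [if_neg (by omega), if_neg (by omega), h.leading (by omega)]
    ring

/-- Linear independence of the derivatives of the resolvent kernel up to order `κ - 1`. -/
theorem eq_zero_of_sum_eq_zero (hT : 0 < T) (h : IsScalarResolvent T κ b N R) {c : Fin κ → ℝ}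
    (hc : ∀ t ∈ Icc 0 T, ∑ m : Fin κ, ∂[T,m] R t * c m = 0) : c = 0 := by
  have hu := uniqueDiffOn_Icc hT
  have h0 : (0 : ℝ) ∈ Icc 0 T := left_mem_Icc.2 hT.le
  have hR := h.contDiffOn_infty hT
  -- Differentiating the relation at `0` gives a linear system with matrix `R^(j+m)(0)`. It is zero
  -- where `j + m < κ - 1` and nonzero where `j + m = κ - 1`, so the constants vanish successively
  -- from the highest index down.
  have key : ∀ j : ℕ, ∑ m : Fin κ, ∂[T,(j + m)] R 0 * c m = 0 := by
    intro j
    have e : ∂[T,j] (fun t => ∑ m : Fin κ, ∂[T,m] R t * c m) 0 = 0 := by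
      rw [iteratedDerivWithin_congr (g := fun _ => 0) (fun t ht => hc t ht) h0]
      simp
    rw [iteratedDerivWithin_fun_sum (f := fun m : Fin κ => fun t => ∂[T,m] R t * c m) h0 hu fun i _ =>
      ((contDiffOn_nat_of_infty (contDiffOn_infty_iteratedDerivWithin hT hR i) j).mul
        contDiffOn_const) 0 h0] at e
    refine Eq.trans ?_ e
    refine Finset.sum_congr rfl fun m _ => ?_
    simp only [mul_comm _ (c m)]
    rw [iteratedDerivWithin_const_mul_field, iteratedDerivWithin_comp_iteratedDerivWithin]
  have main : ∀ j : ℕ, ∀ m : Fin κ, m.1 + j + 1 = κ → c m = 0 := by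
    intro j
    induction j using Nat.strong_induction_on with
    | _ j ih =>
      intro m hm
      have hκ : κ ≠ 0 := by omega
      have := key j
      rw [Finset.sum_eq_single m] at this
      · have hl := h.leading hκ
        rw [show κ - 1 = j + m by omega] at hl
        exact (mul_eq_zero.1 this).resolve_left (right_ne_zero_of_mul_eq_one hl)
      · intro m' _ hne
        have hne' : m'.1 ≠ m.1 := fun e => hne (Fin.ext e)
        rcases lt_or_gt_of_ne hne' with hlt | hlt
        · rw [h.vanishing _ (by omega), zero_mul]
        · rw [ih (κ - 1 - m') (by omega) m' (by omega), mul_zero]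
      · intro hm'; exact absurd (Finset.mem_univ _) hm'
  funext m
  exact main (κ - 1 - m) m (by omega)

end IsScalarResolvent

end ScalarResolvent

/-! ### Elimination of one scalar unknown -/

section ScalarElimination

variable {T : ℝ}

/-- Collects the boundary terms by derivatives of `R`, which makes the constants multiplying them
visible. -/
theorem sum_triangle (κ : ℕ) (c x y : ℕ → ℝ) :
    ∑ i ∈ Finset.range (κ + 1), c i * ∑ m ∈ Finset.range i, x m * y (i - 1 - m)
      = ∑ m : Fin κ, x m * ∑ j ∈ Finset.range κ, (if m + j + 1 ≤ κ then c (m + j + 1) else 0) * y j := by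
  rw [Finset.sum_range_succ', Finset.sum_range_zero, mul_zero, add_zero]
  have h := Finset.sum_range_diag_flip κ (fun m j => c (m + j + 1) * (x m * y j))
  rw [Fin.sum_univ_eq_sum_range (fun m => x m * ∑ j ∈ Finset.range κ,
    (if m + j + 1 ≤ κ then c (m + j + 1) else 0) * y j)]
  refine Eq.trans ?_ (h.trans ?_)
  · refine Finset.sum_congr rfl fun i _ => ?_
    rw [Finset.mul_sum]
    refine Finset.sum_congr rfl fun m hm => ?_
    rw [Finset.mem_range] at hm
    rw [show m + (i - m) + 1 = i + 1 by omega, Nat.add_sub_cancel]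
  · refine Finset.sum_congr rfl fun m hm => ?_
    rw [Finset.mem_range] at hm
    rw [Finset.mul_sum]
    refine Finset.sum_subset_zero_on_sdiff (fun j hj => ?_) (fun j hj => ?_) (fun j hj => ?_)
    · rw [Finset.mem_range] at *; omega
    · rw [Finset.mem_sdiff, Finset.mem_range, Finset.mem_range] at hj
      rw [if_neg (by omega)]; ring
    · rw [Finset.mem_range] at hj
      rw [if_pos (by omega)]; ring

/-- A differential operator composed with a convolution operator. -/
theorem scalarOp_vconv (hT : 0 < T) {k : ℕ} {a : ℕ → ℝ} {N H w : ℝ → ℝ}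
    (hN : ContinuousOn N (Icc 0 T)) (hH : ContDiffOn ℝ ∞ H (Icc 0 T))
    (hw : ContDiffOn ℝ k w (Icc 0 T)) {t : ℝ} (ht : t ∈ Icc 0 T) :
    scalarOp T k a N (vconv H w) t
      = scalarOp T k (fun j => ∑ i ∈ Finset.range (k + 1),
          if j < i then a i * ∂[T,(i - 1 - j)] H 0 else 0) (scalarOp T k a N H) w t := by
  have hHd : ∀ i ∈ Finset.range (k + 1), ContinuousOn (fun s => a i * ∂[T,i] H s) (Icc 0 T) :=
    fun i _ => continuousOn_const.mul (contDiffOn_infty_iteratedDerivWithin hT hH i).continuousOn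
  have e : vconv (scalarOp T k a N H) w t
      = ∑ i ∈ Finset.range (k + 1), a i * vconv (∂[T,i] H) w t + vconv N (vconv H w) t := by
    have : scalarOp T k a N H = fun s => (∑ i ∈ Finset.range (k + 1), a i * ∂[T,i] H s)
        + vconv N H s := rfl
    rw [this, vconv_add_left hw.continuousOn (continuousOn_finsetSum _ hHd)
      (continuousOn_vconv hT hN hH.continuousOn) ht, vconv_sum_left _ hw.continuousOn hHd ht,
      vconv_assoc hT hN hH.continuousOn hw.continuousOn ht]
    simp only [vconv_const_mul_left]
  have e2 : ∑ i ∈ Finset.range (k + 1), a i * ∂[T,i] (vconv H w) t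
      = ∑ j ∈ Finset.range (k + 1), (∑ i ∈ Finset.range (k + 1),
          if j < i then a i * ∂[T,(i - 1 - j)] H 0 else 0) * ∂[T,j] w t
        + ∑ i ∈ Finset.range (k + 1), a i * vconv (∂[T,i] H) w t := by
    simp only [Finset.sum_mul]
    rw [Finset.sum_comm, ← Finset.sum_add_distrib]
    refine Finset.sum_congr rfl fun i hi => ?_
    rw [Finset.mem_range] at hi
    rw [iteratedDerivWithin_vconv hT hH (hw.of_le (by norm_cast; omega)) ht, mul_add]
    congr 1
    rw [← Finset.sum_range_reflect, Finset.mul_sum]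
    symm
    refine (Finset.sum_subset_zero_on_sdiff (fun j hj => ?_) (fun j hj => ?_)
      (fun j hj => ?_)).symm
    · rw [Finset.mem_range] at *; omega
    · rw [Finset.mem_sdiff, Finset.mem_range, Finset.mem_range] at hj
      rw [if_neg (by omega), zero_mul]
    · rw [Finset.mem_range] at hj
      rw [if_pos (by omega), show i - 1 - (i - 1 - j) = j by omega, mul_assoc]
  unfold scalarOp at e e2 ⊢
  rw [e, e2, add_assoc]

theorem scalarOp_sub_coeff {k : ℕ} {a a' : ℕ → ℝ} {K K' z : ℝ → ℝ}
    (hK : ContinuousOn K (Icc 0 T)) (hK' : ContinuousOn K' (Icc 0 T))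
    (hz : ContinuousOn z (Icc 0 T)) {t : ℝ} (ht : t ∈ Icc 0 T) :
    scalarOp T k (fun i => a i - a' i) (fun u => K u - K' u) z t
      = scalarOp T k a K z t - scalarOp T k a' K' z t := by
  have e : vconv (fun u => K u - K' u) z t = vconv K z t - vconv K' z t := by
    have hm : ContinuousOn (fun u => (-1) * K' u) (Icc 0 T) := continuousOn_const.mul hK'
    have h := vconv_add_left hz hK hm ht
    rw [vconv_const_mul_left] at h
    have e0 : (fun u => K u - K' u) = fun s => K s + (-1) * K' s := by funext s; ring
    rw [e0, h]; ring
  unfold scalarOp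
  rw [e]
  simp only [sub_mul, Finset.sum_sub_distrib]
  ring

namespace IsScalarResolvent

variable {κ : ℕ} {b : ℕ → ℝ} {N R : ℝ → ℝ}

/-- Since `c κ = 0`, no multiple of `w` outside the integral remains: the eliminated expression is a
convolution up to a combination of the `R^(m)`, `m < κ`. These span the solutions of the homogeneous
equation, so the initial values can be absorbed into the arbitrary constants. -/
theorem resolvent_scalarOp (hT : 0 < T) (h : IsScalarResolvent T κ b N R) {c : ℕ → ℝ}
    (hc : c κ = 0) {G w H : ℝ → ℝ} (hG : ContinuousOn G (Icc 0 T))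
    (hw : ContDiffOn ℝ κ w (Icc 0 T))
    (hH : EqOn H (fun t => (if κ = 0 then (b 0)⁻¹ else 0) * G t + scalarOp T κ c G R t) (Icc 0 T))
    {t : ℝ} (ht : t ∈ Icc 0 T) :
    (if κ = 0 then (b 0)⁻¹ else 0) * scalarOp T κ c G w t + vconv R (scalarOp T κ c G w) t
      = vconv H w t - ∑ m : Fin κ, ∂[T,m] R t * ∑ j ∈ Finset.range κ,
          (if m + j + 1 ≤ κ then c (m + j + 1) else 0) * ∂[T,j] w 0 := by
  have hR := h.contDiffOn_infty hT
  have key := h.vconv_sum_iteratedDerivWithin hT (c := c) hG hw ht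
  rw [hc, sum_triangle κ c (fun m => ∂[T,m] R t) (fun j => ∂[T,j] w 0)] at key
  have hcR : ContinuousOn (scalarOp T κ c G R) (Icc 0 T) :=
    (continuousOn_finsetSum _ fun i _ => continuousOn_const.mul
      (contDiffOn_infty_iteratedDerivWithin hT hR i).continuousOn).add
        (continuousOn_vconv hT hG hR.continuousOn)
  have hGc : ContinuousOn (fun t => (if κ = 0 then (b 0)⁻¹ else 0) * G t) (Icc 0 T) :=
    continuousOn_const.mul hG
  rw [vconv_congr hH (fun _ _ => rfl) ht, vconv_add_left hw.continuousOn hGc hcR ht, vconv_const_mul_left]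
  have e : (if κ = 0 then (b 0)⁻¹ else 0) * scalarOp T κ c G w t
      = (if κ = 0 then (b 0)⁻¹ else 0) * vconv G w t := by
    rcases κ with _ | κ
    · rw [scalarOp_zero, hc]; ring
    · simp
  rw [e]
  simp only [zero_mul, ite_self, add_zero] at key
  linarith

variable {A : ℕ → Matrix (Fin 1) (Fin 1) ℝ} {K : ℝ → Matrix (Fin 1) (Fin 1) ℝ}

/-- The derivatives `R, …, R^(κ-1)` serve as basis: integration by parts represents every solution
through them, and their values at `0` make them independent. -/
theorem isFundamentalMatrix (hT : 0 < T) (hA : A κ 0 0 ≠ 0)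
    (hK : ContDiffOn ℝ ∞ (fun u => K u 0 0) (Icc 0 T))
    (h : IsScalarResolvent T κ (fun i => A i 0 0) (fun u => K u 0 0) R) :
    IsFundamentalMatrix T κ A K (fun t => Matrix.of fun (_ : Fin 1) (m : Fin κ) => ∂[T,m] R t) := by
  have hR := h.contDiffOn_infty hT
  have hRd : ∀ m, ContDiffOn ℝ ∞ (∂[T,m] R) (Icc 0 T) := fun m =>
    contDiffOn_infty_iteratedDerivWithin hT hR m
  have hKc : ∀ a b, ContinuousOn (fun u => K u a b) (Icc 0 T) := fun a b => by
    rw [Subsingleton.elim a 0, Subsingleton.elim b 0]; exact hK.continuousOn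
  have hmul : ∀ (c : Fin κ → ℝ) (s : ℝ) (a : Fin 1),
      ((Matrix.of fun (_ : Fin 1) (m : Fin κ) => ∂[T,m] R s) *ᵥ c) a
        = ∑ m : Fin κ, c m * ∂[T,m] R s := fun c s a => by
    rw [mulVec_apply_eq_sum]
    exact Finset.sum_congr rfl fun m _ => mul_comm _ _
  refine ⟨fun a b => contDiffOn_nat_of_infty (hRd b) κ, fun c t ht => ?_, fun z hz hz0 => ?_⟩
  · ext a
    rw [constOp_apply hT hKc _ ht, Fin.sum_univ_one, Subsingleton.elim a 0]
    · simp only [hmul]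
      rw [scalarOp_sum (z := fun (m : Fin κ) s => c m * ∂[T,m] R s) hT _ hK.continuousOn
        (fun m _ => contDiffOn_const.mul (contDiffOn_nat_of_infty (hRd m) κ)) ht]
      refine Finset.sum_eq_zero fun m _ => ?_
      rw [scalarOp_const_mul, h.scalarOp_iteratedDerivWithin hT hK m.2 ht, mul_zero]
    · refine contDiffOn_pi.2 fun a => ?_
      simp only [hmul]
      exact ContDiffOn.sum fun m _ => contDiffOn_const.mul (contDiffOn_nat_of_infty (hRd m) κ)
  · have hz0' : ∀ t ∈ Icc 0 T,
        scalarOp T κ (fun i => A i 0 0) (fun u => K u 0 0) (fun s => z s 0) t = 0 := by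
      intro t ht
      have := congrFun (hz0 t ht) 0
      rwa [constOp_apply hT hKc hz ht, Fin.sum_univ_one] at this
    -- The constants of the representation formula, in the order given by `sum_triangle`.
    let c : Fin κ → ℝ := fun m => ∑ j ∈ Finset.range κ,
      (if m.1 + j + 1 ≤ κ then A (m + j + 1) 0 0 else 0) * ∂[T,j] (fun s => z s 0) 0
    have hc : ∀ t ∈ Icc 0 T, z t 0 = ∑ m : Fin κ, c m * ∂[T,m] R t := by
      intro t ht
      rw [h.eq_sum_of_scalarOp_eq_zero hT hA hK.continuousOn (contDiffOn_pi.1 hz 0) hz0' ht,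
        sum_triangle κ _ (fun m => ∂[T,m] R t) (fun j => ∂[T,j] (fun s => z s 0) 0)]
      exact Finset.sum_congr rfl fun m _ => mul_comm _ _
    refine ⟨c, fun t ht => ?_, fun c' hc' => ?_⟩
    · ext a
      rw [hmul, Subsingleton.elim a 0, hc t ht]
    · have : c' - c = 0 := h.eq_zero_of_sum_eq_zero hT fun t ht => by
        have e := congrFun (hc' t ht) 0
        rw [hmul, hc t ht] at e
        simp only [Pi.sub_apply, mul_sub, Finset.sum_sub_distrib]
        simp only [mul_comm (∂[T,_] R t)]
        rw [e, sub_self]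
      exact sub_eq_zero.1 this

theorem resolventApply_apply (hT : 0 < T) {b : ℕ → ℝ} {R : ℝ → ℝ} (hA : A 0 0 0 = b 0)
    (hR : ContinuousOn R (Icc 0 T)) {ψ : ℝ → Fin 1 → ℝ} (hψ : ContinuousOn ψ (Icc 0 T))
    {t : ℝ} (ht : t ∈ Icc 0 T) (a : Fin 1) :
    resolventApply κ A (fun u => Matrix.of fun _ _ => R u) ψ t a
      = (if κ = 0 then (b 0)⁻¹ else 0) * ψ t 0 + vconv R (fun s => ψ s 0) t := by
  rw [resolventApply_eq_constOp T, constOp_apply (K := fun u => Matrix.of fun _ _ => R u) hT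
      (fun _ _ => hR) (by simpa using hψ) ht,
    Fin.sum_univ_one, scalarOp_zero, Subsingleton.elim a 0]
  simp only [Matrix.of_apply]
  congr 2
  split_ifs with h
  · rw [Matrix.inv_subsingleton, Matrix.diagonal_apply_eq, hA, Ring.inverse_eq_inv']
  · rfl

theorem isResolventKernel (hT : 0 < T) (hA : A κ 0 0 ≠ 0)
    (hK : ContinuousOn (fun u => K u 0 0) (Icc 0 T))
    (h : IsScalarResolvent T κ (fun i => A i 0 0) (fun u => K u 0 0) R) :
    IsResolventKernel T κ A K (fun u => Matrix.of fun _ _ => R u) := by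
  have hR := h.contDiffOn_infty hT
  have hKc : ∀ a b, ContinuousOn (fun u => K u a b) (Icc 0 T) := fun a b => by
    rw [Subsingleton.elim a 0, Subsingleton.elim b 0]; exact hK
  refine ⟨fun _ _ => h.analytic, fun ψ hψ => ?_⟩
  obtain ⟨h1, h2⟩ := h.scalarOp_resolvent hT hA hK (continuousOn_pi.1 hψ 0)
  have e : ∀ (a : Fin 1), EqOn (fun t => resolventApply κ A (fun u => Matrix.of fun _ _ => R u) ψ t a)
      (fun t => (if κ = 0 then (A 0 0 0)⁻¹ else 0) * ψ t 0 + vconv R (fun s => ψ s 0) t)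
      (Icc 0 T) := fun a t ht =>
    resolventApply_apply (b := fun i => A i 0 0) hT rfl hR.continuousOn hψ ht a
  have hc : ContDiffOn ℝ κ (resolventApply κ A (fun u => Matrix.of fun _ _ => R u) ψ) (Icc 0 T) :=
    contDiffOn_pi.2 fun a => h1.congr (e a)
  refine ⟨hc, fun t ht => ?_⟩
  ext a
  rw [constOp_apply hT hKc hc ht, Fin.sum_univ_one, Subsingleton.elim a 0,
    scalarOp_congr (fun _ _ => rfl) (e 0) ht, h2 t ht]

end IsScalarResolvent

end ScalarElimination

/-- A nonzero row can be completed to an invertible matrix. -/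
theorem exists_invertible_with_row {n₁ : ℕ} {q : Fin (n₁ + 1) → ℝ} (hq : q ≠ 0) :
    ∃ (M : Matrix (Fin n₁ ⊕ Fin 1) (Fin (n₁ + 1)) ℝ)
      (M' : Matrix (Fin (n₁ + 1)) (Fin n₁ ⊕ Fin 1) ℝ),
      M * M' = 1 ∧ M' * M = 1 ∧ M (Sum.inr 0) = q := by
  obtain ⟨j, hj⟩ := Function.ne_iff.1 hq
  -- The identity with row `j` replaced by `q` has determinant `q j ≠ 0`; the rows are then
  -- renumbered so that row `j` becomes the last block.
  let e : Fin n₁ ⊕ Fin 1 ≃ Fin (n₁ + 1) :=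
    finSumFinEquiv.trans (Equiv.swap (finSumFinEquiv (Sum.inr 0)) j)
  have he : e (Sum.inr 0) = j := by simp [e]
  let U : Matrix (Fin (n₁ + 1)) (Fin (n₁ + 1)) ℝ := (1 : Matrix _ _ ℝ).updateRow j q
  have hU : IsUnit U.det := by
    have : U.det = q j := by
      simp only [U]
      rw [← Matrix.cramer_transpose_apply, Matrix.transpose_one, Matrix.cramer_one]
      rfl
    rw [this]
    exact IsUnit.mk0 _ hj
  refine ⟨U.submatrix e id, U⁻¹.submatrix id e, ?_, ?_, ?_⟩
  · have := Matrix.submatrix_mul_equiv U U⁻¹ e (Equiv.refl _) e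
    rw [Matrix.mul_nonsing_inv U hU, Matrix.submatrix_one_equiv] at this
    exact this
  · rw [Matrix.submatrix_mul_equiv, Matrix.nonsing_inv_mul U hU, Matrix.submatrix_one _ Function.injective_id]
  · funext i
    simp only [Matrix.submatrix_apply, he, id, U, Matrix.updateRow_self]

/-! ### Existence of splitting steps -/

namespace IDESystem

variable {T : ℝ}

/-- A splitting step with a scalar second block. -/
theorem exists_splitStep (hT : 0 < T) {n₁ p : ℕ} (S : IDESystem T (n₁ + 1) p) {κ : ℕ}
    (hκ : κ < S.order)
    (P Q' : Matrix (Fin n₁ ⊕ Fin 1) (Fin (n₁ + 1)) ℝ)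
    (Q P' : Matrix (Fin (n₁ + 1)) (Fin n₁ ⊕ Fin 1) ℝ)
    (hP : P * P' = 1 ∧ P' * P = 1) (hQ : Q * Q' = 1 ∧ Q' * Q = 1)
    (hrow : ∀ i, κ < i → i ≤ S.order → ∀ x, (P * S.A i * Q) (Sum.inr 0) x = 0)
    (hκrow : ∀ β, (P * S.A κ * Q) (Sum.inr 0) (Sum.inl β) = 0)
    (hκκ : (P * S.A κ * Q) (Sum.inr 0) (Sum.inr 0) = 1) :
    ∃ S₁ : IDESystem T n₁ (p + κ), SplitStep S S₁ := by
  have hu := uniqueDiffOn_Icc hT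
  have h0 : (0 : ℝ) ∈ Icc 0 T := left_mem_Icc.2 hT.le
  set k := S.order with hk
  let B : ℕ → Matrix (Fin n₁ ⊕ Fin 1) (Fin n₁ ⊕ Fin 1) ℝ := fun i => P * S.A i * Q
  let N : ℝ → Matrix (Fin n₁ ⊕ Fin 1) (Fin n₁ ⊕ Fin 1) ℝ := fun u => P * S.K u * Q
  have hNa : ∀ x y, AnalyticOnNhd ℝ (fun u => N u x y) (Icc 0 T) :=
    analyticOnNhd_mul_right Q (analyticOnNhd_mul_left P S.analytic_K)
  have hNs : ∀ x y, ContDiffOn ℝ ∞ (fun u => N u x y) (Icc 0 T) := fun x y =>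
    (hNa x y).contDiffOn_infty hu
  have hNc : ∀ x y, ContinuousOn (fun u => N u x y) (Icc 0 T) := fun x y => (hNs x y).continuousOn
  let b : ℕ → ℝ := fun i => B i (Sum.inr 0) (Sum.inr 0)
  have hb : b κ ≠ 0 := by
    have : b κ = 1 := hκκ
    rw [this]; exact one_ne_zero
  obtain ⟨R, hR⟩ := exists_isScalarResolvent hT hb (hNa (Sum.inr 0) (Sum.inr 0))
  have hRs := hR.contDiffOn_infty hT
  have hRd : ∀ m, ContDiffOn ℝ ∞ (∂[T,m] R) (Icc 0 T) := fun m =>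
    contDiffOn_infty_iteratedDerivWithin hT hRs m
  set δ : ℝ := if κ = 0 then (b 0)⁻¹ else 0 with hδ
  let c : Fin n₁ → ℕ → ℝ := fun β i => B i (Sum.inr 0) (Sum.inl β)
  let G : Fin n₁ → ℝ → ℝ := fun β u => N u (Sum.inr 0) (Sum.inl β)
  let a : Fin n₁ → ℕ → ℝ := fun α i => B i (Sum.inl α) (Sum.inr 0)
  let L : Fin n₁ → ℝ → ℝ := fun α u => N u (Sum.inl α) (Sum.inr 0)
  have hG : ∀ β, ContinuousOn (G β) (Icc 0 T) := fun β => hNc _ _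
  have hL : ∀ α, ContinuousOn (L α) (Icc 0 T) := fun α => hNc _ _
  have hLs : ∀ α, ContDiffOn ℝ ∞ (L α) (Icc 0 T) := fun α => hNs _ _
  -- the kernels produced by the elimination of the last unknown
  have exH : ∀ β, ∃ H : ℝ → ℝ, AnalyticOnNhd ℝ H (Icc 0 T) ∧
      EqOn H (fun t => δ * G β t + scalarOp T κ (c β) (G β) R t) (Icc 0 T) := by
    intro β
    obtain ⟨h, hh, e⟩ := exists_analytic_scalarOp hT κ (c β)
      (hNa (Sum.inr 0) (Sum.inl β)) hR.analytic
    refine ⟨fun t => δ * G β t + h t, (analyticOnNhd_const.mul (hNa _ _)).add hh, fun t ht => ?_⟩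
    simp only [G, e ht]
  choose H hHa hH using exH
  have hHs : ∀ β, ContDiffOn ℝ ∞ (H β) (Icc 0 T) := fun β => (hHa β).contDiffOn_infty hu
  have exJ : ∀ α β, ∃ J : ℝ → ℝ, AnalyticOnNhd ℝ J (Icc 0 T) ∧
      EqOn (scalarOp T k (a α) (L α) (H β)) J (Icc 0 T) := fun α β =>
    exists_analytic_scalarOp hT k (a α) (hNa (Sum.inl α) (Sum.inr 0)) (hHa β)
  choose J hJa hJ using exJ
  have hJc : ∀ α β, ContinuousOn (J α β) (Icc 0 T) := fun α β =>
    ((hJa α β).contDiffOn_infty hu).continuousOn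
  -- Boundary terms from differentiating `H * w`. Only indices `j < i ≤ k` occur, so the coefficient
  -- at order `k` is not affected.
  let a' : Fin n₁ → Fin n₁ → ℕ → ℝ := fun α β j => ∑ i ∈ Finset.range (k + 1),
    if j < i then a α i * ∂[T,(i - 1 - j)] (H β) 0 else 0
  -- the solution operator of the last equation
  let ρ : (ℝ → ℝ) → ℝ → ℝ := fun ψ t => δ * ψ t + vconv R ψ t
  have hρ : ∀ ψ, ContDiffOn ℝ ∞ ψ (Icc 0 T) → ContDiffOn ℝ ∞ (ρ ψ) (Icc 0 T) := fun ψ h =>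
    (contDiffOn_const.mul h).add (contDiffOn_infty_vconv hT hRs h)
  let E : Fin n₁ → (ℝ → ℝ) → ℝ → ℝ := fun α => scalarOp T k (a α) (L α)
  have hE : ∀ α z, ContDiffOn ℝ ∞ z (Icc 0 T) → ContDiffOn ℝ ∞ (E α z) (Icc 0 T) := fun α z h =>
    contDiffOn_infty.2 fun m => contDiffOn_scalarOp hT (hLs α) (contDiffOn_nat_of_infty h _)
  let φ : Fin n₁ ⊕ Fin 1 → ℝ → ℝ := fun x t => (P *ᵥ S.f t) x
  let χ : Fin n₁ ⊕ Fin 1 → Fin p → ℝ → ℝ := fun x y t => (P * S.W t) x y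
  have hφ : ∀ x, ContDiffOn ℝ ∞ (φ x) (Icc 0 T) := contDiffOn_mulVec P S.smooth_f
  have hχ : ∀ x y, ContDiffOn ℝ ∞ (χ x y) (Icc 0 T) := contDiffOn_matrix_mul_left P S.smooth_W
  have hg : ∀ (d : Fin p → ℝ) t x, (P *ᵥ S.rhs d t) x = φ x t + ∑ y, d y * χ x y t := by
    intro d t x
    simp only [rhs, φ, χ]
    rw [Matrix.mulVec_add, Pi.add_apply, Matrix.mulVec_mulVec, mulVec_apply_eq_sum (P * S.W t)]
    congr 1
    exact Finset.sum_congr rfl fun y _ => mul_comm _ _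
  -- The system obtained by substitution. Its first `p` columns carry the old constants, and the `κ`
  -- new ones come from the homogeneous solutions `R^(m)`.
  let S₁ : IDESystem T n₁ (p + κ) :=
    { order := k
      A := fun i => Matrix.of fun α β => B i (Sum.inl α) (Sum.inl β) - a' α β i
      K := fun u => Matrix.of fun α β => N u (Sum.inl α) (Sum.inl β) - J α β u
      W := fun t => Matrix.of fun α => Fin.append
        (fun y => χ (Sum.inl α) y t - E α (ρ (χ (Sum.inr 0) y)) t)
        (fun m : Fin κ => - E α (∂[T,m] R) t)
      f := fun t α => φ (Sum.inl α) t - E α (ρ (φ (Sum.inr 0))) t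
      analytic_K := fun α β => (hNa _ _).sub (hJa α β)
      smooth_W := fun α y => by
        refine Fin.addCases (fun y => ?_) (fun m => ?_) y
        · simp only [Matrix.of_apply, Fin.append_left]
          exact (hχ _ y).sub (hE α _ (hρ _ (hχ _ y)))
        · simp only [Matrix.of_apply, Fin.append_right]
          exact (hE α _ (hRd m)).neg
      smooth_f := contDiffOn_pi.2 fun α => (hφ _).sub (hE α _ (hρ _ (hφ _))) }
  -- Exactly the initial value coefficients in `resolvent_scalarOp`.
  let Θ : ℕ → Matrix (Fin κ) (Fin n₁) ℝ := fun j => Matrix.of fun m β =>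
    if m.1 + j + 1 ≤ κ then c β (m + j + 1) else 0
  refine ⟨S₁, 1, κ, P, Q', Q, P',
    fun t => Matrix.of fun (_ : Fin 1) (m : Fin κ) => ∂[T,m] R t,
    fun u => Matrix.of fun _ _ => R u, Θ, one_pos, hκ, le_rfl, hP, hQ, fun i h1 h2 => ⟨?_, ?_⟩,
    ?_, ?_, ?_, ?_⟩
  · ext x y
    rw [Subsingleton.elim x 0]
    exact hrow i h1 h2 _
  · ext x y
    rw [Subsingleton.elim x 0]
    exact hrow i h1 h2 _
  · rw [Matrix.det_fin_one]
    exact hb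
  · exact IsScalarResolvent.isFundamentalMatrix hT hb (hNs _ _) hR
  · exact IsScalarResolvent.isResolventKernel hT hb (hNc _ _) hR
  · intro w hw d c₂ ψ w₂ t ht
    have hwβ : ∀ β, ContDiffOn ℝ k (fun s => w s β) (Icc 0 T) := contDiffOn_pi.1 hw
    have hwκ : ∀ β, ContDiffOn ℝ κ (fun s => w s β) (Icc 0 T) := fun β =>
      (hwβ β).of_le (by norm_cast; omega)
    let C : Fin κ → ℝ := c₂ + ∑ i ∈ Finset.range κ, Θ i *ᵥ iteratedDerivWithin i w (Icc 0 T) 0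
    have hC : ∀ m, C m = c₂ m + ∑ β, ∑ j ∈ Finset.range κ,
        (if m.1 + j + 1 ≤ κ then c β (m + j + 1) else 0) * ∂[T,j] (fun s => w s β) 0 := by
      intro m
      simp only [C, Pi.add_apply, Finset.sum_apply, mulVec_apply_eq_sum]
      rw [Finset.sum_comm]
      congr 1
      refine Finset.sum_congr rfl fun β _ => Finset.sum_congr rfl fun j hj => ?_
      rw [Finset.mem_range] at hj
      rw [iteratedDerivWithin_pi_apply hT (hw.of_le (by norm_cast; omega)) h0]
      rfl
    let op : Fin n₁ → ℝ → ℝ := fun β => scalarOp T κ (c β) (G β) (fun s => w s β)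
    have hop : ∀ β, ContinuousOn (op β) (Icc 0 T) := fun β => by
      have : ContDiffOn ℝ (0 : ℕ) (op β) (Icc 0 T) :=
        contDiffOn_scalarOp hT (hNs _ _) (by rw [zero_add]; exact hwκ β)
      exact this.continuousOn
    let γ : ℝ → ℝ := fun t => φ (Sum.inr 0) t + ∑ y, d y * χ (Sum.inr 0) y t
    have hγs : ContDiffOn ℝ ∞ γ (Icc 0 T) :=
      (hφ _).add (ContDiffOn.sum fun y _ => contDiffOn_const.mul (hχ _ y))
    have hψ : EqOn (fun s => ψ s 0) (fun s => γ s + ∑ β, (-1) * op β s) (Icc 0 T) := by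
      intro s hs
      have e := constOp_apply (A := fun i => (B i).toBlocks₂₁) (K := fun u => (N u).toBlocks₂₁)
        hT (fun x y => hNc (Sum.inr x) (Sum.inl y)) (contDiffOn_pi.2 hwκ) hs 0
      simp only [ψ, Pi.sub_apply]
      rw [hg, ← Finset.mul_sum, neg_one_mul, ← sub_eq_add_neg]
      exact congrArg _ e
    have hopm : ∀ β, ContinuousOn (fun s => (-1) * op β s) (Icc 0 T) := fun β =>
      continuousOn_const.mul (hop β)
    have hops : ContinuousOn (fun s => ∑ β, (-1) * op β s) (Icc 0 T) :=
      continuousOn_finsetSum _ fun β _ => hopm β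
    have hψc : ContinuousOn ψ (Icc 0 T) := continuousOn_pi.2 fun x => by
      rw [Subsingleton.elim x 0]
      exact (hγs.continuousOn.add hops).congr hψ
    have hργ : ∀ s ∈ Icc 0 T, ρ γ s = ρ (φ (Sum.inr 0)) s + ∑ y, d y * ρ (χ (Sum.inr 0) y) s := by
      intro s hs
      have hχc : ∀ y ∈ Finset.univ, ContinuousOn (fun s => d y * χ (Sum.inr 0) y s) (Icc 0 T) :=
        fun y _ => continuousOn_const.mul (hχ _ y).continuousOn
      simp only [ρ, γ]
      rw [vconv_add_right hRs.continuousOn (hφ _).continuousOn (continuousOn_finsetSum _ hχc) hs,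
        vconv_sum_right _ hRs.continuousOn hχc hs]
      simp only [vconv_const_mul_right, mul_add, Finset.sum_add_distrib, Finset.mul_sum]
      simp only [mul_left_comm δ]
      ring
    -- The initial values multiply the same functions `R^(m)` as `c₂` does, so both merge into the
    -- shifted vector `C`, and what remains of `w` is a convolution.
    have hw₂ : EqOn (fun s => w₂ s 0) (fun s => ∑ m, C m * ∂[T,m] R s
        + ((ρ (φ (Sum.inr 0)) s + ∑ y, d y * ρ (χ (Sum.inr 0) y) s)
          + ∑ β, (-1) * vconv (H β) (fun s => w s β) s)) (Icc 0 T) := by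
      intro s hs
      have e1 : w₂ s 0 = ∑ m : Fin κ, ∂[T,m] R s * c₂ m
          + (δ * ψ s 0 + vconv R (fun s => ψ s 0) s) := by
        simp only [w₂, Pi.add_apply]
        congr 1
        exact IsScalarResolvent.resolventApply_apply (A := fun i => (B i).toBlocks₂₂) (b := b)
          hT rfl hRs.continuousOn hψc hs 0
      have e2 : ∀ β, δ * op β s + vconv R (op β) s = vconv (H β) (fun s => w s β) s
          - ∑ m : Fin κ, ∂[T,m] R s * ∑ j ∈ Finset.range κ,
            (if m + j + 1 ≤ κ then c β (m + j + 1) else 0) * ∂[T,j] (fun s => w s β) 0 :=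
        fun β => hR.resolvent_scalarOp hT (hκrow β) (hG β) (hwκ β) (hH β) hs
      have e3 : ψ s 0 = γ s + ∑ β, (-1) * op β s := hψ hs
      simp only []
      rw [e1, vconv_congr (fun _ _ => rfl) hψ hs, e3, vconv_add_right hRs.continuousOn
        hγs.continuousOn hops hs, vconv_sum_right _ hRs.continuousOn (fun β _ => hopm β) hs,
        ← hργ s hs]
      simp only [vconv_const_mul_right, hC, add_mul, Finset.sum_add_distrib, Finset.sum_mul]
      have e4 : ∑ m : Fin κ, ∑ β, ∑ j ∈ Finset.range κ,
            (if m.1 + j + 1 ≤ κ then c β (m + j + 1) else 0) * ∂[T,j] (fun s => w s β) 0 * ∂[T,m] R s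
          = ∑ β, vconv (H β) (fun s => w s β) s - (δ * ∑ β, op β s + ∑ β, vconv R (op β) s) := by
        rw [Finset.sum_comm, Finset.mul_sum, ← Finset.sum_add_distrib, ← Finset.sum_sub_distrib]
        refine Finset.sum_congr rfl fun β _ => ?_
        rw [e2 β, sub_sub_cancel]
        refine Finset.sum_congr rfl fun m _ => ?_
        rw [Finset.mul_sum]
        exact Finset.sum_congr rfl fun j _ => mul_comm _ _
      rw [e4]
      simp only [← Finset.mul_sum, ρ, mul_comm (c₂ _)]
      ring
    have hvs : ∀ β, ContDiffOn ℝ k (vconv (H β) (fun s => w s β)) (Icc 0 T) := fun β =>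
      (contDiffOn_vconv hT (hHs β) (hwβ β)).of_le (by norm_cast; omega)
    have s1 : ContDiffOn ℝ k (fun s => ∑ m : Fin κ, C m * ∂[T,m] R s) (Icc 0 T) :=
      ContDiffOn.sum fun m _ => contDiffOn_const.mul (contDiffOn_nat_of_infty (hRd m) k)
    have s2 : ContDiffOn ℝ k (ρ (φ (Sum.inr 0))) (Icc 0 T) :=
      contDiffOn_nat_of_infty (hρ _ (hφ _)) k
    have s3' : ∀ y, ContDiffOn ℝ k (fun s => d y * ρ (χ (Sum.inr 0) y) s) (Icc 0 T) :=
      fun y => contDiffOn_const.mul (contDiffOn_nat_of_infty (hρ _ (hχ _ y)) k)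
    have s3 : ContDiffOn ℝ k (fun s => ∑ y, d y * ρ (χ (Sum.inr 0) y) s) (Icc 0 T) :=
      ContDiffOn.sum fun y _ => s3' y
    have s4' : ∀ β, ContDiffOn ℝ k (fun s => (-1) * vconv (H β) (fun s => w s β) s) (Icc 0 T) :=
      fun β => contDiffOn_const.mul (hvs β)
    have s4 : ContDiffOn ℝ k (fun s => ∑ β, (-1) * vconv (H β) (fun s => w s β) s) (Icc 0 T) :=
      ContDiffOn.sum fun β _ => s4' β
    have hw₂s : ContDiffOn ℝ k w₂ (Icc 0 T) := contDiffOn_pi.2 fun x => by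
      rw [Subsingleton.elim x 0]
      exact (s1.add ((s2.add s3).add s4)).congr hw₂
    ext α
    have o1 : constOp T k (fun i => (B i).toBlocks₁₁) (fun u => (N u).toBlocks₁₁) w t α
        = ∑ β, scalarOp T k (fun i => B i (Sum.inl α) (Sum.inl β))
            (fun u => N u (Sum.inl α) (Sum.inl β)) (fun s => w s β) t :=
      constOp_apply hT (fun x y => hNc (Sum.inl x) (Sum.inl y)) hw ht α
    have o2 : constOp T k (fun i => (B i).toBlocks₁₂) (fun u => (N u).toBlocks₁₂) w₂ t α
        = E α (fun s => w₂ s 0) t := by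
      have := constOp_apply (A := fun i => (B i).toBlocks₁₂) (K := fun u => (N u).toBlocks₁₂) hT
        (fun x y => hNc (Sum.inl x) (Sum.inr y)) hw₂s ht α
      rw [Fin.sum_univ_one] at this
      exact this
    have o3 : E α (fun s => w₂ s 0) t = ∑ m : Fin κ, C m * E α (∂[T,m] R) t
        + ((E α (ρ (φ (Sum.inr 0))) t + ∑ y, d y * E α (ρ (χ (Sum.inr 0) y)) t)
          + ∑ β, (-1) * scalarOp T k (a' α β) (J α β) (fun s => w s β) t) := by
      simp only [E]
      rw [scalarOp_congr (fun _ _ => rfl) hw₂ ht, scalarOp_add hT (hL α) s1 ((s2.add s3).add s4) ht,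
        scalarOp_add hT (hL α) (s2.add s3) s4 ht, scalarOp_add hT (hL α) s2 s3 ht,
        scalarOp_sum (z := fun (m : Fin κ) s => C m * ∂[T,m] R s) hT _ (hL α)
          (fun m _ => contDiffOn_const.mul (contDiffOn_nat_of_infty (hRd m) k)) ht,
        scalarOp_sum hT _ (hL α) (fun y _ => s3' y) ht,
        scalarOp_sum hT _ (hL α) (fun β _ => s4' β) ht]
      simp only [scalarOp_const_mul]
      congr 2
      refine Finset.sum_congr rfl fun β _ => ?_
      rw [scalarOp_vconv hT (hL α) (hHs β) (hwβ β) ht,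
        scalarOp_congr (hJ α β) (fun _ _ => rfl) ht]
    have o4 : S₁.op w t α = ∑ β, (scalarOp T k (fun i => B i (Sum.inl α) (Sum.inl β))
            (fun u => N u (Sum.inl α) (Sum.inl β)) (fun s => w s β) t
          - scalarOp T k (a' α β) (J α β) (fun s => w s β) t) := by
      refine (constOp_apply (A := S₁.A) hT (fun x y => (S₁.contDiffOn_K hT x y).continuousOn)
        hw ht α).trans (Finset.sum_congr rfl fun β _ => ?_)
      exact scalarOp_sub_coeff (hNc _ _) (hJc α β) (hwβ β).continuousOn ht
    have o5 : S₁.rhs (Fin.append d C) t α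
        = (φ (Sum.inl α) t - E α (ρ (φ (Sum.inr 0))) t)
          + (∑ y, (χ (Sum.inl α) y t - E α (ρ (χ (Sum.inr 0) y)) t) * d y
            + ∑ m : Fin κ, - E α (∂[T,m] R) t * C m) := by
      simp only [rhs, Pi.add_apply, mulVec_apply_eq_sum, Fin.sum_univ_add, Fin.append_left,
        Fin.append_right, S₁, Matrix.of_apply]
    simp only [Pi.add_apply, Pi.sub_apply]
    change constOp T k (fun i => (B i).toBlocks₁₁) (fun u => (N u).toBlocks₁₁) w t α
      + constOp T k (fun i => (B i).toBlocks₁₂) (fun u => (N u).toBlocks₁₂) w₂ t α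
      - (P *ᵥ S.rhs d t) (Sum.inl α) = S₁.op w t α - S₁.rhs (Fin.append d C) t α
    rw [o1, o2, o3, o4, o5, hg]
    simp only [Finset.sum_sub_distrib, sub_mul, neg_mul, Finset.sum_neg_distrib, one_mul,
      mul_comm (d _), mul_comm (C _)]
    ring

end IDESystem

/-! ### Existence of differentiation steps and termination -/

namespace IDESystem

variable {T : ℝ}

/-- A differentiation step for a single purely integral equation. -/
theorem exists_diffStep (hT : 0 < T) {n p : ℕ} (S : IDESystem T n p) (hS : S.symbol.det ≠ 0)
    {q : Fin n → ℝ} (hq : q ≠ 0) (hqA : ∀ i ≤ S.order, q ᵥ* S.A i = 0) :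
    ∃ S' : IDESystem T n p, DiffStep S S' := by
  have hu := uniqueDiffOn_Icc hT
  have h0 : (0 : ℝ) ∈ Icc 0 T := left_mem_Icc.2 hT.le
  obtain ⟨r, hr⟩ := Function.ne_iff.1 hq
  let P : Matrix (Fin n) (Fin n) ℝ := (1 : Matrix _ _ ℝ).updateRow r q
  have hPr : P r = q := Matrix.updateRow_self
  have hP : P.det ≠ 0 := by
    have : P.det = q r := by
      simp only [P]
      rw [← Matrix.cramer_transpose_apply, Matrix.transpose_one, Matrix.cramer_one]
      rfl
    rw [this]
    exact hr
  have hpure : ∀ i ≤ S.order, ∀ b, (P * S.A i) r b = 0 := by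
    intro i hi b
    rw [Matrix.mul_apply_eq_vecMul, hPr, hqA i hi]
    rfl
  let K₂ : Fin n → Fin n → ℝ → ℝ := fun a b u => (P * S.K u) a b
  have hK : ∀ a b, AnalyticOnNhd ℝ (K₂ a b) (Icc 0 T) := analyticOnNhd_mul_left P S.analytic_K
  -- If all derivatives at `0` vanished, the row of the symbol would be zero and the determinant
  -- with it. This is where nonvanishing of the determinant guarantees that a step is available.
  have hex : ∃ i, ∃ b, iteratedDeriv i (K₂ r b) 0 ≠ 0 := by
    by_contra! hno
    have hz : ∀ b, (P.map PowerSeries.C * S.symbol) r b = 0 := by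
      intro b
      rw [symbol, ← matrixSymbol_mul_left hT _ P S.A (S.contDiffOn_K hT)]
      change scalarSymbol T S.order (fun i => (P * S.A i) r b) (K₂ r b) = 0
      ext e
      rw [scalarSymbol, PowerSeries.coeff_mk, map_zero]
      split_ifs with he
      · exact hpure _ (by omega) b
      · rw [iteratedDerivWithin_eq_of_analytic hT (hK r b) _ h0, hno]
    have hd := Matrix.det_eq_zero_of_row_eq_zero r hz
    rw [Matrix.det_mul] at hd
    exact mul_ne_zero (det_map_C_ne_zero hP) hS hd
  classical
  let m := Nat.find hex
  have hm : ∃ b, iteratedDeriv m (K₂ r b) 0 ≠ 0 := Nat.find_spec hex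
  have hmin : ∀ i < m, ∀ b, iteratedDeriv i (K₂ r b) 0 = 0 := by
    intro i hi b
    by_contra h
    exact Nat.find_min hex hi ⟨b, h⟩
  let φ : Fin n → ℝ → ℝ := fun x t => (P *ᵥ S.f t) x
  let χ : Fin n → Fin p → ℝ → ℝ := fun x y t => (P * S.W t) x y
  have hφ : ∀ x, ContDiffOn ℝ ∞ (φ x) (Icc 0 T) := contDiffOn_mulVec P S.smooth_f
  have hχ : ∀ x y, ContDiffOn ℝ ∞ (χ x y) (Icc 0 T) := contDiffOn_matrix_mul_left P S.smooth_W
  have hg : ∀ (d : Fin p → ℝ) t x, (P *ᵥ S.rhs d t) x = φ x t + ∑ y, d y * χ x y t := by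
    intro d t x
    simp only [rhs, φ, χ]
    rw [Matrix.mulVec_add, Pi.add_apply, Matrix.mulVec_mulVec, mulVec_apply_eq_sum (P * S.W t)]
    congr 1
    exact Finset.sum_congr rfl fun y _ => mul_comm _ _
  let S' : IDESystem T n p :=
    { order := S.order
      A := fun i => Matrix.of fun a b =>
        if a = r then (if i = 0 then iteratedDeriv m (K₂ r b) 0 else 0) else (P * S.A i) a b
      K := fun u => Matrix.of fun a b =>
        if a = r then iteratedDeriv (m + 1) (K₂ r b) u else K₂ a b u
      W := fun t => Matrix.of fun a y => if a = r then ∂[T,(m + 1)] (χ r y) t else χ a y t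
      f := fun t a => if a = r then ∂[T,(m + 1)] (φ r) t else φ a t
      analytic_K := fun a b => by
        by_cases h : a = r
        · simp only [Matrix.of_apply, h, if_true]
          exact (hK r b).iteratedDeriv_on _
        · simp only [Matrix.of_apply, h, if_false]
          exact hK a b
      smooth_W := fun a y => by
        by_cases h : a = r
        · simp only [Matrix.of_apply, h, if_true]
          exact contDiffOn_infty_iteratedDerivWithin hT (hχ r y) _
        · simp only [Matrix.of_apply, h, if_false]
          exact hχ a y
      smooth_f := contDiffOn_pi.2 fun a => by
        by_cases h : a = r
        · simp only [h, if_true]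
          exact contDiffOn_infty_iteratedDerivWithin hT (hφ r) _
        · simp only [h, if_false]
          exact hφ a }
  have hrhs : ∀ (d : Fin p → ℝ) t x, S'.rhs d t x
      = (if x = r then ∂[T,(m + 1)] (φ r) t else φ x t)
        + ∑ y, (if x = r then ∂[T,(m + 1)] (χ r y) t else χ x y t) * d y := fun _ _ _ => rfl
  refine ⟨S', P, {r}, m + 1, hP, Finset.singleton_nonempty r, by omega, rfl, ?_, ?_, ?_, ?_, ?_⟩
  · intro a ha i hi b
    rw [Finset.mem_singleton.1 ha]
    exact hpure i hi b
  · intro i hi a ha b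
    rw [Finset.mem_singleton.1 ha]
    exact hmin i (by omega) b
  · exact ⟨r, Finset.mem_singleton_self r, hm⟩
  · intro a ha
    obtain rfl := Finset.mem_singleton.1 ha
    refine ⟨fun b => ?_, fun i h1 _ b => ?_, fun u _ b => ?_, fun d t ht => ?_⟩
    · simp only [S', Matrix.of_apply, if_true, Nat.add_sub_cancel, K₂]
    · simp only [S', Matrix.of_apply, if_true]
      rw [if_neg (by omega)]
    · simp only [S', Matrix.of_apply, if_true, K₂]
    · have hd : ∀ y ∈ Finset.univ, ContDiffWithinAt ℝ (m + 1 : ℕ) (fun s => d y * χ a y s)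
          (Icc 0 T) t := fun y _ =>
        (contDiffOn_const.mul (contDiffOn_nat_of_infty (hχ a y) (m + 1))) t ht
      simp only [hg]
      rw [hrhs, if_pos rfl, iteratedDerivWithin_fun_add ht hu
        (contDiffOn_nat_of_infty (hφ a) (m + 1) t ht) (ContDiffWithinAt.sum hd),
        iteratedDerivWithin_fun_sum ht hu hd]
      congr 1
      refine Finset.sum_congr rfl fun y _ => ?_
      rw [if_pos rfl, iteratedDerivWithin_const_mul_field, mul_comm]
  · intro a ha
    rw [Finset.mem_singleton] at ha
    refine ⟨fun i _ b => ?_, fun u _ b => ?_, fun d t _ => ?_⟩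
    · simp only [S', Matrix.of_apply, if_neg ha]
    · simp only [S', Matrix.of_apply, if_neg ha, K₂]
    · rw [hg, hrhs]
      simp only [if_neg ha, mul_comm]

/-- A row in the left kernel of the leading coefficient that does not annihilate all coefficients
gives rise to a splitting step. -/
theorem exists_splitStep_of_vecMul (hT : 0 < T) {n₁ p : ℕ} (S : IDESystem T (n₁ + 1) p)
    {q : Fin (n₁ + 1) → ℝ} (hq : q ≠ 0) (hqA : q ᵥ* S.A S.order = 0)
    (hex : ∃ i ≤ S.order, q ᵥ* S.A i ≠ 0) :
    ∃ (κ : ℕ) (S₁ : IDESystem T n₁ (p + κ)), SplitStep S S₁ := by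
  have := Classical.decPred fun i => q ᵥ* S.A i ≠ 0
  obtain ⟨i₀, hi₀, hqi₀⟩ := hex
  -- The order of the combined equation; it is below `k` because `q` annihilates the leading
  -- coefficient.
  let κ := Nat.findGreatest (fun i => q ᵥ* S.A i ≠ 0) S.order
  have hκ : q ᵥ* S.A κ ≠ 0 := Nat.findGreatest_spec (P := fun i => q ᵥ* S.A i ≠ 0) hi₀ hqi₀
  have hκk : κ < S.order := by
    refine lt_of_le_of_ne (Nat.findGreatest_le _) fun h => hκ ?_
    rw [h, hqA]
  have hmax : ∀ i, κ < i → i ≤ S.order → q ᵥ* S.A i = 0 := fun i h1 h2 => by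
    by_contra h
    exact Nat.findGreatest_is_greatest h1 h2 h
  obtain ⟨P, P', hPP', hP'P, hPq⟩ := exists_invertible_with_row hq
  -- Completing `q A_κ` to an invertible matrix and inverting it turns this row into the last unit
  -- vector. The last unknown then enters at order `κ` with coefficient `1`, the others only at
  -- lower order.
  obtain ⟨Q', Q, hQ'Q, hQQ', hQq⟩ := exists_invertible_with_row hκ
  have hrow : ∀ i x, (P * S.A i * Q) (Sum.inr 0) x = ((q ᵥ* S.A i) ᵥ* Q) x := fun i x => by
    rw [Matrix.mul_apply_eq_vecMul, Matrix.mul_apply_eq_vecMul, hPq]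
  have hκrow : ∀ x, (P * S.A κ * Q) (Sum.inr 0) x
      = (1 : Matrix (Fin n₁ ⊕ Fin 1) (Fin n₁ ⊕ Fin 1) ℝ) (Sum.inr 0) x := fun x => by
    rw [hrow, ← hQq, ← Matrix.mul_apply_eq_vecMul, hQ'Q]
  exact ⟨κ, exists_splitStep hT S hκk P Q' Q P' ⟨hPP', hP'P⟩ ⟨hQQ', hQ'Q⟩
    (fun i h1 h2 x => by rw [hrow, hmax i h1 h2, Matrix.zero_vecMul]; rfl)
    (fun β => by rw [hκrow, Matrix.one_apply_ne (by simp)])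
    (by rw [hκrow, Matrix.one_apply_eq])⟩

/-- Lexicographic induction: a splitting lowers the number of unknowns, while a differentiation
keeps it and lowers the order of the determinant. The determinant stays nonzero, so a singular
leading coefficient always admits one of the two. -/
theorem canReduce_of_det_symbol_ne_zero (hT : 0 < T) {n p : ℕ} (S : IDESystem T n p)
    (hS : S.symbol.det ≠ 0) : S.CanReduce := by
  induction n generalizing p with
  | zero => exact CanReduce.done S (by rw [Matrix.det_isEmpty]; exact one_ne_zero)
  | succ n₁ ih =>
    induction ho : S.symbol.det.order using WellFoundedLT.induction generalizing S with
    | _ o ih' =>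
      by_cases hA : (S.A S.order).det = 0
      · obtain ⟨q, hq, hqA⟩ := Matrix.exists_vecMul_eq_zero_iff.2 hA
        by_cases hex : ∃ i ≤ S.order, q ᵥ* S.A i ≠ 0
        · obtain ⟨κ, S₁, h⟩ := exists_splitStep_of_vecMul hT S hq hqA hex
          exact CanReduce.split S S₁ h (ih S₁ ((det_symbol_ne_zero_iff_of_splitStep hT h).1 hS))
        · push Not at hex
          obtain ⟨S', h⟩ := exists_diffStep hT S hS hq hex
          exact CanReduce.differentiate S S' h (ih' _ (ho ▸ order_det_symbol_lt_of_diffStep hT h hS)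
            S' ((det_symbol_ne_zero_iff_of_diffStep hT h).1 hS) rfl)
      · exact CanReduce.done S hA

end IDESystem

theorem theorem4 (T : ℝ) (hT : 0 < T) (n : ℕ) (S : IDESystem T n 0)
    (hk : 1 ≤ S.order) (hdet : (S.A S.order).det = 0) :
    S.CanReduce ↔ S.HasLRO :=
  ⟨fun h => S.hasLRO_of_det_symbol_ne_zero hT (IDESystem.det_symbol_ne_zero_of_canReduce hT h),
    fun h => S.canReduce_of_det_symbol_ne_zero hT (S.det_symbol_ne_zero_of_hasLRO hT h)⟩
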